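/- For $\Lambda>0$ let $\Omega_\Lambda:=\mathbb R\times\mathbb T_\Lambda^2$ with $\mathbb T_\Lambda=[0,\Lambda]$; functions on $\Omega_\Lambda$ are identified with functions on $\mathbb R^3$ that are $\Lambda$-periodic in $x_2$ and $x_3$, norms are taken over $\mathbb R\times[0,\Lambda]^2$, and derivatives are weak derivatives. Let $n=3$, let $m\ge 1$ be an integer and let $1\le q,r\le+\infty$. For $1\le k\le 3$, an integer $0\le j<m$ and $1\le p\le+\infty$, consider numbers $\theta_k$ with $$\frac1p=\frac jk+\Big(\frac1r-\frac mk\Big)\theta_k+\frac1q(1-\theta_k),\qquad \frac jm\le\theta_k\le 1. \tag{1}$$ (i) There are positive constants $C=C(m,q,r,k,j,p,\theta_k)$, independent of $\Lambda$ and $u$, with the following property. For every $\Lambda>0$ and every real-valued $u\in L^q(\Omega_\Lambda)$, periodic in $x_2$ and $x_3$, with $\nabla^m u\in L^r(\Omega_\Lambda)$, there is a decomposition $u=\sum_{k=1}^3u^{(k)}$ into functions periodic in $x_2,x_3$ such that for all $1\le k\le 3$, all integers $0\le j<m$ and all $1\le p\le+\infty$, $\theta_k$ satisfying (1), $$\|\nabla^ju^{(k)}\|_{L^p(\Omega_\Lambda)}\le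 C\,\Lambda^{-\frac{n-k}{k}(m\theta_k-j)}\,\|\nabla^mu\|_{L^r(\Omega_\Lambda)}^{\theta_k}\,\|u\|_{L^q(\Omega_\Lambda)}^{1-\theta_k},$$ except in the following cases: (a) $k=3$, $\theta_3=1$, $1<r<\infty$ and $m-j-\frac3r$ is a nonnegative integer; (b) $j=0$, $q=\infty$, $\theta_k>0$, and either $k=1$, $m=r=1$, or $k=3$, $r>1$, $m=\frac3r$. (ii) Let $0\le j<m$ be an integer, $1\le p\le+\infty$, and let $\theta_1,\theta_2,\theta_3$ satisfy (1) for $k=1,2,3$ respectively with the same $j$ and $p$, case (a) being excluded. Then there is a constant $C>0$, independent of $\Lambda$ and $u$, such that for every $\Lambda>0$ and every $u$ as in (i), $$\|\nabla^ju\|_{L^p(\Omega_\Lambda)}\le C\sum_{k=1}^3\Lambda^{-\frac{n-k}{k}(m\theta_k-j)}\,\|\nabla^mu\|_{L^r(\Omega_\Lambda)}^{\theta_k}\,\|u\|_{L^q(\Omega_\Lambda)}^{1-\theta_k}.$$ Powers with exponent $0$ are equal to $1$. -/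

import Mathlib

open MeasureTheory
open scoped ENNReal ContDiff

/-- Three-dimensional Euclidean space; the coordinates `x₁, x₂, x₃` are `x 0, x 1, x 2`. -/
abbrev E3 : Type := EuclideanSpace ℝ (Fin 3)

/-- The standard basis vector in direction `i`. -/
noncomputable def stdBasis3 (i : Fin 3) : E3 := EuclideanSpace.single i 1

/-- The cell `ℝ × [0, Λ]²` representing `Ω_Λ = ℝ × 𝕋_Λ²`. -/
def cell (Λ : ℝ) : Set E3 := {x | x 1 ∈ Set.Icc 0 Λ ∧ x 2 ∈ Set.Icc 0 Λ}

/-- Lebesgue measure on `Ω_Λ`. -/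
noncomputable def cellMeasure (Λ : ℝ) : Measure E3 := volume.restrict (cell Λ)

/-- `u` is periodic with period `Λ` in `x₂` and in `x₃`, i.e. it is a function on `Ω_Λ`. -/
def TransversallyPeriodic (Λ : ℝ) (u : E3 → ℝ) : Prop :=
  ∀ x, u (x + Λ • stdBasis3 1) = u x ∧ u (x + Λ • stdBasis3 2) = u x

/-- The values of `∇^m u`: the component at `I = (i₁, …, i_m)` stands for `∂_{i₁} ⋯ ∂_{i_m} u`,
and `|∇^m u|` is the Euclidean norm of the family of all components. -/
abbrev GradTensor (m : ℕ) : Type := EuclideanSpace ℝ (Fin m → Fin 3)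

/-- `G` is the `m`-th gradient `∇^m u` of `u` in the weak (distributional) sense. Nothing is
required of the derivatives of order strictly between `0` and `m`. -/
def IsWeakGradient (m : ℕ) (u : E3 → ℝ) (G : E3 → GradTensor m) : Prop :=
  LocallyIntegrable u ∧ LocallyIntegrable G ∧
  ∀ φ : E3 → ℝ, ContDiff ℝ ∞ φ → HasCompactSupport φ → ∀ I : Fin m → Fin 3,
    ∫ x, u x * iteratedFDeriv ℝ m φ x (fun l => stdBasis3 (I l))
      = (-1) ^ m * ∫ x, G x I * φ x

/-- `1/p` as a real number, with `1/∞ = 0`. -/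
noncomputable def recip (p : ℝ≥0∞) : ℝ := (p⁻¹).toReal

/-- The relation between the exponents in the `k`-dimensional Gagliardo-Nirenberg inequality. -/
def GNRelation (k m j : ℕ) (q r p : ℝ≥0∞) (θ : ℝ) : Prop :=
  recip p = (j : ℝ) / k + (recip r - (m : ℝ) / k) * θ + recip q * (1 - θ) ∧
    (j : ℝ) / m ≤ θ ∧ θ ≤ 1

/-- The classical critical case of the three-dimensional inequality: `θ = 1`, `1 < r < ∞`, and
`m - j - 3/r` is a nonnegative integer. -/
def GNCritical (m j : ℕ) (r : ℝ≥0∞) (θ : ℝ) : Prop :=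
  θ = 1 ∧ 1 < r ∧ r < ⊤ ∧ ∃ N : ℕ, (m : ℝ) - j - 3 * recip r = N

/-- The degenerate cases: `j = 0`, `q = ∞`, `θ > 0`, and either `k = 1`, `m = r = 1`, or `k = 3`,
`r > 1`, `m = 3/r`. Here the `k`-dimensional inequality would bound `‖u‖_∞` by
`‖∇^m u‖_r ^ θ ‖u‖_∞ ^ (1 - θ)`, which fails on a nonzero constant if `k = 1` and on functions with
a logarithmic peak if `k = 3`. -/
def GNDegenerate (k m j : ℕ) (q r : ℝ≥0∞) (θ : ℝ) : Prop :=
  j = 0 ∧ q = ⊤ ∧ 0 < θ ∧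
    ((k = 1 ∧ m = 1 ∧ r = 1) ∨ (k = 3 ∧ 1 < r ∧ (m : ℝ) = 3 * recip r))

/-- The factor `Λ ^ (-((n - k)/k) (m θ - j))` with `n = 3`. -/
noncomputable def periodFactor (Λ : ℝ) (k m j : ℕ) (θ : ℝ) : ℝ :=
  Λ ^ (-((3 - (k : ℝ)) / k) * (m * θ - j))

/-!
Let `v` be the transverse mean of `u`, that is, the mean of `u` over the torus fibres
`{x₁} × [0, Λ]²`. It depends on `x₁` alone, so it is a function on the line, and it satisfies the
one-dimensional Gagliardo-Nirenberg inequality; the powers of `Λ` come from the area `Λ²` of the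
fibres. The remainder `u - v` has vanishing transverse mean. For such functions Poincaré's inequality
holds with a constant proportional to `Λ` (`eLpNorm_le_of_isMeanZero`), so that all the terms of lower
order that distinguish the cylinder from `ℝ³` are absorbed, and the three-dimensional inequality holds
without any power of `Λ`. These two pieces are the components `k = 1` and `k = 3` of the decomposition;
the component `k = 2` may be taken to be zero.

Both pieces are first treated as smooth functions with bounded derivatives. The common core is
Nirenberg's inequality for `θ = j/m` and arbitrary `q`, `r` (`exists_eLpNorm_pderivs_le`). It is
one-dimensional. On an interval of length `L`, the `j`-th derivative is bounded by a sum of two terms,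
one with `u` and a negative power of `L`, the other with the `m`-th derivative and a positive power of
`L`. At each point where the derivative does not vanish, some `L` balances the two terms
(`exists_balanced_scale`), and there the sum may be replaced by a product; a Besicovitch covering by the balanced intervals
(`exists_setLIntegral_le_of_forall_closedBall`) yields the estimate on a line, and averaging over
parallel lines the one on the cylinder. Mixed derivatives are treated one direction at a time. This
inequality is applied in two ways. It reduces derivatives of order `j` to order zero, with `m - j` in
place of `m` (`GNBound.of_order_zero`). For `q = ∞` it also bounds first derivatives by the `m`-th
derivatives and by the supremum of `u`; a bound of the supremum by first derivatives hence implies one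
by `m`-th derivatives, because the supremum on the right-hand side can be absorbed (`SupBound.of_one`).

Order zero is an interpolation between `L^q` and one endpoint. On the line, and for `m > 3/r` in
dimension three, the endpoint is a supremum bound, obtained from the fundamental theorem of calculus
(`supBound_one_of_isLongitudinal`) and from Morrey's estimate (`supBound_one_of_isMeanZero`),
respectively. If `m < 3/r`, it is Sobolev's inequality, carried over to the cylinder by cutoff functions
(`exists_eLpNorm_le_of_isMeanZero`). The borderline `m = 3/r` splits into the embedding of `W^{3,1}` into
bounded functions (`abs_le_of_pderivs_three`) and, for `r > 1`, the inclusion into all `L^p` with `p < ∞`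
(`exists_eLpNorm_le_of_critical`), which is why `θ = 1` is excluded there. The results are
`gnBound_of_isLongitudinal` and `gnBound_of_isMeanZero`.

General `u` is approximated by mollification. The derivatives of intermediate order of the approximants
are Cauchy in `L¹` on balls, because they are locally controlled by the derivatives of order `0` and `m`
(`exists_ballNorm_pderivs_le`); their limits are weak derivatives, and the inequalities pass to the limit
by Fatou's lemma (`exists_isWeakGradient_of_locTendsto`, `exists_decomposition`). The second part follows
by adding up, unless one of the inequalities is degenerate; but then `j = 0` and `p = q = ∞`, one of `θ₁`,
`θ₃` vanishes (`theta_eq_zero_of_degenerate`), and the corresponding summand is `‖u‖_∞` itself.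
-/

open scoped NNReal

/-! ### Iterated partial derivatives of smooth functions -/

/-- The partial derivative of `u` in direction `i`. -/
noncomputable def pderiv (i : Fin 3) (u : E3 → ℝ) (x : E3) : ℝ := fderiv ℝ u x (stdBasis3 i)

/-- The iterated partial derivative `∂_{i₁} ⋯ ∂_{i_n} u` for a list `[i₁, …, i_n]` of directions. -/
noncomputable def pderivs : List (Fin 3) → (E3 → ℝ) → E3 → ℝ
  | [], u => u
  | i :: l, u => pderiv i (pderivs l u)

theorem contDiff_pderiv {u : E3 → ℝ} (hu : ContDiff ℝ ∞ u) (i : Fin 3) :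
    ContDiff ℝ ∞ (pderiv i u) := by
  unfold pderiv
  exact (hu.fderiv_right (m := ∞) (by norm_cast)).clm_apply contDiff_const

theorem contDiff_pderivs {u : E3 → ℝ} (hu : ContDiff ℝ ∞ u) (l : List (Fin 3)) :
    ContDiff ℝ ∞ (pderivs l u) := by
  induction l with
  | nil => exact hu
  | cons i l ih => exact contDiff_pderiv ih i

theorem pderivs_append (l l' : List (Fin 3)) (u : E3 → ℝ) :
    pderivs (l ++ l') u = pderivs l (pderivs l' u) := by
  induction l with
  | nil => rfl
  | cons i l ih => simp [pderivs, ih]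

theorem pderiv_comm {u : E3 → ℝ} (hu : ContDiff ℝ ∞ u) (i j : Fin 3) :
    pderiv i (pderiv j u) = pderiv j (pderiv i u) := by
  have hd : Differentiable ℝ (fderiv ℝ u) :=
    (hu.fderiv_right (m := ∞) (by norm_cast)).differentiable (by simp)
  have key (a b : Fin 3) (x : E3) : pderiv a (pderiv b u) x =
      fderiv ℝ (fderiv ℝ u) x (stdBasis3 a) (stdBasis3 b) := by
    unfold pderiv
    rw [fderiv_clm_apply (hd x) (differentiableAt_const _)]
    simp
  funext x
  rw [key, key]
  exact (hu.contDiffAt.isSymmSndFDerivAt (by simp; norm_cast)) _ _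

theorem pderivs_perm {u : E3 → ℝ} (hu : ContDiff ℝ ∞ u) {l l' : List (Fin 3)} (h : l.Perm l') :
    pderivs l u = pderivs l' u := by
  induction h with
  | nil => rfl
  | cons i _ ih => simp [pderivs, ih]
  | swap i j l => exact pderiv_comm (contDiff_pderivs hu l) _ _
  | trans _ _ ih1 ih2 => exact ih1.trans ih2

theorem iteratedFDeriv_eq_pderivs {u : E3 → ℝ} (hu : ContDiff ℝ ∞ u) {m : ℕ} (I : Fin m → Fin 3)
    (x : E3) :
    iteratedFDeriv ℝ m u x (fun l => stdBasis3 (I l)) = pderivs (List.ofFn I) u x := by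
  induction m generalizing x with
  | zero => simp [pderivs]
  | succ m ih =>
    rw [iteratedFDeriv_succ_apply_left, List.ofFn_succ]
    simp only [pderivs, pderiv]
    have hd : DifferentiableAt ℝ (iteratedFDeriv ℝ m u) x :=
      (hu.differentiable_iteratedFDeriv (by exact_mod_cast WithTop.coe_lt_top m)) x
    have : pderivs (List.ofFn fun i => I i.succ) u =
        fun y => iteratedFDeriv ℝ m u y (fun l => stdBasis3 (I l.succ)) := by
      funext y; exact (ih (fun i => I i.succ) y).symm
    rw [this, fderiv_continuousMultilinear_apply_const_apply hd]
    rfl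

theorem hasDerivAt_line {u : E3 → ℝ} (hu : ContDiff ℝ ∞ u) (i : Fin 3) (x : E3) (t : ℝ) :
    HasDerivAt (fun s : ℝ => u (x + s • stdBasis3 i)) (pderiv i u (x + t • stdBasis3 i)) t := by
  have h1 : HasFDerivAt u (fderiv ℝ u (x + t • stdBasis3 i)) (x + t • stdBasis3 i) :=
    (hu.differentiable (by simp) _).hasFDerivAt
  have h2 : HasDerivAt (fun s : ℝ => x + s • stdBasis3 i) (stdBasis3 i) t := by
    simpa using! ((hasDerivAt_id t).smul_const (stdBasis3 i)).const_add x
  exact h1.comp_hasDerivAt t h2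

theorem iteratedDeriv_line {u : E3 → ℝ} (hu : ContDiff ℝ ∞ u) (i : Fin 3) (x : E3) (n : ℕ) :
    iteratedDeriv n (fun s : ℝ => u (x + s • stdBasis3 i)) =
      fun t => pderivs (List.replicate n i) u (x + t • stdBasis3 i) := by
  induction n with
  | zero => simp [pderivs]
  | succ n ih =>
    rw [iteratedDeriv_succ, ih]
    funext t
    exact (hasDerivAt_line (contDiff_pderivs hu _) i x t).deriv

theorem contDiff_line {u : E3 → ℝ} (hu : ContDiff ℝ ∞ u) (i : Fin 3) (x : E3) :
    ContDiff ℝ ∞ (fun s : ℝ => u (x + s • stdBasis3 i)) := by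
  fun_prop

/-! ### Interior estimates for intermediate derivatives on an interval -/

theorem abs_le_integral_of_iteratedDeriv_eq_zero {m : ℕ} (hm : 1 ≤ m) {f : ℝ → ℝ}
    (hf : ContDiff ℝ ∞ f) (h0 : ∀ i < m, iteratedDeriv i f 0 = 0) {t : ℝ} (ht : t ∈ Set.Icc (0 : ℝ) 1) :
    |f t| ≤ ∫ s in (0 : ℝ)..1, |iteratedDeriv m f s| := by
  induction m, hm using Nat.le_induction generalizing f t with
  | base =>
    have hd : ∀ s, HasDerivAt f (deriv f s) s := fun s =>
      (hf.differentiable (by simp) s).hasDerivAt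
    have hc : Continuous (deriv f) := hf.continuous_deriv (by simp)
    have h1 : f t = ∫ s in (0 : ℝ)..t, deriv f s := by
      rw [intervalIntegral.integral_eq_sub_of_hasDerivAt (fun s _ => hd s) (hc.intervalIntegrable _ _)]
      have := h0 0 (by norm_num)
      simp at this
      simp [this]
    rw [h1, iteratedDeriv_one]
    refine (intervalIntegral.abs_integral_le_integral_abs ht.1).trans ?_
    exact intervalIntegral.integral_mono_interval le_rfl ht.1 ht.2
      (Filter.Eventually.of_forall fun s => abs_nonneg _) (hc.abs.intervalIntegrable _ _)
  | succ m hm ih =>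
    have hd : ∀ s, HasDerivAt f (deriv f s) s := fun s =>
      (hf.differentiable (by simp) s).hasDerivAt
    have hc : Continuous (deriv f) := hf.continuous_deriv (by simp)
    have hf' : ContDiff ℝ ∞ (deriv f) := ((contDiff_infty_iff_deriv).1 hf).2
    have h1 : f t = ∫ s in (0 : ℝ)..t, deriv f s := by
      rw [intervalIntegral.integral_eq_sub_of_hasDerivAt (fun s _ => hd s) (hc.intervalIntegrable _ _)]
      have := h0 0 (by norm_num)
      simp at this
      simp [this]
    have h2 : ∀ s ∈ Set.Icc (0 : ℝ) 1, |deriv f s| ≤ ∫ s in (0 : ℝ)..1, |iteratedDeriv (m + 1) f s| := by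
      intro s hs
      rw [iteratedDeriv_succ']
      exact ih hf' (fun i hi => by rw [← iteratedDeriv_succ']; exact h0 _ (by omega)) hs
    rw [h1, ← Real.norm_eq_abs]
    refine (intervalIntegral.norm_integral_le_of_norm_le_const (C := ∫ s in (0 : ℝ)..1, |iteratedDeriv (m + 1) f s|) ?_).trans ?_
    · intro s hs
      rw [Set.uIoc_of_le ht.1] at hs
      exact h2 s ⟨hs.1.le, hs.2.trans ht.2⟩
    · have := (abs_nonneg _).trans (h2 0 (by simp))
      rw [sub_zero, abs_of_nonneg ht.1]
      exact mul_le_of_le_one_right this ht.2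

/-- The coefficients of a polynomial of degree less than `m` are controlled by its `L¹` norm on
`[0, 1]`: all norms on a finite-dimensional space are equivalent. -/
theorem exists_coeff_le_integral (m : ℕ) : ∃ C : ℝ, 0 < C ∧ ∀ a : Fin m → ℝ, ∀ j,
    |a j| ≤ C * ∫ t in (0 : ℝ)..1, |∑ i, a i * t ^ (i : ℕ)| := by
  set N : (Fin m → ℝ) → ℝ := fun a => ∫ t in (0 : ℝ)..1, |∑ i, a i * t ^ (i : ℕ)| with hN
  have hcont : Continuous N := by
    apply intervalIntegral.continuous_parametric_intervalIntegral_of_continuous'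
    fun_prop
  have hpos : ∀ a ∈ Metric.sphere (0 : Fin m → ℝ) 1, 0 < N a := by
    intro a ha
    have hcf : Continuous fun t : ℝ => |∑ i, a i * t ^ (i : ℕ)| := by fun_prop
    rcases (intervalIntegral.integral_nonneg (μ := volume) (zero_le_one' ℝ)
      (fun t _ => abs_nonneg (∑ i, a i * t ^ (i : ℕ)))).lt_or_eq with h | h
    · exact h
    exfalso
    have hz : ∀ t ∈ Set.Ioo (0 : ℝ) 1, (∑ i, a i * t ^ (i : ℕ)) = 0 := by
      have := (intervalIntegral.integral_eq_zero_iff_of_nonneg_ae (μ := volume) (a := 0) (b := 1)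
        (f := fun t : ℝ => |∑ i, a i * t ^ (i : ℕ)|)
        (Filter.Eventually.of_forall fun t => abs_nonneg _)
        (hcf.intervalIntegrable _ _)).1 h.symm
      have h2 := Measure.eqOn_open_of_ae_eq (U := Set.Ioo (0:ℝ) 1) (μ := volume) (f := fun t : ℝ => |∑ i, a i * t ^ (i : ℕ)|)
        (g := fun _ => 0) ?_ isOpen_Ioo hcf.continuousOn continuousOn_const
      · intro t ht
        simpa using h2 ht
      · refine ae_mono (Measure.restrict_mono ?_ le_rfl) this
        intro t ht
        exact Or.inl ⟨ht.1, ht.2.le⟩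
    set P : Polynomial ℝ := ∑ i, Polynomial.C (a i) * Polynomial.X ^ (i : ℕ) with hP
    have hev : ∀ t, P.eval t = ∑ i, a i * t ^ (i : ℕ) := by
      intro t; simp [hP, Polynomial.eval_finsetSum]
    have hP0 : P = 0 := by
      apply Polynomial.eq_zero_of_infinite_isRoot
      apply (Set.Ioo_infinite (zero_lt_one' ℝ)).mono
      intro t ht
      simp only [Set.mem_ofPred_eq, Polynomial.IsRoot, hev]
      exact hz t ht
    have ha0 : a = 0 := by
      funext j
      have : P.coeff j = a j := by
        simp [hP, Polynomial.finsetSum_coeff, Polynomial.coeff_X_pow, Fin.val_inj]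
      rw [← this, hP0]; simp
    rw [ha0] at ha
    simp at ha
  have hscale : ∀ (c : ℝ) (a : Fin m → ℝ), N (c • a) = |c| * N a := by
    intro c a
    simp only [hN]
    rw [← intervalIntegral.integral_const_mul]
    congr 1; funext t
    rw [← abs_mul, Finset.mul_sum]
    simp [mul_assoc]
  rcases (Metric.sphere (0 : Fin m → ℝ) 1).eq_empty_or_nonempty with he | hne
  · refine ⟨1, one_pos, fun a j => ?_⟩
    exfalso
    have : (Pi.single j 1 : Fin m → ℝ) ∈ Metric.sphere (0 : Fin m → ℝ) 1 := by
      simp [Pi.norm_single]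
    rw [he] at this; exact this
  obtain ⟨a0, ha0, hmin⟩ := (isCompact_sphere (0 : Fin m → ℝ) 1).exists_isMinOn hne hcont.continuousOn
  have hc := hpos a0 ha0
  refine ⟨(N a0)⁻¹, inv_pos.2 hc, fun a j => ?_⟩
  rw [← div_eq_inv_mul, le_div_iff₀ hc]
  rcases eq_or_ne a 0 with rfl | hane
  · simp
  have hna : 0 < ‖a‖ := norm_pos_iff.2 hane
  have h1 : N a0 ≤ N (‖a‖⁻¹ • a) := hmin (by simp [norm_smul, hna.ne'])
  -- `N a0` is the minimum of the homogeneous function `N` on the unit sphere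
  rw [hscale, abs_of_pos (inv_pos.2 hna), ← div_eq_inv_mul, le_div_iff₀ hna] at h1
  calc |a j| * N a0 ≤ ‖a‖ * N a0 := by
        gcongr; exact norm_le_pi_norm a j
    _ ≤ N a := by linarith

/-- Up to a factorial, the derivative at `0` is a coefficient of the Taylor polynomial of degree less
than `m`, whose `L¹` norm is at most that of `f` plus that of the remainder. -/
theorem exists_iteratedDeriv_zero_le {m j : ℕ} (hj : j < m) : ∃ C : ℝ, 0 < C ∧
    ∀ f : ℝ → ℝ, ContDiff ℝ ∞ f → |iteratedDeriv j f 0| ≤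
      C * ((∫ t in (0 : ℝ)..1, |f t|) + ∫ t in (0 : ℝ)..1, |iteratedDeriv m f t|) := by
  obtain ⟨C, hC, h⟩ := exists_coeff_le_integral m
  refine ⟨j.factorial * C, by positivity, fun f hf => ?_⟩
  -- the Taylor polynomial `P` of degree less than `m` at `0`
  set a : Fin m → ℝ := fun i => iteratedDeriv i f 0 / (i : ℕ).factorial with ha
  set P : ℝ → ℝ := fun t => ∑ i, a i * t ^ (i : ℕ) with hP
  have hPc : ContDiff ℝ ∞ P := by fun_prop
  have hPd : ∀ n : ℕ, iteratedDeriv n P =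
      fun t => ∑ i : Fin m, a i * ((i : ℕ).descFactorial n * t ^ ((i : ℕ) - n)) := by
    intro n
    funext t
    simp only [hP]
    rw [iteratedDeriv_fun_sum (fun i _ => by fun_prop)]
    refine Finset.sum_congr rfl fun i _ => ?_
    rw [iteratedDeriv_const_mul_field, iteratedDeriv_pow]
  have hPm : iteratedDeriv m P = fun _ => 0 := by
    rw [hPd]; funext t
    refine Finset.sum_eq_zero fun i _ => ?_
    simp [Nat.descFactorial_eq_zero_iff_lt.2 i.2]
  have hP0 : ∀ n (hn : n < m), iteratedDeriv n P 0 = iteratedDeriv n f 0 := by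
    intro n hn
    rw [hPd]
    simp only
    rw [Finset.sum_eq_single (⟨n, hn⟩ : Fin m)]
    · simp [ha, Nat.descFactorial_self]
      field_simp
    · intro i _ hi
      rcases lt_or_gt_of_ne (Fin.val_ne_of_ne hi) with h | h
      · simp [Nat.descFactorial_eq_zero_iff_lt.2 h]
      · rw [zero_pow (by simp at h; omega)]; simp
    · simp
  have hsub : ∀ n t, iteratedDeriv n (fun t => f t - P t) t =
      iteratedDeriv n f t - iteratedDeriv n P t := fun n t =>
    iteratedDeriv_fun_sub (hf.of_le (by exact_mod_cast le_top)).contDiffAt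
      (hPc.of_le (by exact_mod_cast le_top)).contDiffAt
  have hrem : ∀ t ∈ Set.Icc (0 : ℝ) 1, |f t - P t| ≤ ∫ s in (0 : ℝ)..1, |iteratedDeriv m f s| := by
    intro t ht
    have := abs_le_integral_of_iteratedDeriv_eq_zero (m := m) (by omega) (hf.sub hPc)
      (fun i hi => by rw [hsub, hP0 i hi, sub_self]) ht
    simpa [hsub, hPm] using this
  have hfi : IntervalIntegrable (fun t => |f t|) volume 0 1 := hf.continuous.abs.intervalIntegrable _ _
  have hPi : IntervalIntegrable (fun t => |P t|) volume 0 1 := hPc.continuous.abs.intervalIntegrable _ _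
  have hPint : (∫ t in (0 : ℝ)..1, |P t|) ≤
      (∫ t in (0 : ℝ)..1, |f t|) + ∫ t in (0 : ℝ)..1, |iteratedDeriv m f t| := by
    have : (∫ t in (0 : ℝ)..1, |P t|) ≤
        ∫ t in (0 : ℝ)..1, (|f t| + ∫ s in (0 : ℝ)..1, |iteratedDeriv m f s|) := by
      refine intervalIntegral.integral_mono_on zero_le_one hPi (hfi.add (by simp)) fun t ht => ?_
      have h1 := hrem t ht
      have h2 : |P t| ≤ |f t| + |f t - P t| := by
        rw [abs_sub_comm]; have := abs_add_le (f t) (P t - f t); simpa using this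
      linarith
    rw [intervalIntegral.integral_add hfi (by simp)] at this
    simpa using this
  have h1 := h a ⟨j, hj⟩
  have h2 : |iteratedDeriv j f 0| = j.factorial * |a ⟨j, hj⟩| := by
    simp only [ha, abs_div, Nat.abs_cast]; field_simp
  rw [h2, mul_assoc]
  gcongr
  exact h1.trans (by gcongr)

/-- The preceding estimate on an interval of length `2L`, at an arbitrary point `y` of the interval. -/
theorem exists_iteratedDeriv_mul_pow_le {m j : ℕ} (hj : j < m) : ∃ C : ℝ, 0 < C ∧
    ∀ f : ℝ → ℝ, ContDiff ℝ ∞ f → ∀ x L : ℝ, 0 < L → ∀ y ∈ Set.Icc (x - L) (x + L),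
      |iteratedDeriv j f y| * L ^ (j + 1) ≤
        C * ((∫ t in (x - L)..(x + L), |f t|) +
          L ^ m * ∫ t in (x - L)..(x + L), |iteratedDeriv m f t|) := by
  obtain ⟨C, hC, h⟩ := exists_iteratedDeriv_zero_le hj
  refine ⟨C, hC, fun f hf x L hL y hy => ?_⟩
  -- of the two intervals of length `L` with endpoint `y`, one lies in `[x - L, x + L]`
  obtain ⟨c, hcL, hcI⟩ : ∃ c : ℝ, |c| = L ∧ ∀ g : ℝ → ℝ, Continuous g →
      L * ∫ t in (0 : ℝ)..1, |g (y + c * t)| ≤ ∫ t in (x - L)..(x + L), |g t| := by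
    rcases le_total y x with hyx | hyx
    · refine ⟨L, abs_of_pos hL, fun g hg => ?_⟩
      rw [intervalIntegral.integral_comp_add_mul (fun t => |g t|) hL.ne']
      simp only [mul_zero, add_zero, mul_one, smul_eq_mul]
      rw [mul_inv_cancel_left₀ hL.ne']
      exact intervalIntegral.integral_mono_interval hy.1 (by linarith) (by linarith)
        (Filter.Eventually.of_forall fun s => abs_nonneg _) (hg.abs.intervalIntegrable _ _)
    · refine ⟨-L, by simp [abs_of_pos hL], fun g hg => ?_⟩
      rw [intervalIntegral.integral_comp_add_mul (fun t => |g t|) (neg_ne_zero.2 hL.ne')]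
      simp only [mul_zero, add_zero, mul_one, smul_eq_mul]
      rw [intervalIntegral.integral_symm, inv_neg, neg_mul_neg, mul_inv_cancel_left₀ hL.ne']
      exact intervalIntegral.integral_mono_interval (by linarith) (by linarith) hy.2
        (Filter.Eventually.of_forall fun s => abs_nonneg _) (hg.abs.intervalIntegrable _ _)
  have hg : ContDiff ℝ ∞ fun t => f (y + c * t) := by fun_prop
  have hd : ∀ n, iteratedDeriv n (fun t => f (y + c * t)) =
      fun t => c ^ n * iteratedDeriv n f (y + c * t) := by
    intro n
    have h1 := iteratedDeriv_comp_const_mul (n := n) (f := fun s => f (y + s))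
      ((hf.comp (contDiff_const.add contDiff_id)).of_le (by exact_mod_cast le_top)) c
    rw [h1, iteratedDeriv_comp_const_add]
  have h1 := h _ hg
  simp only [hd, mul_zero, add_zero, abs_mul, abs_pow, hcL, intervalIntegral.integral_const_mul] at h1
  have h2 := hcI f hf.continuous
  have h3 := hcI (iteratedDeriv m f) (hf.continuous_iteratedDeriv m (by exact_mod_cast le_top))
  calc |iteratedDeriv j f y| * L ^ (j + 1) = L * (L ^ j * |iteratedDeriv j f y|) := by ring
    _ ≤ L * (C * ((∫ t in (0 : ℝ)..1, |f (y + c * t)|) +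
          L ^ m * ∫ t in (0 : ℝ)..1, |iteratedDeriv m f (y + c * t)|)) := by gcongr
    _ = C * (L * (∫ t in (0 : ℝ)..1, |f (y + c * t)|) +
          L ^ m * (L * ∫ t in (0 : ℝ)..1, |iteratedDeriv m f (y + c * t)|)) := by ring
    _ ≤ _ := by gcongr

/-! ### Balanced scales and the one-dimensional Nirenberg inequality -/

theorem recip_nonneg (p : ℝ≥0∞) : 0 ≤ recip p := ENNReal.toReal_nonneg

theorem recip_le_one {p : ℝ≥0∞} (hp : 1 ≤ p) : recip p ≤ 1 := by
  unfold recip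
  have : p⁻¹ ≤ 1 := by simpa using hp
  simpa using ENNReal.toReal_mono ENNReal.one_ne_top this

@[simp] theorem recip_top : recip ⊤ = 0 := by simp [recip]

theorem recip_eq_inv (p : ℝ≥0∞) : recip p = p.toReal⁻¹ := by simp [recip]

theorem recip_pos {p : ℝ≥0∞} (hp : 1 ≤ p) (hp' : p ≠ ⊤) : 0 < recip p := by
  rw [recip_eq_inv]
  exact inv_pos.2 (ENNReal.toReal_pos (by positivity) hp')

theorem recip_eq_zero_iff {p : ℝ≥0∞} (hp : 1 ≤ p) : recip p = 0 ↔ p = ⊤ := by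
  constructor
  · intro h; by_contra h'; exact (recip_pos hp h').ne' h
  · rintro rfl; simp

/-- Besicovitch's covering theorem turns an inequality on a ball around every point of `E`
into one on all of `E`. -/
theorem exists_setLIntegral_le_of_forall_closedBall : ∃ K : ℕ, ∀ (g w : ℝ → ℝ≥0∞) (E : Set ℝ)
    (a b N : ℝ), E ⊆ Set.Icc a b → (∀ x ∈ E, ∃ L, 0 < L ∧ L ≤ N ∧
      ∫⁻ t in Metric.closedBall x L, g t ≤ ∫⁻ t in Metric.closedBall x L, w t) →
    ∫⁻ t in E, g t ≤ K * ∫⁻ t in Set.Icc (a - N) (b + N), w t := by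
  obtain ⟨K, τ, hτ, hK⟩ := HasBesicovitchCovering.no_satelliteConfig (α := ℝ)
  refine ⟨K, fun g w E a b N hE h => ?_⟩
  choose L hL0 hLN hL using h
  obtain ⟨s, hs, hcov⟩ := Besicovitch.exist_disjoint_covering_families (β := E) hτ hK
    { c := fun x => x.1, r := fun x => L x.1 x.2, rpos := fun x => hL0 _ _, r_bound := N,
      r_le := fun x => hLN _ _ }
  simp only [Subtype.range_coe_subtype] at hcov
  have hcount : ∀ i, (s i).Countable := fun i =>
    (hs i).countable_of_nonempty_interior fun x _ =>
      ⟨x.1, Metric.ball_subset_interior_closedBall (Metric.mem_ball_self (hL0 _ _))⟩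
  have hone : ∀ i, ∫⁻ t in ⋃ x ∈ s i, Metric.closedBall x.1 (L x.1 x.2), g t ≤
      ∫⁻ t in Set.Icc (a - N) (b + N), w t := by
    intro i
    have := (hcount i).to_subtype
    calc _ ≤ ∑' x : s i, ∫⁻ t in Metric.closedBall x.1.1 (L x.1.1 x.1.2), g t := by
          rw [Set.biUnion_eq_iUnion]; exact lintegral_iUnion_le _ _
      _ ≤ ∑' x : s i, ∫⁻ t in Metric.closedBall x.1.1 (L x.1.1 x.1.2), w t :=
          ENNReal.tsum_le_tsum fun x => hL _ _
      _ = ∫⁻ t in ⋃ x ∈ s i, Metric.closedBall x.1 (L x.1 x.2), w t :=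
          (lintegral_biUnion (hcount i) (fun _ _ => Metric.isClosed_closedBall.measurableSet)
            (hs i) _).symm
      _ ≤ _ := by
          refine lintegral_mono_set (Set.iUnion₂_subset fun x _ => ?_)
          rw [Real.closedBall_eq_Icc]
          have := hE x.2
          have h2 := hLN x.1 x.2
          exact Set.Icc_subset_Icc (by linarith [this.1]) (by linarith [this.2])
  have hEs : E ⊆ ⋃ i, ⋃ x ∈ s i, Metric.closedBall x.1 (L x.1 x.2) := by
    refine Set.Subset.trans (fun x hx => hcov hx) ?_
    exact Set.iUnion_mono fun i => Set.iUnion₂_mono fun x _ => Metric.ball_subset_closedBall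
  calc ∫⁻ t in E, g t ≤ ∑' i : Fin K, ∫⁻ t in ⋃ x ∈ s i, Metric.closedBall x.1 (L x.1 x.2), g t :=
        (lintegral_mono_set hEs).trans (lintegral_iUnion_le _ _)
    _ ≤ ∑' _ : Fin K, ∫⁻ t in Set.Icc (a - N) (b + N), w t := ENNReal.tsum_le_tsum hone
    _ = _ := by simp

/-- If `A` and `B` control `F` on all intervals around `x` and `F x` is not too small, then the two
terms balance at some scale `L < N`, and there the sum may be replaced by a product. -/
theorem exists_balanced_scale {m j : ℕ} (hj0 : 0 < j) (hj : j < m) {ρ κ C K M N x : ℝ}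
    (hρ : ρ ≤ 1) (hκ0 : 0 ≤ κ) (hC : 0 < C) (hN : 0 < N)
    {A B F : ℝ → ℝ} (hA : ContinuousOn A (Set.Ioi 0)) (hB : ContinuousOn B (Set.Ioi 0))
    (hA0 : ∀ L, 0 < L → 0 ≤ A L) (hB0 : ∀ L, 0 < L → 0 ≤ B L)
    (hAK : ∀ L, 0 < L → A L ≤ K * L ^ ρ) (hBM : ∀ L, 0 < L → B L ≤ M * L ^ κ)
    (hloc : ∀ L, 0 < L → ∀ y ∈ Set.Icc (x - L) (x + L),
      |F y| ≤ C * (L ^ (-(j : ℝ) - κ) * B L + L ^ ((m : ℝ) - j - ρ) * A L))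
    (hx : 2 * C * M * N ^ (-(j : ℝ)) < |F x|) :
    ∃ L, 0 < L ∧ L ≤ N ∧ ∀ y ∈ Set.Icc (x - L) (x + L),
      |F y| ≤ 2 * C * (L ^ (-((j : ℝ) / m * ρ + (1 - (j : ℝ) / m) * κ)) *
        (A L ^ ((j : ℝ) / m) * B L ^ (1 - (j : ℝ) / m))) := by
  have hjm : (j : ℝ) + 1 ≤ m := by exact_mod_cast hj
  have hj1 : (1 : ℝ) ≤ j := by exact_mod_cast hj0
  have hm0 : (0 : ℝ) < m := by linarith
  set σ : ℝ := m - ρ + κ with hσ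
  have hσ0 : 0 < σ := by linarith
  have hcent : ∀ L : ℝ, 0 < L → x ∈ Set.Icc (x - L) (x + L) := fun L hL => ⟨by linarith, by linarith⟩
  have hpow : ∀ L : ℝ, 0 < L → L ^ ((m : ℝ) - j - ρ) = L ^ (-(j : ℝ) - κ) * L ^ σ := by
    intro L hL
    rw [← Real.rpow_add hL]; congr 1; rw [hσ]; ring
  -- the difference of the two terms, up to a positive factor
  set Φ : ℝ → ℝ := fun L => L ^ σ * A L - B L with hΦ
  -- otherwise the term with `B` dominates at the scale `N`, which contradicts `hx`
  have hΦN : 0 < Φ N := by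
    by_contra! hneg
    have h1 := hloc N hN x (hcent N hN)
    rw [hpow N hN] at h1
    have h2 : N ^ σ * A N ≤ B N := by simp only [hΦ] at hneg; linarith
    have h3 : N ^ (-(j : ℝ) - κ) * B N ≤ M * N ^ (-(j : ℝ)) := by
      calc N ^ (-(j : ℝ) - κ) * B N ≤ N ^ (-(j : ℝ) - κ) * (M * N ^ κ) := by
            gcongr; exact hBM N hN
        _ = M * (N ^ (-(j : ℝ) - κ) * N ^ κ) := by ring
        _ = _ := by rw [← Real.rpow_add hN]; congr 2; ring
    have h4 : N ^ (-(j : ℝ) - κ) * (N ^ σ * A N) ≤ N ^ (-(j : ℝ) - κ) * B N := by gcongr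
    have : |F x| ≤ C * (M * N ^ (-(j : ℝ)) + M * N ^ (-(j : ℝ))) := by
      exact h1.trans (mul_le_mul_of_nonneg_left (add_le_add h3 (by
        rw [mul_assoc]; exact h4.trans h3)) hC.le)
    linarith
  have hF0 : 0 < |F x| := by
    have : 0 ≤ M * N ^ κ := (hB0 N hN).trans (hBM N hN)
    have hM : 0 ≤ M := nonneg_of_mul_nonneg_left this (Real.rpow_pos_of_pos hN _)
    have : 0 ≤ 2 * C * M * N ^ (-(j : ℝ)) := by positivity
    linarith
  -- otherwise the term with `A` dominates at all small scales; but it tends to zero, while `F x ≠ 0`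
  have hsmall : ∃ L0, 0 < L0 ∧ L0 ≤ N ∧ Φ L0 < 0 := by
    have hlim : Filter.Tendsto (fun L : ℝ => 2 * C * K * L ^ ((m : ℝ) - j)) (nhdsWithin 0 (Set.Ioi 0))
        (nhds (2 * C * K * 0 ^ ((m : ℝ) - j))) := by
      apply Filter.Tendsto.const_mul
      exact ((Real.continuousAt_rpow_const 0 _ (Or.inr (by linarith))).tendsto).mono_left
        nhdsWithin_le_nhds
    rw [Real.zero_rpow (by linarith), mul_zero] at hlim
    obtain ⟨L0, h1, h2⟩ := ((hlim.eventually (gt_mem_nhds hF0)).and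
      (Ioc_mem_nhdsGT hN)).exists
    refine ⟨L0, h2.1, h2.2, ?_⟩
    by_contra! hneg
    have hL0 := h2.1
    have h3 := hloc L0 hL0 x (hcent L0 hL0)
    have h4 : B L0 ≤ L0 ^ σ * A L0 := by simp only [hΦ] at hneg; linarith
    have h5 : L0 ^ ((m : ℝ) - j - ρ) * A L0 ≤ K * L0 ^ ((m : ℝ) - j) := by
      calc _ ≤ L0 ^ ((m : ℝ) - j - ρ) * (K * L0 ^ ρ) := by gcongr; exact hAK L0 hL0
        _ = K * (L0 ^ ((m : ℝ) - j - ρ) * L0 ^ ρ) := by ring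
        _ = _ := by rw [← Real.rpow_add hL0]; congr 2; ring
    have h6 : L0 ^ (-(j : ℝ) - κ) * B L0 ≤ K * L0 ^ ((m : ℝ) - j) := by
      refine le_trans ?_ h5
      rw [hpow L0 hL0, mul_assoc]; gcongr
    have : |F x| ≤ C * (K * L0 ^ ((m : ℝ) - j) + K * L0 ^ ((m : ℝ) - j)) := by
      refine h3.trans ?_; gcongr
    linarith
  obtain ⟨L0, hL0, hL0N, hΦ0⟩ := hsmall
  have hcont : ContinuousOn Φ (Set.Icc L0 N) := by
    have hsub : Set.Icc L0 N ⊆ Set.Ioi 0 := fun t ht => lt_of_lt_of_le hL0 ht.1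
    refine ((ContinuousOn.rpow_const continuousOn_id fun t ht => Or.inr hσ0.le).mul
      (hA.mono hsub)).sub (hB.mono hsub)
  obtain ⟨L, hL, hΦL⟩ := intermediate_value_Icc hL0N hcont (show (0 : ℝ) ∈ Set.Icc (Φ L0) (Φ N) from ⟨hΦ0.le, hΦN.le⟩)
  have hLp : 0 < L := hL0.trans_le hL.1
  refine ⟨L, hLp, hL.2, fun y hy => ?_⟩
  have hbal : L ^ σ * A L = B L := by simp only [hΦ] at hΦL; linarith
  have h1 := hloc L hLp y hy
  rw [hpow L hLp, mul_assoc, hbal] at h1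
  have hθ0 : (0 : ℝ) < j / m := by positivity
  have hθ1 : (j : ℝ) / m < 1 := by rw [div_lt_one hm0]; linarith
  have h2 : L ^ (-(j : ℝ) - κ) * B L =
      L ^ (-((j : ℝ) / m * ρ + (1 - (j : ℝ) / m) * κ)) *
        (A L ^ ((j : ℝ) / m) * B L ^ (1 - (j : ℝ) / m)) := by
    have hb : B L = (L ^ σ * A L) ^ ((j : ℝ) / m) * B L ^ (1 - (j : ℝ) / m) := by
      rw [hbal, ← Real.rpow_add_of_nonneg (hB0 L hLp) hθ0.le (by linarith)]
      simp
    rw [Real.mul_rpow (by positivity) (hA0 L hLp), ← Real.rpow_mul hLp.le] at hb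
    have he : L ^ (-((j : ℝ) / m * ρ + (1 - (j : ℝ) / m) * κ)) =
        L ^ (-(j : ℝ) - κ) * L ^ (σ * (j / m)) := by
      rw [← Real.rpow_add hLp]; congr 1; rw [hσ]; field_simp; ring
    rw [he]
    conv_lhs => rw [hb]
    ring
  rw [← h2]
  linarith

theorem lintegral_Icc_ofReal {w : ℝ → ℝ} (hw : Continuous w) (hw0 : ∀ t, 0 ≤ w t) {a b : ℝ}
    (hab : a ≤ b) : ∫⁻ t in Set.Icc a b, ENNReal.ofReal (w t) = ENNReal.ofReal (∫ t in a..b, w t) := by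
  rw [intervalIntegral.integral_of_le hab, ← integral_Icc_eq_integral_Ioc,
    ofReal_integral_eq_lintegral_ofReal (hw.integrableOn_Icc)
      (Filter.Eventually.of_forall hw0)]

/-- A continuous local `L^r` size of `h` on the intervals `[x - L, x + L]`. For `r = ∞` it is the
constant upper bound `X`, which keeps it continuous in `L`. -/
theorem exists_local_size {r : ℝ≥0∞} (hr : 1 ≤ r) {h : ℝ → ℝ} (hh : Continuous h) {K X : ℝ}
    (hK : ∀ t, |h t| ≤ K) (hX : 0 < X) (htop : r = ⊤ → ∀ t, |h t| ≤ X) (x : ℝ) :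
    ∃ A : ℝ → ℝ, ContinuousOn A (Set.Ioi 0) ∧ (∀ L, 0 < L → 0 ≤ A L) ∧
      (∀ L, 0 < L → A L ≤ (2 * K + X) * L ^ recip r) ∧
      (∀ L, 0 < L → ∫ t in (x - L)..(x + L), |h t| ≤ 2 * L ^ (1 - recip r) * A L) ∧
      ∀ L, 0 < L → ∀ s, 0 ≤ s → (A L / X) ^ s ≤
        (∫ t in (x - L)..(x + L), (|h t| / X) ^ r.toReal) ^ (recip r * s) := by
  have hK0 : 0 ≤ K := (abs_nonneg _).trans (hK 0)
  by_cases hrt : r = ⊤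
  · subst hrt
    refine ⟨fun _ => X, continuousOn_const, fun _ _ => hX.le, fun L _ => by simp; linarith, ?_, ?_⟩
    · intro L hL
      have : ‖∫ t in (x - L)..(x + L), |h t|‖ ≤ X * |x + L - (x - L)| :=
        intervalIntegral.norm_integral_le_of_norm_le_const fun t _ => by
          simpa using htop rfl t
      rw [Real.norm_eq_abs, abs_of_nonneg (intervalIntegral.integral_nonneg (by linarith)
        fun t _ => abs_nonneg _), abs_of_nonneg (by linarith)] at this
      simp; linarith
    · intro L hL s hs
      simp [hX.ne']
  set R := r.toReal with hR
  have hR1 : 1 ≤ R := by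
    rw [hR, ← ENNReal.toReal_one]; exact ENNReal.toReal_mono hrt hr
  have hR0 : 0 < R := by linarith
  have hρ : recip r = R⁻¹ := recip_eq_inv r
  have hcR : Continuous fun t => |h t| ^ R := hh.abs.rpow_const fun t => Or.inr hR0.le
  have hint0 : ∀ L, 0 < L → 0 ≤ ∫ t in (x - L)..(x + L), |h t| ^ R := fun L hL =>
    intervalIntegral.integral_nonneg (by linarith) fun t _ => by positivity
  refine ⟨fun L => (∫ t in (x - L)..(x + L), |h t| ^ R) ^ R⁻¹, ?_, ?_, ?_, ?_, ?_⟩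
  · refine ContinuousOn.rpow_const ?_ fun L hL => Or.inr (by positivity)
    have h1 : Continuous fun b => ∫ t in (0 : ℝ)..b, |h t| ^ R :=
      intervalIntegral.continuous_primitive (fun a b => hcR.intervalIntegrable a b) 0
    have h2 : (fun L => ∫ t in (x - L)..(x + L), |h t| ^ R) =
        fun L => (∫ t in (0 : ℝ)..(x + L), |h t| ^ R) - ∫ t in (0 : ℝ)..(x - L), |h t| ^ R := by
      funext L
      rw [intervalIntegral.integral_interval_sub_left (hcR.intervalIntegrable _ _)
        (hcR.intervalIntegrable _ _)]
    rw [h2]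
    fun_prop
  · intro L hL; exact Real.rpow_nonneg (hint0 L hL) _
  · intro L hL
    have h1 : ∫ t in (x - L)..(x + L), |h t| ^ R ≤ 2 * L * K ^ R := by
      calc _ ≤ ∫ t in (x - L)..(x + L), K ^ R := by
            refine intervalIntegral.integral_mono_on (by linarith) (hcR.intervalIntegrable _ _)
              (by simp) fun t _ => ?_
            exact Real.rpow_le_rpow (abs_nonneg _) (hK t) hR0.le
        _ = _ := by rw [intervalIntegral.integral_const, smul_eq_mul]; ring
    calc _ ≤ (2 * L * K ^ R) ^ R⁻¹ := Real.rpow_le_rpow (hint0 L hL) h1 (by positivity)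
      _ = 2 ^ R⁻¹ * L ^ R⁻¹ * K := by
          rw [Real.mul_rpow (by positivity) (by positivity), Real.mul_rpow (by positivity) hL.le,
            Real.rpow_rpow_inv hK0 hR0.ne']
      _ ≤ 2 ^ (1 : ℝ) * L ^ R⁻¹ * K := by
          gcongr
          · norm_num
          · exact inv_le_one_of_one_le₀ hR1
      _ ≤ (2 * K + X) * L ^ recip r := by
          rw [hρ, Real.rpow_one]; nlinarith [Real.rpow_pos_of_pos hL R⁻¹]
  · intro L hL
    have hvol : (volume (Set.Ioc (x - L) (x + L))).toReal = 2 * L := by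
      rw [Real.volume_Ioc, ENNReal.toReal_ofReal (by linarith)]; ring
    -- Jensen's inequality compares the mean of `|h|` with that of its power
    have hJ := (convexOn_rpow hR1).map_set_average_le (μ := volume) (t := Set.Ioc (x - L) (x + L))
      (f := fun t => |h t|) ((continuous_id.rpow_const fun t => Or.inr hR0.le).continuousOn)
      isClosed_Ici (by rw [Real.volume_Ioc]; simp; linarith) (by simp)
      (Filter.Eventually.of_forall fun t => abs_nonneg (h t))
      (hh.abs.integrableOn_Ioc) (hcR.integrableOn_Ioc)
    rw [setAverage_eq, setAverage_eq, Measure.real, hvol,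
      ← intervalIntegral.integral_of_le (by linarith),
      ← intervalIntegral.integral_of_le (by linarith), smul_eq_mul, smul_eq_mul] at hJ
    have h0 : 0 ≤ ∫ t in (x - L)..(x + L), |h t| :=
      intervalIntegral.integral_nonneg (by linarith) fun t _ => abs_nonneg _
    have h2 := Real.rpow_le_rpow (by positivity) hJ (inv_nonneg.2 hR0.le)
    rw [Real.rpow_rpow_inv (by positivity) hR0.ne', Real.mul_rpow (by positivity) (hint0 L hL),
      inv_mul_le_iff₀ (by positivity)] at h2
    refine h2.trans ?_
    rw [← mul_assoc]
    refine mul_le_mul_of_nonneg_right ?_ (Real.rpow_nonneg (hint0 L hL) _)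
    rw [hρ]
    calc 2 * L * (2 * L)⁻¹ ^ R⁻¹ = 2 * (2⁻¹ ^ R⁻¹) * (L ^ (1 : ℝ) * L ^ (-R⁻¹)) := by
          rw [mul_inv, Real.mul_rpow (by positivity) (by positivity), Real.rpow_one,
            Real.rpow_neg hL.le, Real.inv_rpow hL.le]; ring
      _ ≤ 2 * 1 * (L ^ (1 : ℝ) * L ^ (-R⁻¹)) := by
          gcongr
          exact Real.rpow_le_one (by norm_num) (by norm_num) (by positivity)
      _ = 2 * L ^ (1 - R⁻¹) := by rw [← Real.rpow_add hL]; ring_nf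
  · intro L hL s hs
    have h1 : ∫ t in (x - L)..(x + L), (|h t| / X) ^ R =
        (∫ t in (x - L)..(x + L), |h t| ^ R) / X ^ R := by
      rw [← intervalIntegral.integral_div]
      congr 1; funext t; rw [Real.div_rpow (abs_nonneg _) hX.le]
    rw [h1, Real.rpow_mul (div_nonneg (hint0 L hL) (by positivity)),
      hρ, Real.div_rpow (hint0 L hL) (by positivity), Real.rpow_rpow_inv hX.le hR0.ne']

/-- The weight whose integral controls the intermediate derivative in Nirenberg's inequality. -/
noncomputable def nirenbergWeight (α β : ℝ) (q r : ℝ≥0∞) (X Y a b : ℝ) : ℝ :=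
  α * (|a| / X) ^ r.toReal + β * (|b| / Y) ^ q.toReal

/-- At every point where the `j`-th derivative is not too small, there is a scale `L ≤ N` at which it is
bounded by a product of local `L^r` and `L^q` norms, normalized by `X` and `Y`. If `r = ∞` or `q = ∞`, the
corresponding integral carries the exponent `0`. -/
theorem exists_nirenberg_scale {m j : ℕ} (hj0 : 0 < j) (hj : j < m) {q r : ℝ≥0∞} (hq : 1 ≤ q)
    (hr : 1 ≤ r) : ∃ C : ℝ, 0 < C ∧ ∀ f : ℝ → ℝ, ContDiff ℝ ∞ f → ∀ K M X Y N : ℝ,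
      (∀ t, |f t| ≤ M) → (∀ t, |iteratedDeriv m f t| ≤ K) → 0 < X → 0 < Y → 0 < N →
      (r = ⊤ → ∀ t, |iteratedDeriv m f t| ≤ X) → (q = ⊤ → ∀ t, |f t| ≤ Y) →
      ∀ x, C * (M + Y) * N ^ (-(j : ℝ)) < |iteratedDeriv j f x| →
      ∃ L, 0 < L ∧ L ≤ N ∧ ∀ y ∈ Set.Icc (x - L) (x + L), ∀ s, 0 ≤ s → |iteratedDeriv j f y| ^ s ≤
        (C * (L ^ (-((j : ℝ) / m * recip r + (1 - (j : ℝ) / m) * recip q)) *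
          (X ^ ((j : ℝ) / m) * Y ^ (1 - (j : ℝ) / m)))) ^ s *
        ((∫ t in (x - L)..(x + L), (|iteratedDeriv m f t| / X) ^ r.toReal) ^
            (recip r * ((j : ℝ) / m * s)) *
          (∫ t in (x - L)..(x + L), (|f t| / Y) ^ q.toReal) ^
            (recip q * ((1 - (j : ℝ) / m) * s))) := by
  obtain ⟨C, hC, hloc⟩ := exists_iteratedDeriv_mul_pow_le hj
  have hjm : (j : ℝ) + 1 ≤ m := by exact_mod_cast hj
  have hj1 : (1 : ℝ) ≤ j := by exact_mod_cast hj0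
  have hm0 : (0 : ℝ) < m := by linarith
  have hθ0 : (0 : ℝ) < j / m := by positivity
  have hθ1 : (0 : ℝ) < 1 - (j : ℝ) / m := by rw [sub_pos, div_lt_one hm0]; linarith
  refine ⟨8 * C, by positivity, fun f hf K M X Y N hM hK hX hY hN hrX hqY x hx => ?_⟩
  have hM0 : 0 ≤ M := (abs_nonneg _).trans (hM 0)
  obtain ⟨A, hAc, hA0, hAK, hAi, hAp⟩ := exists_local_size hr
    (hf.continuous_iteratedDeriv m (by exact_mod_cast le_top)) hK hX hrX x
  obtain ⟨B, hBc, hB0, hBM, hBi, hBp⟩ := exists_local_size hq hf.continuous hM hY hqY x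
  obtain ⟨L, hL, hLN, hLy⟩ := exists_balanced_scale (F := iteratedDeriv j f) (C := 2 * C) hj0 hj
    (recip_le_one hr) (recip_nonneg q) (by positivity) hN hAc hBc hA0 hB0 hAK hBM
    (x := x) (fun L hL y hy => by
      have h1 := hloc f hf x L hL y hy
      have h2 := hAi L hL
      have h3 := hBi L hL
      rw [← le_div_iff₀ (by positivity)] at h1
      refine h1.trans ?_
      rw [div_le_iff₀ (by positivity)]
      have e1 : L ^ (-(j : ℝ) - recip q) * L ^ (j + 1) = L ^ (1 - recip q) := by
        rw [← Real.rpow_natCast, ← Real.rpow_add hL]; congr 1; push_cast; ring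
      have e2 : L ^ ((m : ℝ) - j - recip r) * L ^ (j + 1) = L ^ m * L ^ (1 - recip r) := by
        rw [← Real.rpow_natCast, ← Real.rpow_natCast, ← Real.rpow_add hL, ← Real.rpow_add hL]
        congr 1; push_cast; ring
      calc _ ≤ C * (2 * L ^ (1 - recip q) * B L + L ^ m * (2 * L ^ (1 - recip r) * A L)) := by
            gcongr
        _ = 2 * C * (L ^ (1 - recip q) * B L + (L ^ m * L ^ (1 - recip r)) * A L) := by ring
        _ = _ := by rw [← e1, ← e2]; ring)
    (by
      refine lt_of_le_of_lt ?_ hx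
      have : 2 * (2 * C) * (2 * M + Y) ≤ 8 * C * (M + Y) := by nlinarith
      gcongr)
  refine ⟨L, hL, hLN, fun y hy s hs => ?_⟩
  have h1 := Real.rpow_le_rpow (abs_nonneg _) (hLy y hy) hs
  refine h1.trans ?_
  have hA' := hAp L hL ((j : ℝ) / m * s) (by positivity)
  have hB' := hBp L hL ((1 - (j : ℝ) / m) * s) (by positivity)
  have hAL := hA0 L hL
  have hBL := hB0 L hL
  have e : A L ^ ((j : ℝ) / m) * B L ^ (1 - (j : ℝ) / m) =
      (X ^ ((j : ℝ) / m) * Y ^ (1 - (j : ℝ) / m)) *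
        ((A L / X) ^ ((j : ℝ) / m) * (B L / Y) ^ (1 - (j : ℝ) / m)) := by
    rw [Real.div_rpow hAL hX.le, Real.div_rpow hBL hY.le]
    field_simp
  rw [e, ← mul_assoc (L ^ _), ← mul_assoc (2 * (2 * C)), Real.mul_rpow (by positivity) (by positivity),
    Real.mul_rpow (x := (A L / X) ^ _) (by positivity) (by positivity), ← Real.rpow_mul (by positivity),
    ← Real.rpow_mul (by positivity)]
  have hi : ∀ g : ℝ → ℝ, ∀ p c Z : ℝ, 0 < Z →
      0 ≤ (∫ t in (x - L)..(x + L), (|g t| / Z) ^ p) ^ c := fun g p c Z hZ =>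
    Real.rpow_nonneg (intervalIntegral.integral_nonneg (by linarith) fun t _ => by positivity) _
  refine mul_le_mul (Real.rpow_le_rpow (by positivity) ?_ hs)
    (mul_le_mul hA' hB' (by positivity) (hi _ _ _ _ hX)) (by positivity) (by positivity)
  have h8 : 2 * (2 * C) ≤ 8 * C := by linarith
  exact mul_le_mul_of_nonneg_right h8 (by positivity)

/-- Nirenberg's inequality on a line for `q = r = ∞`. -/
theorem exists_iteratedDeriv_le_of_top {m j : ℕ} (hj0 : 0 < j) (hj : j < m) : ∃ C : ℝ, 0 < C ∧
    ∀ f : ℝ → ℝ, ContDiff ℝ ∞ f → ∀ X Y : ℝ, 0 < X → 0 < Y →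
      (∀ t, |iteratedDeriv m f t| ≤ X) → (∀ t, |f t| ≤ Y) →
      ∀ x, |iteratedDeriv j f x| ≤ C * (X ^ ((j : ℝ) / m) * Y ^ (1 - (j : ℝ) / m)) := by
  obtain ⟨C, hC, h⟩ := exists_nirenberg_scale hj0 hj (q := ⊤) (r := ⊤) le_top le_top
  refine ⟨C, hC, fun f hf X Y hX hY hfX hfY x => ?_⟩
  rcases eq_or_ne (iteratedDeriv j f x) 0 with h0 | h0
  · rw [h0, abs_zero]; positivity
  have hF : 0 < |iteratedDeriv j f x| := abs_pos.2 h0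
  have hlim : Filter.Tendsto (fun N : ℝ => C * (Y + Y) * N ^ (-(j : ℝ))) Filter.atTop (nhds 0) := by
    have := (tendsto_rpow_neg_atTop (y := (j : ℝ)) (by exact_mod_cast hj0)).const_mul (C * (Y + Y))
    simpa using this
  obtain ⟨N, h1, hN⟩ := ((hlim.eventually (gt_mem_nhds hF)).and (Filter.eventually_gt_atTop 0)).exists
  obtain ⟨L, hL, -, hy⟩ := h f hf X Y X Y N hfY hfX hX hY hN (fun _ => hfX) (fun _ => hfY) x h1
  simpa using hy x ⟨by linarith, by linarith⟩ 1 zero_le_one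

theorem continuous_nirenbergWeight {α β : ℝ} {q r : ℝ≥0∞} {X Y : ℝ} {S : Type*} [TopologicalSpace S]
    {a b : S → ℝ} (ha : Continuous a) (hb : Continuous b) :
    Continuous fun t => nirenbergWeight α β q r X Y (a t) (b t) := by
  unfold nirenbergWeight
  have h1 : Continuous fun t => (|a t| / X) ^ r.toReal :=
    (ha.abs.div_const X).rpow_const fun _ => Or.inr ENNReal.toReal_nonneg
  have h2 : Continuous fun t => (|b t| / Y) ^ q.toReal :=
    (hb.abs.div_const Y).rpow_const fun _ => Or.inr ENNReal.toReal_nonneg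
  fun_prop

theorem nirenbergWeight_nonneg {α β : ℝ} {q r : ℝ≥0∞} {X Y : ℝ} (hα : 0 ≤ α) (hβ : 0 ≤ β)
    (hX : 0 < X) (hY : 0 < Y) (a b : ℝ) : 0 ≤ nirenbergWeight α β q r X Y a b := by
  unfold nirenbergWeight; positivity

/-- Nirenberg's inequality on a segment, with the exponent `s` for the `j`-th derivative. Only points
where this derivative is not too small are taken into account; this limits the scales to `N`. -/
theorem exists_setLIntegral_iteratedDeriv_le {m j : ℕ} (hj0 : 0 < j) (hj : j < m) {q r : ℝ≥0∞}
    (hq : 1 ≤ q) (hr : 1 ≤ r) {s : ℝ} (hs : 0 < s)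
    (hsum : (j : ℝ) / m * recip r * s + (1 - (j : ℝ) / m) * recip q * s = 1) :
    ∃ C C' : ℝ, 0 < C ∧ 0 < C' ∧ ∀ f : ℝ → ℝ, ContDiff ℝ ∞ f → ∀ K M X Y N : ℝ,
      (∀ t, |f t| ≤ M) → (∀ t, |iteratedDeriv m f t| ≤ K) → 0 < X → 0 < Y → 0 < N →
      (r = ⊤ → ∀ t, |iteratedDeriv m f t| ≤ X) → (q = ⊤ → ∀ t, |f t| ≤ Y) → ∀ a b : ℝ,
      ∫⁻ t in Set.Icc a b ∩ {t | C' * (M + Y) * N ^ (-(j : ℝ)) < |iteratedDeriv j f t|},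
          ENNReal.ofReal (|iteratedDeriv j f t| ^ s) ≤
        ENNReal.ofReal (C * (X ^ ((j : ℝ) / m) * Y ^ (1 - (j : ℝ) / m)) ^ s) *
          ∫⁻ t in Set.Icc (a - N) (b + N), ENNReal.ofReal
            (nirenbergWeight ((j : ℝ) / m * recip r * s) ((1 - (j : ℝ) / m) * recip q * s) q r X Y
              (iteratedDeriv m f t) (f t)) := by
  obtain ⟨C, hC, hsc⟩ := exists_nirenberg_scale hj0 hj hq hr
  obtain ⟨B, hB⟩ := exists_setLIntegral_le_of_forall_closedBall
  have hjm : (j : ℝ) + 1 ≤ m := by exact_mod_cast hj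
  have hm0 : (0 : ℝ) < m := by linarith [(Nat.cast_nonneg j : (0 : ℝ) ≤ j)]
  have hθ0 : (0 : ℝ) ≤ j / m := by positivity
  have hθ1 : (0 : ℝ) ≤ 1 - (j : ℝ) / m := by rw [sub_nonneg, div_le_one hm0]; linarith
  set α : ℝ := (j : ℝ) / m * recip r * s with hα
  set β : ℝ := (1 - (j : ℝ) / m) * recip q * s with hβ
  have hα0 : 0 ≤ α := mul_nonneg (mul_nonneg hθ0 (recip_nonneg r)) hs.le
  have hβ0 : 0 ≤ β := mul_nonneg (mul_nonneg hθ1 (recip_nonneg q)) hs.le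
  refine ⟨(B + 1) * (2 * C ^ s), C, by positivity, hC, fun f hf K M X Y N hM hK hX hY hN hrX hqY a b => ?_⟩
  set Z : ℝ := (X ^ ((j : ℝ) / m) * Y ^ (1 - (j : ℝ) / m)) with hZ
  have hZ0 : 0 < Z := by positivity
  set w : ℝ → ℝ := fun t => nirenbergWeight α β q r X Y (iteratedDeriv m f t) (f t) with hw
  have hfm : Continuous (iteratedDeriv m f) := hf.continuous_iteratedDeriv m (by exact_mod_cast le_top)
  have hwc : Continuous w := continuous_nirenbergWeight hfm hf.continuous
  have hw0 : ∀ t, 0 ≤ w t := fun t => nirenbergWeight_nonneg hα0 hβ0 hX hY _ _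
  have h1 := hB (fun t => ENNReal.ofReal (|iteratedDeriv j f t| ^ s))
    (fun t => ENNReal.ofReal (2 * C ^ s * Z ^ s) * ENNReal.ofReal (w t))
    (Set.Icc a b ∩ {t | C * (M + Y) * N ^ (-(j : ℝ)) < |iteratedDeriv j f t|}) a b N
    Set.inter_subset_left (by
      rintro x ⟨-, hx⟩
      obtain ⟨L, hL, hLN, hLy⟩ := hsc f hf K M X Y N hM hK hX hY hN hrX hqY x hx
      refine ⟨L, hL, hLN, ?_⟩
      rw [Real.closedBall_eq_Icc, lintegral_const_mul' _ _ ENNReal.ofReal_ne_top,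
        lintegral_Icc_ofReal hwc hw0 (by linarith), ← ENNReal.ofReal_mul (by positivity)]
      have hI1 : 0 ≤ ∫ t in (x - L)..(x + L), (|iteratedDeriv m f t| / X) ^ r.toReal :=
        intervalIntegral.integral_nonneg (by linarith) fun t _ => by positivity
      have hI2 : 0 ≤ ∫ t in (x - L)..(x + L), (|f t| / Y) ^ q.toReal :=
        intervalIntegral.integral_nonneg (by linarith) fun t _ => by positivity
      have hc1 : Continuous fun t => (|iteratedDeriv m f t| / X) ^ r.toReal :=
        (hfm.abs.div_const X).rpow_const fun _ => Or.inr ENNReal.toReal_nonneg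
      have hc2 : Continuous fun t => (|f t| / Y) ^ q.toReal :=
        (hf.continuous.abs.div_const Y).rpow_const fun _ => Or.inr ENNReal.toReal_nonneg
      have hsplit : ∫ t in (x - L)..(x + L), w t =
          α * (∫ t in (x - L)..(x + L), (|iteratedDeriv m f t| / X) ^ r.toReal) +
          β * ∫ t in (x - L)..(x + L), (|f t| / Y) ^ q.toReal := by
        simp only [hw, nirenbergWeight]
        rw [intervalIntegral.integral_add ((hc1.intervalIntegrable _ _).const_mul _)
          ((hc2.intervalIntegrable _ _).const_mul _), intervalIntegral.integral_const_mul,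
          intervalIntegral.integral_const_mul]
      have hbound : ∀ y ∈ Set.Icc (x - L) (x + L), |iteratedDeriv j f y| ^ s ≤
          C ^ s * Z ^ s * L⁻¹ * ∫ t in (x - L)..(x + L), w t := by
        intro y hy
        refine (hLy y hy s hs.le).trans ?_
        rw [hsplit]
        have e1 : recip r * ((j : ℝ) / m * s) = α := by rw [hα]; ring
        have e2 : recip q * ((1 - (j : ℝ) / m) * s) = β := by rw [hβ]; ring
        have e3 : (L ^ (-((j : ℝ) / m * recip r + (1 - (j : ℝ) / m) * recip q))) ^ s = L⁻¹ := by
          rw [← Real.rpow_mul hL.le, ← Real.rpow_neg_one]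
          congr 1; linarith
        rw [e1, e2, Real.mul_rpow hC.le (by positivity), Real.mul_rpow (by positivity) hZ0.le, e3]
        -- the weighted inequality of the means turns the product into the integral of one weight; the exponents
        -- are such that the power of `L` is `L⁻¹`, which cancels the length of the interval
        have := mul_le_mul_of_nonneg_left
          (Real.geom_mean_le_arith_mean2_weighted hα0 hβ0 hI1 hI2 hsum)
          (show 0 ≤ C ^ s * Z ^ s * L⁻¹ by positivity)
        refine le_trans (le_of_eq ?_) this
        ring
      calc ∫⁻ t in Set.Icc (x - L) (x + L), ENNReal.ofReal (|iteratedDeriv j f t| ^ s)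
          ≤ ∫⁻ t in Set.Icc (x - L) (x + L),
              ENNReal.ofReal (C ^ s * Z ^ s * L⁻¹ * ∫ t in (x - L)..(x + L), w t) :=
            setLIntegral_mono' measurableSet_Icc fun y hy => ENNReal.ofReal_le_ofReal (hbound y hy)
        _ = ENNReal.ofReal (2 * C ^ s * Z ^ s * ∫ t in (x - L)..(x + L), w t) := by
            rw [setLIntegral_const, Real.volume_Icc, ← ENNReal.ofReal_mul' (by linarith)]
            congr 1
            field_simp; ring
        _ ≤ _ := le_rfl)
  refine h1.trans ?_
  rw [lintegral_const_mul' _ _ ENNReal.ofReal_ne_top, ← mul_assoc]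
  gcongr
  rw [← ENNReal.ofReal_natCast, ← ENNReal.ofReal_mul (by positivity)]
  apply ENNReal.ofReal_le_ofReal
  rw [← mul_assoc]
  gcongr
  linarith

/-! ### Integration of periodic functions over the cell -/

/-- Transversal periodicity for functions with values in any type. -/
def IsTransPeriodic {α : Type*} (Λ : ℝ) (g : E3 → α) : Prop :=
  ∀ x, g (x + Λ • stdBasis3 1) = g x ∧ g (x + Λ • stdBasis3 2) = g x

/-- The period lattice, parametrized by `ℤ × ℤ`. -/
noncomputable def periodHom (Λ : ℝ) : ℤ × ℤ →+ E3 where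
  toFun n := n.1 • (Λ • stdBasis3 1) + n.2 • (Λ • stdBasis3 2)
  map_zero' := by simp
  map_add' a b := by simp only [Prod.fst_add, Prod.snd_add, add_smul]; abel

@[simp] theorem stdBasis3_apply (i k : Fin 3) : stdBasis3 i k = if k = i then 1 else 0 := by
  simp [stdBasis3]

theorem periodHom_apply_one (Λ : ℝ) (n : ℤ × ℤ) : periodHom Λ n 1 = n.1 * Λ := by
  simp [periodHom]

theorem periodHom_apply_two (Λ : ℝ) (n : ℤ × ℤ) : periodHom Λ n 2 = n.2 * Λ := by
  simp [periodHom]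

theorem periodic_add_zsmul {α : Type*} {g : E3 → α} {v : E3}
    (hg : ∀ x, g (x + v) = g x) (n : ℤ) (x : E3) : g (x + n • v) = g x := by
  have hp : Function.Periodic g v := hg
  exact hp.zsmul n x

theorem IsTransPeriodic.add_periodHom {α : Type*} {Λ : ℝ} {g : E3 → α} (hg : IsTransPeriodic Λ g)
    (n : ℤ × ℤ) (x : E3) : g (x + periodHom Λ n) = g x := by
  simp only [periodHom, AddMonoidHom.coe_mk, ZeroHom.coe_mk]
  rw [← add_assoc, periodic_add_zsmul fun x => (hg x).2,
    periodic_add_zsmul fun x => (hg x).1]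

/-- The half-open cell with corner determined by `y`. -/
def halfOpenCell (Λ : ℝ) (y : E3) : Set E3 :=
  {x | x 1 ∈ Set.Ioc (y 1) (y 1 + Λ) ∧ x 2 ∈ Set.Ioc (y 2) (y 2 + Λ)}

theorem measurableSet_halfOpenCell (Λ : ℝ) (y : E3) : MeasurableSet (halfOpenCell Λ y) := by
  have h (i : Fin 3) : Measurable fun x : E3 => x i := by fun_prop
  exact (h 1 measurableSet_Ioc).inter (h 2 measurableSet_Ioc)

theorem measurableSet_cell (Λ : ℝ) : MeasurableSet (cell Λ) := by
  have h (i : Fin 3) : Measurable fun x : E3 => x i := by fun_prop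
  exact (h 1 measurableSet_Icc).inter (h 2 measurableSet_Icc)

theorem volume_coord_eq (i : Fin 3) (c : ℝ) : volume {x : E3 | x i = c} = 0 := by
  have h := (PiLp.volume_preserving_ofLp (Fin 3)).measure_preimage
    (s := {x | x i = c}) ((measurableSet_eq_fun (measurable_pi_apply i) measurable_const).nullMeasurableSet)
  have h2 : volume {x : Fin 3 → ℝ | x i = c} = 0 := by
    have := Measure.pi_hyperplane (fun _ : Fin 3 => (volume : Measure ℝ)) i c
    simpa [volume_pi] using! this
  rw [h2] at h
  exact h

theorem halfOpenCell_ae_eq_cell (Λ : ℝ) : halfOpenCell Λ 0 =ᵐ[volume] cell Λ := by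
  have h1 : ∀ᵐ x : E3, x 1 ≠ 0 := by
    rw [ae_iff]; simpa using volume_coord_eq 1 0
  have h2 : ∀ᵐ x : E3, x 2 ≠ 0 := by
    rw [ae_iff]; simpa using volume_coord_eq 2 0
  filter_upwards [h1, h2] with x hx1 hx2
  apply propext
  change (x 1 ∈ Set.Ioc ((0 : E3) 1) _ ∧ x 2 ∈ Set.Ioc ((0 : E3) 2) _) ↔
    (x 1 ∈ Set.Icc 0 Λ ∧ x 2 ∈ Set.Icc 0 Λ)
  simp only [PiLp.zero_apply, zero_add, Set.mem_Ioc, Set.mem_Icc]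
  constructor
  · rintro ⟨⟨a, b⟩, c, d⟩; exact ⟨⟨a.le, b⟩, c.le, d⟩
  · rintro ⟨⟨a, b⟩, c, d⟩; exact ⟨⟨lt_of_le_of_ne a hx1.symm, b⟩, lt_of_le_of_ne c hx2.symm, d⟩

theorem cellMeasure_eq (Λ : ℝ) : cellMeasure Λ = volume.restrict (halfOpenCell Λ 0) :=
  (Measure.restrict_congr_set (halfOpenCell_ae_eq_cell Λ)).symm

theorem isAddFundamentalDomain_halfOpenCell {Λ : ℝ} (hΛ : 0 < Λ) (y : E3) :
    IsAddFundamentalDomain (periodHom Λ).range (halfOpenCell Λ y) volume := by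
  refine IsAddFundamentalDomain.mk' (measurableSet_halfOpenCell Λ y).nullMeasurableSet fun x => ?_
  obtain ⟨a, ha, ha'⟩ := existsUnique_add_zsmul_mem_Ioc hΛ (x 1) (y 1)
  obtain ⟨b, hb, hb'⟩ := existsUnique_add_zsmul_mem_Ioc hΛ (x 2) (y 2)
  have hmem : ∀ n : ℤ × ℤ, periodHom Λ n + x ∈ halfOpenCell Λ y ↔
      x 1 + n.1 • Λ ∈ Set.Ioc (y 1) (y 1 + Λ) ∧ x 2 + n.2 • Λ ∈ Set.Ioc (y 2) (y 2 + Λ) := by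
    intro n
    change ((periodHom Λ n + x) 1 ∈ _ ∧ (periodHom Λ n + x) 2 ∈ _) ↔ _
    rw [PiLp.add_apply, PiLp.add_apply, periodHom_apply_one, periodHom_apply_two, add_comm (x 1),
      add_comm (x 2), zsmul_eq_mul, zsmul_eq_mul]
  refine ⟨⟨periodHom Λ (a, b), ⟨(a, b), rfl⟩⟩, (hmem (a, b)).2 ⟨ha, hb⟩, ?_⟩
  rintro ⟨_, ⟨n, rfl⟩⟩ hn
  have := (hmem n).1 hn
  have h1 := ha' _ this.1
  have h2 := hb' _ this.2
  apply Subtype.ext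
  change periodHom Λ n = periodHom Λ (a, b)
  rw [← h1, ← h2]

instance countable_periodHom_range (Λ : ℝ) : Countable (periodHom Λ).range :=
  (Set.countable_range (periodHom Λ)).to_subtype

/-- The integral of a periodic function over a translated cell does not depend on the translation: both
cells are fundamental domains of the period lattice. -/
theorem lintegral_cell_add {Λ : ℝ} (hΛ : 0 < Λ) {g : E3 → ℝ≥0∞} (hg : IsTransPeriodic Λ g)
    (y : E3) : ∫⁻ x, g (x + y) ∂(cellMeasure Λ) = ∫⁻ x, g x ∂(cellMeasure Λ) := by
  rw [cellMeasure_eq]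
  have h1 : ∫⁻ x in halfOpenCell Λ 0, g (x + y) = ∫⁻ x in halfOpenCell Λ y, g x := by
    have hpre : (fun x : E3 => x + y) ⁻¹' halfOpenCell Λ y = halfOpenCell Λ 0 := by
      ext x
      simp only [halfOpenCell, Set.mem_preimage, Set.mem_ofPred_eq, PiLp.add_apply, PiLp.zero_apply,
        Set.mem_Ioc]
      constructor <;> rintro ⟨⟨a, b⟩, c, d⟩ <;> refine ⟨⟨?_, ?_⟩, ?_, ?_⟩ <;> linarith
    have := (measurePreserving_add_right (volume : Measure E3) y).setLIntegral_comp_preimage_emb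
      (MeasurableEquiv.addRight y).measurableEmbedding g (halfOpenCell Λ y)
    rw [hpre] at this
    exact this
  rw [h1]
  refine (isAddFundamentalDomain_halfOpenCell hΛ y).setLIntegral_eq
    (isAddFundamentalDomain_halfOpenCell hΛ 0) g ?_
  rintro ⟨_, ⟨n, rfl⟩⟩ x
  change g (periodHom Λ n + x) = g x
  rw [add_comm]; exact hg.add_periodHom n x

/-- Averaging translates of a periodic function does not change its integral over the cell. -/
theorem lintegral_cell_lintegral_add {Λ : ℝ} (hΛ : 0 < Λ) {g : E3 → ℝ≥0∞} (hg : IsTransPeriodic Λ g)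
    (hm : Measurable g) {S : Type*} [MeasurableSpace S] (ν : Measure S) [SFinite ν] {τ : S → E3}
    (hτ : Measurable τ) :
    ∫⁻ x, ∫⁻ s, g (x + τ s) ∂ν ∂(cellMeasure Λ) = ν Set.univ * ∫⁻ x, g x ∂(cellMeasure Λ) := by
  unfold cellMeasure at *
  rw [lintegral_lintegral_swap]
  · have h1 : ∀ s, ∫⁻ x, g (x + τ s) ∂(volume.restrict (cell Λ)) = ∫⁻ x, g x ∂(volume.restrict (cell Λ)) :=
      fun s => lintegral_cell_add hΛ hg (τ s)
    simp_rw [h1]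
    rw [lintegral_const, mul_comm]
  · exact (hm.comp (measurable_fst.add (hτ.comp measurable_snd))).aemeasurable

/-- A function that is bounded pointwise by an average of translates of a periodic function `u` has
at most the `L^p` norm of `u`. -/
theorem eLpNorm_cell_le_of_le_average {Λ : ℝ} (hΛ : 0 < Λ) {p : ℝ≥0∞} (hp : 1 ≤ p) {F G : Type*}
    [NormedAddCommGroup F] [NormedAddCommGroup G] {u : E3 → F} (hu : IsTransPeriodic Λ u)
    (hm : StronglyMeasurable u) {S : Type*} [MeasurableSpace S] (ν : Measure S)
    [IsProbabilityMeasure ν] {τ : S → E3} (hτ : Measurable τ) {v : E3 → G}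
    (hv : ∀ x, ‖v x‖ₑ ≤ ∫⁻ s, ‖u (x + τ s)‖ₑ ∂ν) :
    eLpNorm v p (cellMeasure Λ) ≤ eLpNorm u p (cellMeasure Λ) := by
  have hp0 : p ≠ 0 := (zero_lt_one.trans_le hp).ne'
  by_cases hpt : p = ⊤
  · subst hpt
    rw [eLpNorm_exponent_top, eLpNorm_exponent_top]
    set M := eLpNormEssSup u (cellMeasure Λ) with hM
    have hS : MeasurableSet {x | M < ‖u x‖ₑ} := measurableSet_lt measurable_const hm.enorm
    have h0 : ∀ s, ∀ᵐ x ∂(cellMeasure Λ), ‖u (x + τ s)‖ₑ ≤ M := by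
      intro s
      have hper : IsTransPeriodic Λ ({x | M < ‖u x‖ₑ}.indicator (fun _ => (1 : ℝ≥0∞))) := by
        intro x
        simp only [Set.indicator_apply, Set.mem_ofPred_eq, (hu x).1, (hu x).2, and_self]
      have h1 := lintegral_cell_add hΛ hper (τ s)
      have h2 : ∫⁻ x, {x | M < ‖u x‖ₑ}.indicator (fun _ => (1 : ℝ≥0∞)) x ∂(cellMeasure Λ) = 0 := by
        rw [lintegral_indicator hS, setLIntegral_const, one_mul]
        exact meas_eLpNormEssSup_lt
      rw [h2, lintegral_eq_zero_iff] at h1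
      · filter_upwards [h1] with x hx
        by_contra! hlt
        simp [hlt] at hx
      · exact (measurable_const.indicator hS).comp (measurable_id.add_const (τ s))
    have h1 : ∀ᵐ x ∂(cellMeasure Λ), ∀ᵐ s ∂ν, ‖u (x + τ s)‖ₑ ≤ M := by
      unfold cellMeasure at *
      rw [Measure.ae_ae_comm]
      · exact Filter.Eventually.of_forall h0
      · exact measurableSet_le (hm.enorm.comp (measurable_fst.add (hτ.comp measurable_snd)))
          measurable_const
    refine essSup_le_of_ae_le _ ?_
    filter_upwards [h1] with x hx
    refine (hv x).trans ((lintegral_mono_ae hx).trans ?_)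
    simp
  · have hP : 0 < p.toReal := ENNReal.toReal_pos hp0 hpt
    rw [eLpNorm_eq_lintegral_rpow_enorm_toReal hp0 hpt, eLpNorm_eq_lintegral_rpow_enorm_toReal hp0 hpt]
    gcongr ?_ ^ _
    have hper : IsTransPeriodic Λ (fun x => ‖u x‖ₑ ^ p.toReal) := fun x => by
      simp only [(hu x).1, (hu x).2, and_self]
    calc ∫⁻ x, ‖v x‖ₑ ^ p.toReal ∂(cellMeasure Λ)
        ≤ ∫⁻ x, ∫⁻ s, ‖u (x + τ s)‖ₑ ^ p.toReal ∂ν ∂(cellMeasure Λ) := by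
          refine lintegral_mono fun x => ?_
          have hms : AEStronglyMeasurable (fun s => u (x + τ s)) ν :=
            (hm.comp_measurable (hτ.const_add x)).aestronglyMeasurable
          have h1 := eLpNorm_le_eLpNorm_of_exponent_le hp hms
          rw [eLpNorm_one_eq_lintegral_enorm, eLpNorm_eq_lintegral_rpow_enorm_toReal hp0 hpt] at h1
          have h2 := ENNReal.rpow_le_rpow ((hv x).trans h1) hP.le
          rwa [← ENNReal.rpow_mul, one_div, inv_mul_cancel₀ hP.ne', ENNReal.rpow_one] at h2
      _ = _ := by
          rw [lintegral_cell_lintegral_add hΛ hper (hm.enorm.pow_const _) ν hτ]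
          simp

/-! ### Coordinate boxes -/

theorem lintegral_E3 {f : E3 → ℝ≥0∞} (hf : Measurable f) : ∫⁻ x, f x =
    ∫⁻ a : ℝ, ∫⁻ b : ℝ, ∫⁻ c : ℝ, f (a • stdBasis3 0 + b • stdBasis3 1 + c • stdBasis3 2) := by
  have h1 := (PiLp.volume_preserving_toLp (Fin 3)).lintegral_comp hf
  rw [← h1]
  have h2 := (volume_preserving_piFinSuccAbove (fun _ : Fin 3 => ℝ) 0).symm.lintegral_comp
    (f := fun x => f (WithLp.toLp 2 x)) (by fun_prop)
  rw [← h2, Measure.volume_eq_prod, lintegral_prod _ (by fun_prop)]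
  refine lintegral_congr fun a => ?_
  have h3 := (volume_preserving_finTwoArrow ℝ).symm.lintegral_comp
    (f := fun x : Fin 2 → ℝ => f (WithLp.toLp 2 ((MeasurableEquiv.piFinSuccAbove (fun _ : Fin 3 => ℝ) 0).symm (a, x))))
    (by fun_prop)
  rw [← h3, Measure.volume_eq_prod, lintegral_prod _ (by fun_prop)]
  refine lintegral_congr fun b => lintegral_congr fun c => ?_
  congr 1
  ext i
  fin_cases i <;> simp [MeasurableEquiv.piFinSuccAbove, Fin.insertNthEquiv, MeasurableEquiv.finTwoArrow]

/-- The coordinate box `[0, a] × [0, b] × [0, c]`. -/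
def coordBox (a b c : ℝ) : Set E3 :=
  {x | x 0 ∈ Set.Icc 0 a ∧ x 1 ∈ Set.Icc 0 b ∧ x 2 ∈ Set.Icc 0 c}

theorem measurableSet_coordBox (a b c : ℝ) : MeasurableSet (coordBox a b c) := by
  have h (i : Fin 3) : Measurable fun x : E3 => x i := by fun_prop
  exact (h 0 measurableSet_Icc).inter ((h 1 measurableSet_Icc).inter (h 2 measurableSet_Icc))

theorem setLIntegral_coordBox (a b c : ℝ) {f : E3 → ℝ≥0∞} (hf : Measurable f) :
    ∫⁻ x in coordBox a b c, f x = ∫⁻ s in Set.Icc 0 a, ∫⁻ t in Set.Icc 0 b, ∫⁻ w in Set.Icc 0 c,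
      f (s • stdBasis3 0 + t • stdBasis3 1 + w • stdBasis3 2) := by
  rw [← lintegral_indicator (measurableSet_coordBox a b c),
    lintegral_E3 (hf.indicator (measurableSet_coordBox a b c)),
    ← lintegral_indicator measurableSet_Icc]
  refine lintegral_congr fun s => ?_
  by_cases hs : s ∈ Set.Icc 0 a
  · rw [Set.indicator_of_mem hs, ← lintegral_indicator measurableSet_Icc]
    refine lintegral_congr fun t => ?_
    by_cases ht : t ∈ Set.Icc 0 b
    · rw [Set.indicator_of_mem ht, ← lintegral_indicator measurableSet_Icc]
      refine lintegral_congr fun w => ?_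
      by_cases hw : w ∈ Set.Icc 0 c
      · rw [Set.indicator_of_mem hw, Set.indicator_of_mem]
        simp only [coordBox, Set.mem_ofPred_eq]
        simpa using ⟨hs, ht, hw⟩
      · rw [Set.indicator_of_notMem hw, Set.indicator_of_notMem]
        intro h; apply hw
        simpa [coordBox] using h.2.2
    · rw [Set.indicator_of_notMem ht]
      refine (lintegral_congr fun w => Set.indicator_of_notMem ?_ _).trans (by simp)
      intro h; apply ht
      simpa [coordBox] using h.2.1
  · rw [Set.indicator_of_notMem hs]
    refine (lintegral_congr fun t => (lintegral_congr fun w => Set.indicator_of_notMem ?_ _)).trans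
      (by simp)
    intro h; apply hs
    simpa [coordBox] using h.1

theorem volume_coordBox {a b c : ℝ} (ha : 0 ≤ a) (hb : 0 ≤ b) :
    volume (coordBox a b c) = ENNReal.ofReal (a * b * c) := by
  have := setLIntegral_coordBox a b c (f := fun _ => 1) measurable_const
  simp only [setLIntegral_const, one_mul, Real.volume_Icc, sub_zero] at this
  rw [this, ← ENNReal.ofReal_mul' hb, ← ENNReal.ofReal_mul' ha]
  ring_nf

theorem eLpNorm_cell_add {Λ : ℝ} (hΛ : 0 < Λ) {p : ℝ≥0∞} (hp : 1 ≤ p) {F : Type*}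
    [NormedAddCommGroup F] {u : E3 → F} (hu : IsTransPeriodic Λ u) (hm : StronglyMeasurable u) (y : E3) :
    eLpNorm (fun x => u (x + y)) p (cellMeasure Λ) ≤ eLpNorm u p (cellMeasure Λ) :=
  eLpNorm_cell_le_of_le_average hΛ hp hu hm (Measure.dirac ()) (τ := fun _ => y) measurable_const
    fun x => by simp

/-- Hölder's inequality on a translated box that fits into the cell. -/
theorem setLIntegral_coordBox_le {Λ : ℝ} (hΛ : 0 < Λ) {p : ℝ≥0∞} (hp : 1 ≤ p) {F : Type*}
    [NormedAddCommGroup F] {u : E3 → F} (hu : IsTransPeriodic Λ u) (hm : StronglyMeasurable u) {a b c : ℝ}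
    (ha : 0 ≤ a) (hb : 0 ≤ b) (hbΛ : b ≤ Λ) (hcΛ : c ≤ Λ) (x : E3) :
    ∫⁻ y in coordBox a b c, ‖u (x + y)‖ₑ ≤
      ENNReal.ofReal (a * b * c) ^ (1 - recip p) * eLpNorm u p (cellMeasure Λ) := by
  have hms : StronglyMeasurable fun y => u (x + y) := hm.comp_measurable (measurable_const_add x)
  have h1 := eLpNorm_le_eLpNorm_mul_rpow_measure_univ (μ := volume.restrict (coordBox a b c)) hp
    hms.aestronglyMeasurable
  rw [eLpNorm_one_eq_lintegral_enorm, Measure.restrict_apply_univ, volume_coordBox ha hb] at h1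
  rw [mul_comm]
  refine h1.trans ?_
  rw [recip_eq_inv]
  simp only [ENNReal.toReal_one, one_div, inv_one]
  gcongr
  have hsub : coordBox a b c ⊆ cell Λ := fun y hy =>
    ⟨⟨hy.2.1.1, hy.2.1.2.trans hbΛ⟩, hy.2.2.1, hy.2.2.2.trans hcΛ⟩
  calc _ ≤ eLpNorm (fun y => u (x + y)) p (cellMeasure Λ) :=
        eLpNorm_mono_measure _ (Measure.restrict_mono hsub le_rfl)
    _ ≤ _ := by
        simp_rw [add_comm x]
        exact eLpNorm_cell_add hΛ hp hu hm x

/-! ### Smooth periodic functions with bounded derivatives -/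

/-- Smooth transversally periodic functions all of whose derivatives are bounded. -/
structure IsNice (Λ : ℝ) (u : E3 → ℝ) : Prop where
  smooth : ContDiff ℝ ∞ u
  periodic : IsTransPeriodic Λ u
  bounded : ∀ l, ∃ M, ∀ x, |pderivs l u x| ≤ M

theorem pderiv_comp_add_right (i : Fin 3) (u : E3 → ℝ) (y : E3) :
    pderiv i (fun x => u (x + y)) = fun x => pderiv i u (x + y) := by
  funext x
  simp only [pderiv, fderiv_comp_add_right]

theorem pderivs_comp_add_right (l : List (Fin 3)) (u : E3 → ℝ) (y : E3) :
    pderivs l (fun x => u (x + y)) = fun x => pderivs l u (x + y) := by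
  induction l with
  | nil => rfl
  | cons i l ih => simp only [pderivs]; rw [ih, pderiv_comp_add_right]

theorem IsTransPeriodic.pderivs {Λ : ℝ} {u : E3 → ℝ} (hu : IsTransPeriodic Λ u) (l : List (Fin 3)) :
    IsTransPeriodic Λ (pderivs l u) := by
  intro x
  have h1 : (fun x => u (x + Λ • stdBasis3 1)) = u := funext fun x => (hu x).1
  have h2 : (fun x => u (x + Λ • stdBasis3 2)) = u := funext fun x => (hu x).2
  refine ⟨?_, ?_⟩
  · have := pderivs_comp_add_right l u (Λ • stdBasis3 1)
    rw [h1] at this; exact (congrFun this x).symm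
  · have := pderivs_comp_add_right l u (Λ • stdBasis3 2)
    rw [h2] at this; exact (congrFun this x).symm

theorem IsNice.pderivs {Λ : ℝ} {u : E3 → ℝ} (hu : IsNice Λ u) (l : List (Fin 3)) :
    IsNice Λ (pderivs l u) where
  smooth := contDiff_pderivs hu.smooth l
  periodic := hu.periodic.pderivs l
  bounded l' := by
    rw [← pderivs_append]; exact hu.bounded _

theorem IsNice.stronglyMeasurable {Λ : ℝ} {u : E3 → ℝ} (hu : IsNice Λ u) : StronglyMeasurable u :=
  hu.smooth.continuous.stronglyMeasurable

/-- A continuous periodic function is bounded everywhere by its `L^∞` norm. -/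
theorem abs_le_of_eLpNorm_top_le {Λ : ℝ} (hΛ : 0 < Λ) {u : E3 → ℝ} (hu : Continuous u)
    (hp : IsTransPeriodic Λ u) {X : ℝ} (hX : 0 ≤ X)
    (h : eLpNorm u ⊤ (cellMeasure Λ) ≤ ENNReal.ofReal X) (x : E3) : |u x| ≤ X := by
  by_contra! hlt
  set c : E3 := (Λ / 2) • stdBasis3 1 + (Λ / 2) • stdBasis3 2 with hc
  set V : Set E3 := {z | z 1 ∈ Set.Ioo 0 Λ ∧ z 2 ∈ Set.Ioo 0 Λ} with hV
  have hVo : IsOpen V := by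
    have h (i : Fin 3) : Continuous fun x : E3 => x i := by fun_prop
    exact (isOpen_Ioo.preimage (h 1)).inter (isOpen_Ioo.preimage (h 2))
  have hUo : IsOpen ({z | X < |u (z + (x - c))|} ∩ V) :=
    (isOpen_lt continuous_const (hu.comp (continuous_add_const (x - c))).abs).inter hVo
  have hcU : c ∈ {z | X < |u (z + (x - c))|} ∩ V := by
    refine ⟨by simpa using hlt, ?_⟩
    simp only [hV, hc, Set.mem_ofPred_eq, PiLp.add_apply, PiLp.smul_apply, stdBasis3_apply,
      smul_eq_mul]
    rw [if_pos trivial, if_neg (show ¬((1 : Fin 3) = 2) by decide),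
      if_neg (show ¬((2 : Fin 3) = 1) by decide)]
    refine ⟨⟨?_, ?_⟩, ?_, ?_⟩ <;> linarith
  have hpos := hUo.measure_pos volume ⟨c, hcU⟩
  have h1 := (eLpNorm_cell_add hΛ (le_top (a := (1 : ℝ≥0∞))) hp hu.stronglyMeasurable (x - c)).trans h
  rw [eLpNorm_exponent_top] at h1
  have h3 : ∀ᵐ z ∂(cellMeasure Λ), ‖u (z + (x - c))‖ₑ ≤ ENNReal.ofReal X := by
    filter_upwards [ae_le_eLpNormEssSup (f := fun z => u (z + (x - c))) (μ := cellMeasure Λ)] with z hz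
    exact hz.trans h1
  rw [cellMeasure, ae_restrict_iff' (measurableSet_cell Λ), ae_iff] at h3
  refine hpos.ne' (measure_mono_null ?_ h3)
  rintro z ⟨hz1, hz2⟩
  simp only [Set.mem_ofPred_eq, Classical.not_imp, not_le]
  refine ⟨⟨⟨hz2.1.1.le, hz2.1.2.le⟩, hz2.2.1.le, hz2.2.2.le⟩, ?_⟩
  rw [Real.enorm_eq_ofReal_abs]
  exact (ENNReal.ofReal_lt_ofReal_iff_of_nonneg hX).2 hz1

/-! ### Nirenberg's interpolation inequality for intermediate derivatives -/

theorem lintegral_div_rpow_le {μ : Measure E3} {a : E3 → ℝ} {r : ℝ≥0∞} (hr : 1 ≤ r) (hrt : r ≠ ⊤) {X : ℝ}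
    (hX : 0 < X) (h : eLpNorm a r μ ≤ ENNReal.ofReal X) :
    ∫⁻ x, ENNReal.ofReal ((|a x| / X) ^ r.toReal) ∂μ ≤ 1 := by
  have hr0 : r ≠ 0 := (zero_lt_one.trans_le hr).ne'
  have hR : 0 < r.toReal := ENNReal.toReal_pos hr0 hrt
  rw [eLpNorm_eq_lintegral_rpow_enorm_toReal hr0 hrt, one_div, ENNReal.rpow_inv_le_iff hR] at h
  have e : ∀ x, ENNReal.ofReal ((|a x| / X) ^ r.toReal) =
      ‖a x‖ₑ ^ r.toReal * (ENNReal.ofReal X ^ r.toReal)⁻¹ := by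
    intro x
    rw [← ENNReal.ofReal_rpow_of_nonneg (by positivity) hR.le, ENNReal.ofReal_div_of_pos hX,
      ENNReal.div_rpow_of_nonneg _ _ hR.le, Real.enorm_eq_ofReal_abs, ENNReal.div_eq_inv_mul, mul_comm]
  simp_rw [e]
  have hne : ENNReal.ofReal X ^ r.toReal ≠ 0 := by
    simp [hX]
  have hnt : ENNReal.ofReal X ^ r.toReal ≠ ⊤ := by
    simp [hR.le]
  rw [lintegral_mul_const' _ _ (ENNReal.inv_ne_top.2 hne)]
  calc _ ≤ ENNReal.ofReal X ^ r.toReal * (ENNReal.ofReal X ^ r.toReal)⁻¹ := by gcongr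
    _ = 1 := ENNReal.mul_inv_cancel hne hnt

theorem lintegral_nirenbergWeight_le {μ : Measure E3} {a b : E3 → ℝ} (ha : Continuous a)
    {q r : ℝ≥0∞} (hq : 1 ≤ q) (hr : 1 ≤ r) {α β X Y : ℝ} (hα : 0 ≤ α) (hβ : 0 ≤ β)
    (hαr : r = ⊤ → α = 0) (hβq : q = ⊤ → β = 0) (hαβ : α + β = 1) (hX : 0 < X) (hY : 0 < Y)
    (haX : eLpNorm a r μ ≤ ENNReal.ofReal X) (hbY : eLpNorm b q μ ≤ ENNReal.ofReal Y) :
    ∫⁻ x, ENNReal.ofReal (nirenbergWeight α β q r X Y (a x) (b x)) ∂μ ≤ 1 := by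
  have h1 : ∀ x, ENNReal.ofReal (nirenbergWeight α β q r X Y (a x) (b x)) =
      ENNReal.ofReal α * ENNReal.ofReal ((|a x| / X) ^ r.toReal) +
      ENNReal.ofReal β * ENNReal.ofReal ((|b x| / Y) ^ q.toReal) := by
    intro x
    unfold nirenbergWeight
    rw [ENNReal.ofReal_add (by positivity) (by positivity), ENNReal.ofReal_mul hα, ENNReal.ofReal_mul hβ]
  have hc1 : Continuous fun t => (|a t| / X) ^ r.toReal :=
    (ha.abs.div_const X).rpow_const fun _ => Or.inr ENNReal.toReal_nonneg
  simp_rw [h1]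
  rw [lintegral_add_left (by fun_prop), lintegral_const_mul' _ _ ENNReal.ofReal_ne_top,
    lintegral_const_mul' _ _ ENNReal.ofReal_ne_top]
  have h2 : ENNReal.ofReal α * ∫⁻ x, ENNReal.ofReal ((|a x| / X) ^ r.toReal) ∂μ ≤ ENNReal.ofReal α := by
    by_cases hrt : r = ⊤
    · simp [hαr hrt]
    · exact mul_le_of_le_one_right' (lintegral_div_rpow_le hr hrt hX haX)
  have h3 : ENNReal.ofReal β * ∫⁻ x, ENNReal.ofReal ((|b x| / Y) ^ q.toReal) ∂μ ≤ ENNReal.ofReal β := by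
    by_cases hqt : q = ⊤
    · simp [hβq hqt]
    · exact mul_le_of_le_one_right' (lintegral_div_rpow_le hq hqt hY hbY)
  calc _ ≤ ENNReal.ofReal α + ENNReal.ofReal β := add_le_add h2 h3
    _ = 1 := by rw [← ENNReal.ofReal_add hα hβ, hαβ, ENNReal.ofReal_one]

theorem volume_Icc_univ (a b : ℝ) : (volume.restrict (Set.Icc a b)) Set.univ = ENNReal.ofReal (b - a) := by
  simp

/-- Nirenberg's inequality for pure derivatives in one coordinate direction. -/
theorem exists_eLpNorm_pderivs_replicate_le {m j : ℕ} (hj0 : 0 < j) (hj : j < m) {q r p : ℝ≥0∞}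
    (hq : 1 ≤ q) (hr : 1 ≤ r) (hp : 1 ≤ p)
    (hpqr : recip p = (j : ℝ) / m * recip r + (1 - (j : ℝ) / m) * recip q) :
    ∃ C : ℝ, 0 < C ∧ ∀ Λ : ℝ, 0 < Λ → ∀ g : E3 → ℝ, IsNice Λ g → ∀ i : Fin 3, ∀ X Y : ℝ,
      0 < X → 0 < Y →
      eLpNorm (pderivs (List.replicate m i) g) r (cellMeasure Λ) ≤ ENNReal.ofReal X →
      eLpNorm g q (cellMeasure Λ) ≤ ENNReal.ofReal Y →
      eLpNorm (pderivs (List.replicate j i) g) p (cellMeasure Λ) ≤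
        ENNReal.ofReal (C * (X ^ ((j : ℝ) / m) * Y ^ (1 - (j : ℝ) / m))) := by
  have hjm : (j : ℝ) + 1 ≤ m := by exact_mod_cast hj
  have hj1 : (1 : ℝ) ≤ j := by exact_mod_cast hj0
  have hm0 : (0 : ℝ) < m := by linarith
  have hθ0 : (0 : ℝ) < j / m := by positivity
  have hθ1 : (0 : ℝ) < 1 - (j : ℝ) / m := by rw [sub_pos, div_lt_one hm0]; linarith
  by_cases hpt : p = ⊤
  · subst hpt
    have hr0 := mul_nonneg hθ0.le (recip_nonneg r)
    have hq0 := mul_nonneg hθ1.le (recip_nonneg q)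
    rw [recip_top] at hpqr
    -- `p = ∞` leaves only `q = r = ∞`
    have hrt : r = ⊤ := (recip_eq_zero_iff hr).1 (by
      have : (j : ℝ) / m * recip r = 0 := by linarith
      exact (mul_eq_zero.1 this).resolve_left hθ0.ne')
    have hqt : q = ⊤ := (recip_eq_zero_iff hq).1 (by
      have : (1 - (j : ℝ) / m) * recip q = 0 := by linarith
      exact (mul_eq_zero.1 this).resolve_left hθ1.ne')
    subst hrt hqt
    obtain ⟨C, hC, h⟩ := exists_iteratedDeriv_le_of_top hj0 hj
    refine ⟨C, hC, fun Λ hΛ g hg i X Y hX hY hgX hgY => ?_⟩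
    have hgX' := abs_le_of_eLpNorm_top_le hΛ (contDiff_pderivs hg.smooth _).continuous
      (hg.periodic.pderivs _) hX.le hgX
    have hgY' := abs_le_of_eLpNorm_top_le hΛ hg.smooth.continuous hg.periodic hY.le hgY
    rw [eLpNorm_exponent_top]
    refine essSup_le_of_ae_le _ (Filter.Eventually.of_forall fun x => ?_)
    have := h _ (contDiff_line hg.smooth i x) X Y hX hY
      (by rw [iteratedDeriv_line hg.smooth]; intro t; exact hgX' _) (fun t => hgY' _) 0
    rw [iteratedDeriv_line hg.smooth] at this
    simp only [zero_smul, add_zero] at this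
    simp only [Real.enorm_eq_ofReal_abs]
    exact ENNReal.ofReal_le_ofReal this
  have hp0 : p ≠ 0 := (zero_lt_one.trans_le hp).ne'
  set s := p.toReal with hs
  have hs0 : 0 < s := ENNReal.toReal_pos hp0 hpt
  have hps : recip p * s = 1 := by rw [recip_eq_inv, ← hs]; exact inv_mul_cancel₀ hs0.ne'
  have hsum : (j : ℝ) / m * recip r * s + (1 - (j : ℝ) / m) * recip q * s = 1 := by
    rw [← add_mul, ← hpqr, hps]
  obtain ⟨C, C', hC, hC', h⟩ := exists_setLIntegral_iteratedDeriv_le hj0 hj hq hr hs0 hsum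
  refine ⟨C ^ s⁻¹, by positivity, fun Λ hΛ g hg i X Y hX hY hgX hgY => ?_⟩
  set Z : ℝ := X ^ ((j : ℝ) / m) * Y ^ (1 - (j : ℝ) / m) with hZ
  have hZ0 : 0 < Z := by positivity
  obtain ⟨M, hM⟩ := hg.bounded []
  obtain ⟨K, hK⟩ := hg.bounded (List.replicate m i)
  have hM0 : 0 ≤ M := (abs_nonneg _).trans (hM 0)
  set α : ℝ := (j : ℝ) / m * recip r * s with hα
  set β : ℝ := (1 - (j : ℝ) / m) * recip q * s with hβ
  have hα0 : 0 ≤ α := mul_nonneg (mul_nonneg hθ0.le (recip_nonneg r)) hs0.le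
  have hβ0 : 0 ≤ β := mul_nonneg (mul_nonneg hθ1.le (recip_nonneg q)) hs0.le
  set d : E3 → ℝ := pderivs (List.replicate j i) g with hd
  have hdc : Continuous d := (contDiff_pderivs hg.smooth _).continuous
  have hdp : IsTransPeriodic Λ d := hg.periodic.pderivs _
  set D : ℝ := C * Z ^ s with hD
  have hD0 : 0 < D := by positivity
  set W : E3 → ℝ≥0∞ := fun x => ENNReal.ofReal
    (nirenbergWeight α β q r X Y (pderivs (List.replicate m i) g x) (g x)) with hW
  have hmc : Continuous (pderivs (List.replicate m i) g) := (contDiff_pderivs hg.smooth _).continuous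
  have hWm : Measurable W :=
    (continuous_nirenbergWeight hmc hg.smooth.continuous).measurable.ennreal_ofReal
  have hmp := hg.periodic.pderivs (List.replicate m i)
  have hWp : IsTransPeriodic Λ W := fun x => by
    simp only [hW, (hmp x).1, (hmp x).2, (hg.periodic x).1, (hg.periodic x).2, and_self]
  have hW1 : ∫⁻ x, W x ∂(cellMeasure Λ) ≤ 1 :=
    lintegral_nirenbergWeight_le hmc hq hr hα0 hβ0
      (fun hrt => by rw [hα, hrt]; simp) (fun hqt => by rw [hβ, hqt]; simp) hsum hX hY hgX hgY
  -- `H N` is `|∂^j g|^p`, cut off where the derivative is too small to have a balanced scale `< N`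
  set H : ℕ → E3 → ℝ≥0∞ := fun N => {x | C' * (M + Y) * ((N : ℝ) + 1) ^ (-(j : ℝ)) < |d x|}.indicator
    (fun x => ENNReal.ofReal (|d x| ^ s)) with hH
  have hset : ∀ c : ℝ, MeasurableSet {x | c < |d x|} := fun c =>
    (isOpen_lt continuous_const hdc.abs).measurableSet
  have hds : Measurable fun x => ENNReal.ofReal (|d x| ^ s) :=
    (hdc.abs.rpow_const fun _ => Or.inr hs0.le).measurable.ennreal_ofReal
  have hHm : ∀ N, Measurable (H N) := fun N => hds.indicator (hset _)
  have hHp : ∀ N, IsTransPeriodic Λ (H N) := fun N x => by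
    simp only [hH, Set.indicator_apply, Set.mem_ofPred_eq, (hdp x).1, (hdp x).2, and_self]
  have hHle : ∀ N, ∫⁻ x, H N x ∂(cellMeasure Λ) ≤ ENNReal.ofReal D := by
    intro N
    have hN : (0 : ℝ) < N + 1 := by positivity
    have hτ : Measurable fun t : ℝ => t • stdBasis3 i := by fun_prop
    -- average the one-dimensional inequality over a long segment of length `A`
    have hA : ∀ A : ℝ, 0 < A → ENNReal.ofReal A * ∫⁻ x, H N x ∂(cellMeasure Λ) ≤
        ENNReal.ofReal D * ENNReal.ofReal (A + 2 * (N + 1)) := by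
      intro A hA
      have h1 : ∀ x, ∫⁻ t in Set.Icc 0 A, H N (x + t • stdBasis3 i) ≤
          ENNReal.ofReal D * ∫⁻ t in Set.Icc (0 - ((N : ℝ) + 1)) (A + (N + 1)), W (x + t • stdBasis3 i) := by
        intro x
        have h2 := h (fun t => g (x + t • stdBasis3 i)) (contDiff_line hg.smooth i x) K M X Y (N + 1)
          (fun t => hM _) (by rw [iteratedDeriv_line hg.smooth]; exact fun t => hK _) hX hY hN
          (by
            rintro rfl
            rw [iteratedDeriv_line hg.smooth]
            exact fun t => abs_le_of_eLpNorm_top_le hΛ hmc hmp hX.le hgX _)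
          (by
            rintro rfl
            exact fun t => abs_le_of_eLpNorm_top_le hΛ hg.smooth.continuous hg.periodic hY.le hgY _) 0 A
        rw [iteratedDeriv_line hg.smooth, iteratedDeriv_line hg.smooth] at h2
        refine le_trans (le_of_eq ?_) h2
        have hms : MeasurableSet {t : ℝ | C' * (M + Y) * ((N : ℝ) + 1) ^ (-(j : ℝ)) <
            |pderivs (List.replicate j i) g (x + t • stdBasis3 i)|} :=
          (hτ.const_add x) (hset _)
        rw [Set.inter_comm, ← Measure.restrict_restrict hms, ← lintegral_indicator hms]
        rfl
      have h3 := lintegral_mono (μ := cellMeasure Λ) h1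
      rw [lintegral_cell_lintegral_add hΛ (hHp N) (hHm N) _ hτ, lintegral_const_mul' _ _ ENNReal.ofReal_ne_top,
        lintegral_cell_lintegral_add hΛ hWp hWm _ hτ, volume_Icc_univ, volume_Icc_univ] at h3
      rw [sub_zero] at h3
      refine h3.trans ?_
      gcongr
      calc _ ≤ ENNReal.ofReal (A + (N + 1) - (0 - ((N : ℝ) + 1))) * 1 := by gcongr
        _ = _ := by rw [mul_one]; congr 1; ring
    have hlim : Filter.Tendsto (fun A : ℝ => ENNReal.ofReal (D * (1 + 2 * (N + 1) * A⁻¹))) Filter.atTop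
        (nhds (ENNReal.ofReal (D * (1 + 2 * (N + 1) * 0)))) :=
      ENNReal.tendsto_ofReal (((tendsto_inv_atTop_zero.const_mul _).const_add 1).const_mul D)
    rw [mul_zero, add_zero, mul_one] at hlim
    refine ge_of_tendsto hlim ?_
    filter_upwards [Filter.eventually_gt_atTop 0] with A hA0
    have h4 := hA A hA0
    have hAne : ENNReal.ofReal A ≠ 0 := by simpa using hA0
    rw [mul_comm, ← ENNReal.le_div_iff_mul_le (Or.inl hAne) (Or.inl ENNReal.ofReal_ne_top)] at h4
    refine h4.trans (le_of_eq ?_)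
    rw [← ENNReal.ofReal_mul hD0.le, ← ENNReal.ofReal_div_of_pos hA0]
    congr 1; field_simp
  -- the exceptional sets shrink to the zeros of `d` as `N → ∞`
  have hfin : ∫⁻ x, ENNReal.ofReal (|d x| ^ s) ∂(cellMeasure Λ) ≤ ENNReal.ofReal D := by
    calc _ ≤ ∫⁻ x, Filter.liminf (fun N => H N x) Filter.atTop ∂(cellMeasure Λ) := by
          refine lintegral_mono fun x => ?_
          refine Filter.le_liminf_of_le (by isBoundedDefault) ?_
          rcases eq_or_ne (d x) 0 with h0 | h0
          · simp [h0, hs0.ne']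
          have hlim : Filter.Tendsto (fun N : ℕ => C' * (M + Y) * ((N : ℝ) + 1) ^ (-(j : ℝ)))
              Filter.atTop (nhds 0) := by
            have h1 := (tendsto_rpow_neg_atTop (y := (j : ℝ)) (by linarith)).const_mul (C' * (M + Y))
            rw [mul_zero] at h1
            exact h1.comp (Filter.tendsto_atTop_add_const_right _ _ tendsto_natCast_atTop_atTop)
          filter_upwards [hlim.eventually (gt_mem_nhds (abs_pos.2 h0))] with N hN
          simp only [hH]
          rw [Set.indicator_of_mem (by exact hN)]
      _ ≤ Filter.liminf (fun N => ∫⁻ x, H N x ∂(cellMeasure Λ)) Filter.atTop :=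
          lintegral_liminf_le hHm
      _ ≤ _ := Filter.liminf_le_of_le (by isBoundedDefault) fun b hb => by
          obtain ⟨N, hN⟩ := hb.exists
          exact hN.trans (hHle N)
  rw [eLpNorm_eq_lintegral_rpow_enorm_toReal hp0 hpt, one_div, ENNReal.rpow_inv_le_iff hs0,
    ENNReal.ofReal_rpow_of_nonneg (by positivity) hs0.le, Real.mul_rpow (by positivity) hZ0.le,
    Real.rpow_inv_rpow hC.le hs0.ne']
  refine le_trans (le_of_eq ?_) hfin
  refine lintegral_congr fun x => ?_
  rw [Real.enorm_eq_ofReal_abs, ENNReal.ofReal_rpow_of_nonneg (abs_nonneg _) hs0.le]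

theorem recip_injective {p p' : ℝ≥0∞} (hp : 1 ≤ p) (hp' : 1 ≤ p') (h : recip p = recip p') : p = p' := by
  have h1 : p⁻¹ ≠ ⊤ := ENNReal.inv_ne_top.2 (zero_lt_one.trans_le hp).ne'
  have h2 : p'⁻¹ ≠ ⊤ := ENNReal.inv_ne_top.2 (zero_lt_one.trans_le hp').ne'
  exact inv_injective ((ENNReal.toReal_eq_toReal_iff' h1 h2).1 h)

theorem exists_recip_eq {t : ℝ} (h0 : 0 ≤ t) (h1 : t ≤ 1) : ∃ p : ℝ≥0∞, 1 ≤ p ∧ recip p = t := by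
  refine ⟨(ENNReal.ofReal t)⁻¹, ?_, ?_⟩
  · rw [ENNReal.one_le_inv]; exact ENNReal.ofReal_le_one.2 h1
  · simp [recip, h0]

/-- Nirenberg's inequality for mixed derivatives, with exponents interpolated linearly between
`(0, q)` and `(m, r)`. -/
theorem exists_eLpNorm_pderivs_le_of_list {m : ℕ} {q r : ℝ≥0∞} (hq : 1 ≤ q) (hr : 1 ≤ r)
    (l : List (Fin 3)) (hl : l.length < m) : ∃ C : ℝ, 0 < C ∧ ∀ p : ℝ≥0∞, 1 ≤ p →
      recip p = (l.length : ℝ) / m * recip r + (1 - (l.length : ℝ) / m) * recip q →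
      ∀ Λ : ℝ, 0 < Λ → ∀ g : E3 → ℝ, IsNice Λ g → ∀ X Y : ℝ, 0 < X → 0 < Y →
      (∀ l : List (Fin 3), l.length = m → eLpNorm (pderivs l g) r (cellMeasure Λ) ≤ ENNReal.ofReal X) →
      eLpNorm g q (cellMeasure Λ) ≤ ENNReal.ofReal Y →
      eLpNorm (pderivs l g) p (cellMeasure Λ) ≤
        ENNReal.ofReal (C * (X ^ ((l.length : ℝ) / m) * Y ^ (1 - (l.length : ℝ) / m))) := by
  -- treat a block of equal directions at a time
  have step : ∀ (i : Fin 3) (b : ℕ) (l : List (Fin 3)), b + l.length < m →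
      (∃ C : ℝ, 0 < C ∧ ∀ p : ℝ≥0∞, 1 ≤ p →
        recip p = (l.length : ℝ) / m * recip r + (1 - (l.length : ℝ) / m) * recip q →
        ∀ Λ : ℝ, 0 < Λ → ∀ g : E3 → ℝ, IsNice Λ g → ∀ X Y : ℝ, 0 < X → 0 < Y →
        (∀ l : List (Fin 3), l.length = m → eLpNorm (pderivs l g) r (cellMeasure Λ) ≤ ENNReal.ofReal X) →
        eLpNorm g q (cellMeasure Λ) ≤ ENNReal.ofReal Y →
        eLpNorm (pderivs l g) p (cellMeasure Λ) ≤
          ENNReal.ofReal (C * (X ^ ((l.length : ℝ) / m) * Y ^ (1 - (l.length : ℝ) / m)))) →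
      ∃ C : ℝ, 0 < C ∧ ∀ p : ℝ≥0∞, 1 ≤ p →
        recip p = ((List.replicate b i ++ l).length : ℝ) / m * recip r +
          (1 - ((List.replicate b i ++ l).length : ℝ) / m) * recip q →
        ∀ Λ : ℝ, 0 < Λ → ∀ g : E3 → ℝ, IsNice Λ g → ∀ X Y : ℝ, 0 < X → 0 < Y →
        (∀ l : List (Fin 3), l.length = m → eLpNorm (pderivs l g) r (cellMeasure Λ) ≤ ENNReal.ofReal X) →
        eLpNorm g q (cellMeasure Λ) ≤ ENNReal.ofReal Y →
        eLpNorm (pderivs (List.replicate b i ++ l) g) p (cellMeasure Λ) ≤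
          ENNReal.ofReal (C * (X ^ (((List.replicate b i ++ l).length : ℝ) / m) *
            Y ^ (1 - ((List.replicate b i ++ l).length : ℝ) / m))) := by
    intro i b l hbl ⟨C₁, hC₁, h₁⟩
    rcases Nat.eq_zero_or_pos b with rfl | hb
    · exact ⟨C₁, hC₁, h₁⟩
    set a := l.length with ha
    have ha0 : (0 : ℝ) ≤ a := Nat.cast_nonneg _
    have hb1 : (1 : ℝ) ≤ b := by exact_mod_cast hb
    have habm : (b : ℝ) + a + 1 ≤ m := by exact_mod_cast hbl
    have hm0 : (0 : ℝ) < m := by linarith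
    have hma : (0 : ℝ) < m - a := by linarith
    have hcast : ((m - a : ℕ) : ℝ) = m - a := by rw [Nat.cast_sub (by omega)]
    have hθ0 : (0 : ℝ) ≤ a / m := by positivity
    have hθ1 : (0 : ℝ) ≤ 1 - (a : ℝ) / m := by rw [sub_nonneg, div_le_one hm0]; linarith
    have hr0 := recip_nonneg r
    have hr1 := recip_le_one hr
    have hq0 := recip_nonneg q
    have hq1 := recip_le_one hq
    obtain ⟨p₁, hp₁, hp₁e⟩ := exists_recip_eq (t := (a : ℝ) / m * recip r + (1 - (a : ℝ) / m) * recip q)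
      (by positivity) (by nlinarith)
    have hlen : (((List.replicate b i ++ l).length : ℕ) : ℝ) = b + a := by simp [ha]
    rw [hlen]
    -- without an admissible exponent there is nothing to prove
    by_cases hpex : ∃ p : ℝ≥0∞, 1 ≤ p ∧ recip p = ((b : ℝ) + a) / m * recip r + (1 - ((b : ℝ) + a) / m) * recip q
    swap
    · exact ⟨1, one_pos, fun p hp hpe => absurd ⟨p, hp, hpe⟩ hpex⟩
    obtain ⟨p₂, hp₂, hp₂e⟩ := hpex
    obtain ⟨C₂, hC₂, h₂⟩ := exists_eLpNorm_pderivs_replicate_le hb (show b < m - a by omega) hp₁ hr hp₂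
      (by rw [hp₁e, hp₂e, hcast]; field_simp; ring)
    rw [hcast] at h₂
    refine ⟨C₂ * C₁ ^ (1 - (b : ℝ) / (m - a)), by positivity,
      fun p hp hpe Λ hΛ g hg X Y hX hY hgX hgY => ?_⟩
    obtain rfl : p = p₂ := recip_injective hp hp₂ (hpe.trans hp₂e.symm)
    have h3 := h₁ p₁ hp₁ hp₁e Λ hΛ g hg X Y hX hY hgX hgY
    have h4 := h₂ Λ hΛ (pderivs l g) (hg.pderivs l) i X _ hX (by positivity)
      (by rw [← pderivs_append]; exact hgX _ (by simp; omega)) h3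
    rw [pderivs_append]
    refine h4.trans (le_of_eq ?_)
    congr 1
    rw [Real.mul_rpow hC₁.le (by positivity), Real.mul_rpow (by positivity) (by positivity),
      ← Real.rpow_mul hX.le, ← Real.rpow_mul hY.le]
    have e1 : X ^ (((b : ℝ) + a) / m) = X ^ ((b : ℝ) / (m - a)) * X ^ ((a : ℝ) / m * (1 - b / (m - a))) := by
      rw [← Real.rpow_add hX]; congr 1; field_simp; ring
    have e2 : 1 - ((b : ℝ) + a) / m = (1 - (a : ℝ) / m) * (1 - b / (m - a)) := by
      field_simp; ring
    rw [e1, e2]; ring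
  -- partial derivatives commute, so equal directions may be collected
  have hperm : l.Perm (List.replicate (l.count 0) 0 ++ (List.replicate (l.count 1) 1 ++
      (List.replicate (l.count 2) 2 ++ []))) := by
    rw [List.perm_iff_count]
    intro a
    fin_cases a <;> simp [List.count_replicate]
  have hlen := hperm.length_eq
  simp only [List.length_append, List.length_replicate, List.length_nil, add_zero] at hlen
  have h0 := step 2 (l.count 2) [] (by simp; omega) ⟨1, one_pos, fun p hp hpe Λ hΛ g hg X Y hX hY hgX hgY => by
    simp only [List.length_nil, Nat.cast_zero, zero_div, zero_mul, zero_add, sub_zero, one_mul] at hpe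
    obtain rfl : p = q := recip_injective hp hq hpe
    simpa [pderivs] using hgY⟩
  have h1 := step 1 (l.count 1) _ (by simp; omega) h0
  have h2 := step 0 (l.count 0) _ (by simp; omega) h1
  obtain ⟨C, hC, h⟩ := h2
  rw [← hperm.length_eq] at h
  refine ⟨C, hC, fun p hp hpe Λ hΛ g hg X Y hX hY hgX hgY => ?_⟩
  rw [pderivs_perm hg.smooth hperm]
  exact h p hp hpe Λ hΛ g hg X Y hX hY hgX hgY

/-- There are finitely many lists of a given length, so constants may be chosen uniformly. -/
theorem exists_forall_list_length {j : ℕ} {P : List (Fin 3) → ℝ → Prop}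
    (hP : ∀ l c c', P l c → c ≤ c' → P l c')
    (h : ∀ l : List (Fin 3), l.length = j → ∃ C : ℝ, 0 < C ∧ P l C) :
    ∃ C : ℝ, 0 < C ∧ ∀ l : List (Fin 3), l.length = j → P l C := by
  choose! c hc hPc using h
  refine ⟨∑ I : Fin j → Fin 3, c (List.ofFn I), Finset.sum_pos (fun I _ => hc _ (by simp))
    Finset.univ_nonempty, fun l hl => hP _ _ _ (hPc l hl) ?_⟩
  subst hl
  have := Finset.single_le_sum (f := fun I : Fin l.length → Fin 3 => c (List.ofFn I))
    (fun I _ => (hc _ (by simp)).le) (Finset.mem_univ (l.get))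
  simpa using this

/-- Nirenberg's inequality `‖∇^j g‖_p ≤ C ‖∇^m g‖_r ^ (j/m) ‖g‖_q ^ (1 - j/m)`. -/
theorem exists_eLpNorm_pderivs_le {m j : ℕ} (hj : j < m) {q r p : ℝ≥0∞} (hq : 1 ≤ q) (hr : 1 ≤ r)
    (hp : 1 ≤ p) (hpqr : recip p = (j : ℝ) / m * recip r + (1 - (j : ℝ) / m) * recip q) :
    ∃ C : ℝ, 0 < C ∧ ∀ l : List (Fin 3), l.length = j →
      ∀ Λ : ℝ, 0 < Λ → ∀ g : E3 → ℝ, IsNice Λ g → ∀ X Y : ℝ, 0 < X → 0 < Y →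
      (∀ l : List (Fin 3), l.length = m → eLpNorm (pderivs l g) r (cellMeasure Λ) ≤ ENNReal.ofReal X) →
      eLpNorm g q (cellMeasure Λ) ≤ ENNReal.ofReal Y →
      eLpNorm (pderivs l g) p (cellMeasure Λ) ≤
        ENNReal.ofReal (C * (X ^ ((j : ℝ) / m) * Y ^ (1 - (j : ℝ) / m))) := by
  refine exists_forall_list_length (fun l c c' h hcc Λ hΛ g hg X Y hX hY hgX hgY =>
    (h Λ hΛ g hg X Y hX hY hgX hgY).trans (ENNReal.ofReal_le_ofReal (by gcongr))) fun l hl => ?_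
  obtain ⟨C, hC, h⟩ := exists_eLpNorm_pderivs_le_of_list hq hr l (by omega : l.length < m)
  rw [hl] at h
  exact ⟨C, hC, h p hp hpqr⟩

/-! ### Interpolation between Lebesgue exponents -/

/-- Interpolation of `L^p` norms, with upper bounds in place of the norms of `f`. -/
theorem eLpNorm_le_of_recip_eq {μ : Measure E3} {f : E3 → ℝ} (hf : AEStronglyMeasurable f μ)
    {p p₀ p₁ : ℝ≥0∞} (hp : 1 ≤ p) (hp₀ : 1 ≤ p₀) (hp₁ : 1 ≤ p₁) {t A B : ℝ} (ht0 : 0 ≤ t) (ht1 : t ≤ 1)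
    (h : recip p = (1 - t) * recip p₀ + t * recip p₁) (hA : 0 ≤ A) (hB : 0 ≤ B)
    (hfA : eLpNorm f p₀ μ ≤ ENNReal.ofReal A) (hfB : eLpNorm f p₁ μ ≤ ENNReal.ofReal B) :
    eLpNorm f p μ ≤ ENNReal.ofReal (A ^ (1 - t) * B ^ t) := by
  rcases ht0.eq_or_lt with rfl | ht0
  · obtain rfl : p = p₀ := recip_injective hp hp₀ (by simpa using h)
    simpa using hfA
  rcases ht1.eq_or_lt with rfl | ht1
  · obtain rfl : p = p₁ := recip_injective hp hp₁ (by simpa using h)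
    simpa using hfB
  have ht1' : 0 < 1 - t := by linarith
  have hne0 : ENNReal.ofReal (1 - t) ≠ 0 := by simpa using ht1
  have hne1 : ENNReal.ofReal t ≠ 0 := by simpa using ht0
  set P₀ := p₀ / ENNReal.ofReal (1 - t) with hP₀
  set P₁ := p₁ / ENNReal.ofReal t with hP₁
  have hinv (x : ℝ≥0∞) (hx : 1 ≤ x) : x⁻¹ = ENNReal.ofReal (recip x) :=
    (ENNReal.ofReal_toReal (ENNReal.inv_ne_top.2 (zero_lt_one.trans_le hx).ne')).symm
  have hH : ENNReal.HolderTriple P₀ P₁ p := ⟨by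
    rw [hP₀, hP₁, ENNReal.inv_div (Or.inl ENNReal.ofReal_ne_top) (Or.inl hne0),
      ENNReal.inv_div (Or.inl ENNReal.ofReal_ne_top) (Or.inl hne1), div_eq_mul_inv, div_eq_mul_inv,
      hinv p hp, hinv p₀ hp₀, hinv p₁ hp₁, ← ENNReal.ofReal_mul ht1'.le, ← ENNReal.ofReal_mul ht0.le,
      ← ENNReal.ofReal_add (mul_nonneg ht1'.le (recip_nonneg _)) (mul_nonneg ht0.le (recip_nonneg _)), h]⟩
  have hc (c : ℝ) (hc : 0 ≤ c) : Continuous fun y : ℝ => |y| ^ c :=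
    continuous_abs.rpow_const fun _ => Or.inr hc
  have hm (c : ℝ) (hc0 : 0 ≤ c) : AEStronglyMeasurable (fun x => ‖f x‖ ^ c) μ :=
    (hc c hc0).comp_aestronglyMeasurable hf
  have h1 := eLpNorm_smul_le_mul_eLpNorm (p := P₀) (q := P₁) (r := p) (hm t ht0.le) (hm (1 - t) ht1'.le)
  have h2 : (fun x => ‖f x‖ ^ (1 - t)) • (fun x => ‖f x‖ ^ t) = fun x => ‖f x‖ := by
    funext x
    simp only [Pi.smul_apply', smul_eq_mul]
    rw [← Real.rpow_add_of_nonneg (norm_nonneg _) ht1'.le ht0.le]; simp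
  rw [h2, eLpNorm_norm, eLpNorm_norm_rpow _ ht1', eLpNorm_norm_rpow _ ht0, hP₀, hP₁,
    ENNReal.div_mul_cancel hne0 ENNReal.ofReal_ne_top, ENNReal.div_mul_cancel hne1 ENNReal.ofReal_ne_top] at h1
  refine h1.trans ?_
  rw [ENNReal.ofReal_mul (by positivity), ← ENNReal.ofReal_rpow_of_nonneg hA ht1'.le,
    ← ENNReal.ofReal_rpow_of_nonneg hB ht0.le]
  gcongr

/-! ### The transverse mean -/

/-- The vector with coordinates `(0, s₁, s₂)`. -/
noncomputable def transShift (s : ℝ × ℝ) : E3 := s.1 • stdBasis3 1 + s.2 • stdBasis3 2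

/-- The uniform probability measure on `[0, Λ]²`. -/
noncomputable def transMeasure (Λ : ℝ) : Measure (ℝ × ℝ) :=
  ProbabilityTheory.cond volume (Set.Icc 0 Λ ×ˢ Set.Icc 0 Λ)

/-- The mean of `u` over the torus fibre through `x`. -/
noncomputable def transMean (Λ : ℝ) (u : E3 → ℝ) (x : E3) : ℝ :=
  ∫ s, u (x + transShift s) ∂(transMeasure Λ)

theorem measurable_transShift : Measurable transShift := by
  unfold transShift; fun_prop

theorem volume_square {Λ : ℝ} (hΛ : 0 < Λ) :
    volume (Set.Icc 0 Λ ×ˢ Set.Icc 0 Λ : Set (ℝ × ℝ)) = ENNReal.ofReal (Λ ^ 2) := by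
  rw [Measure.volume_eq_prod, Measure.prod_prod, Real.volume_Icc, sub_zero, ← ENNReal.ofReal_mul hΛ.le, sq]

theorem isProbabilityMeasure_transMeasure {Λ : ℝ} (hΛ : 0 < Λ) : IsProbabilityMeasure (transMeasure Λ) :=
  ProbabilityTheory.cond_isProbabilityMeasure_of_finite
    (by rw [volume_square hΛ]; simpa using hΛ.ne') (by rw [volume_square hΛ]; exact ENNReal.ofReal_ne_top)

theorem ae_transMeasure_mem (Λ : ℝ) : ∀ᵐ s ∂(transMeasure Λ), s.1 ∈ Set.Icc 0 Λ ∧ s.2 ∈ Set.Icc 0 Λ :=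
  ProbabilityTheory.ae_cond_mem (measurableSet_Icc.prod measurableSet_Icc)

/-- Functions whose transverse mean vanishes identically. -/
def IsMeanZero (Λ : ℝ) (u : E3 → ℝ) : Prop := ∀ x, transMean Λ u x = 0

/-- Functions of the first coordinate only. -/
def IsLongitudinal (u : E3 → ℝ) : Prop := ∀ x s, u (x + transShift s) = u x

theorem IsLongitudinal.pderivs {u : E3 → ℝ} (hu : IsLongitudinal u) (l : List (Fin 3)) :
    IsLongitudinal (pderivs l u) := by
  intro x s
  have h1 : (fun x => u (x + transShift s)) = u := funext fun x => hu x s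
  have := pderivs_comp_add_right l u (transShift s)
  rw [h1] at this; exact (congrFun this x).symm

theorem IsMeanZero.pderiv {Λ : ℝ} (hΛ : 0 < Λ) {u : E3 → ℝ} (hn : IsNice Λ u) (hu : IsMeanZero Λ u)
    (i : Fin 3) : IsMeanZero Λ (pderiv i u) := by
  intro x
  have := isProbabilityMeasure_transMeasure hΛ
  obtain ⟨M, hM⟩ := hn.bounded []
  obtain ⟨K, hK⟩ := hn.bounded [i]
  have hmeas : ∀ v : E3 → ℝ, Continuous v → ∀ y,
      AEStronglyMeasurable (fun s => v (y + transShift s)) (transMeasure Λ) := fun v hv y =>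
    (hv.stronglyMeasurable.comp_measurable (measurable_transShift.const_add y)).aestronglyMeasurable
  have h := hasDerivAt_integral_of_dominated_loc_of_deriv_le (μ := transMeasure Λ) (x₀ := (0 : ℝ))
    (s := Set.univ) (F := fun t s => u (x + transShift s + t • stdBasis3 i))
    (F' := fun t s => _root_.pderiv i u (x + transShift s + t • stdBasis3 i)) (bound := fun _ => K)
    Filter.univ_mem
    (Filter.Eventually.of_forall fun t => by
      have := hmeas u hn.smooth.continuous (x + t • stdBasis3 i)
      simpa only [add_right_comm] using this)
    (by
      refine Integrable.of_bound ?_ M (Filter.Eventually.of_forall fun s => hM _)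
      simpa using hmeas u hn.smooth.continuous x)
    (by simpa using hmeas _ (contDiff_pderiv hn.smooth i).continuous x)
    (Filter.Eventually.of_forall fun s t _ => hK _) (integrable_const K)
    (Filter.Eventually.of_forall fun s t _ => hasDerivAt_line hn.smooth i _ t)
  have h0 : (fun t : ℝ => ∫ s, u (x + transShift s + t • stdBasis3 i) ∂(transMeasure Λ)) = fun _ => 0 := by
    funext t
    have := hu (x + t • stdBasis3 i)
    unfold transMean at this
    simpa only [add_right_comm] using this
  have h2 := h.2
  rw [h0] at h2
  have h3 := h2.unique (hasDerivAt_const (0 : ℝ) (0 : ℝ))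
  simpa [transMean] using h3

theorem IsMeanZero.pderivs {Λ : ℝ} (hΛ : 0 < Λ) {u : E3 → ℝ} (hn : IsNice Λ u) (hu : IsMeanZero Λ u)
    (l : List (Fin 3)) : IsMeanZero Λ (pderivs l u) := by
  induction l with
  | nil => exact hu
  | cons i l ih => exact ih.pderiv hΛ (hn.pderivs l) i

theorem enorm_sub_le_lintegral {u : E3 → ℝ} (hu : ContDiff ℝ ∞ u) (x y : E3) :
    ‖u (x + y) - u x‖ₑ ≤ ∫⁻ t in Set.Icc (0 : ℝ) 1, ‖fderiv ℝ u (x + t • y) y‖ₑ := by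
  have hd : ∀ t : ℝ, HasDerivAt (fun s : ℝ => u (x + s • y)) (fderiv ℝ u (x + t • y) y) t := by
    intro t
    have h1 : HasFDerivAt u (fderiv ℝ u (x + t • y)) (x + t • y) :=
      (hu.differentiable (by simp) _).hasFDerivAt
    have h2 : HasDerivAt (fun s : ℝ => x + s • y) y t := by
      simpa using! ((hasDerivAt_id t).smul_const y).const_add x
    exact h1.comp_hasDerivAt t h2
  have hc : Continuous fun t : ℝ => fderiv ℝ u (x + t • y) y :=
    ((hu.continuous_fderiv (by simp)).comp (by fun_prop)).clm_apply continuous_const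
  have h1 := intervalIntegral.integral_eq_sub_of_hasDerivAt (fun t _ => hd t)
    (hc.intervalIntegrable 0 1)
  simp only [one_smul, zero_smul, add_zero] at h1
  rw [← h1, intervalIntegral.integral_of_le zero_le_one, ← integral_Icc_eq_integral_Ioc]
  exact enorm_integral_le_lintegral_enorm _

theorem E3_eq_sum (y : E3) : y = y 0 • stdBasis3 0 + y 1 • stdBasis3 1 + y 2 • stdBasis3 2 := by
  ext i; fin_cases i <;> simp

theorem fderiv_apply_eq (u : E3 → ℝ) (x y : E3) :
    fderiv ℝ u x y = y 0 * pderiv 0 u x + y 1 * pderiv 1 u x + y 2 * pderiv 2 u x := by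
  conv_lhs => rw [E3_eq_sum y]
  simp [pderiv]

theorem transShift_apply_zero (s : ℝ × ℝ) : transShift s 0 = 0 := by simp [transShift]
theorem transShift_apply_one (s : ℝ × ℝ) : transShift s 1 = s.1 := by simp [transShift]
theorem transShift_apply_two (s : ℝ × ℝ) : transShift s 2 = s.2 := by simp [transShift]

/-- Poincaré's inequality for functions with vanishing transverse mean. -/
theorem eLpNorm_le_of_isMeanZero {Λ : ℝ} (hΛ : 0 < Λ) {u : E3 → ℝ} (hn : IsNice Λ u)
    (hu : IsMeanZero Λ u) {p : ℝ≥0∞} (hp : 1 ≤ p) {X : ℝ} (hX : 0 ≤ X)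
    (h : ∀ i, eLpNorm (pderiv i u) p (cellMeasure Λ) ≤ ENNReal.ofReal X) :
    eLpNorm u p (cellMeasure Λ) ≤ ENNReal.ofReal (2 * Λ * X) := by
  have := isProbabilityMeasure_transMeasure hΛ
  have hI : IsProbabilityMeasure (volume.restrict (Set.Icc (0 : ℝ) 1)) := ⟨by simp⟩
  set g : E3 → ℝ := fun x => Λ * (|pderiv 1 u x| + |pderiv 2 u x|) with hg
  have hc (i : Fin 3) : Continuous (pderiv i u) := (contDiff_pderiv hn.smooth i).continuous
  have hgc : Continuous g := by fun_prop
  have hgp : IsTransPeriodic Λ g := fun x => by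
    have h1 := hn.periodic.pderivs [1] x
    have h2 := hn.periodic.pderivs [2] x
    simp only [_root_.pderivs] at h1 h2
    simp only [hg, h1.1, h1.2, h2.1, h2.2, and_self]
  have h1 : eLpNorm u p (cellMeasure Λ) ≤ eLpNorm g p (cellMeasure Λ) := by
    refine eLpNorm_cell_le_of_le_average hΛ hp hgp hgc.stronglyMeasurable
      ((transMeasure Λ).prod (volume.restrict (Set.Icc (0 : ℝ) 1)))
      (τ := fun z => z.2 • transShift z.1) (measurable_snd.smul (measurable_transShift.comp measurable_fst)) ?_
    intro x
    rw [lintegral_prod _ (by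
      exact ((hgc.measurable.comp ((measurable_snd.smul
        (measurable_transShift.comp measurable_fst)).const_add x)).enorm).aemeasurable)]
    obtain ⟨M, hM⟩ := hn.bounded []
    have hint : Integrable (fun s => u (x + transShift s)) (transMeasure Λ) :=
      Integrable.of_bound (hn.stronglyMeasurable.comp_measurable
        (measurable_transShift.const_add x)).aestronglyMeasurable M (Filter.Eventually.of_forall fun s => hM _)
    -- since the transverse mean vanishes, `u x` is minus the mean of the increments along the fibre
    have e1 : u x = -∫ s, (u (x + transShift s) - u x) ∂(transMeasure Λ) := by
      rw [integral_sub hint (integrable_const _)]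
      have := hu x
      unfold transMean at this
      simp [this]
    rw [e1, enorm_neg]
    refine (enorm_integral_le_lintegral_enorm _).trans (lintegral_mono_ae ?_)
    filter_upwards [ae_transMeasure_mem Λ] with s hs
    refine (enorm_sub_le_lintegral hn.smooth x (transShift s)).trans (lintegral_mono fun t => ?_)
    rw [fderiv_apply_eq, transShift_apply_zero, transShift_apply_one, transShift_apply_two, zero_mul, zero_add,
      Real.enorm_eq_ofReal_abs, Real.enorm_eq_ofReal_abs]
    apply ENNReal.ofReal_le_ofReal
    refine (abs_add_le _ _).trans (le_trans ?_ (le_abs_self _))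
    simp only [hg, abs_mul, mul_add]
    have := abs_of_nonneg hs.1.1
    have := abs_of_nonneg hs.2.1
    rw [abs_of_nonneg hs.1.1, abs_of_nonneg hs.2.1]
    gcongr
    · exact hs.1.2
    · exact hs.2.2
  refine h1.trans ?_
  have h2 : g = Λ • ((fun x => ‖pderiv 1 u x‖) + fun x => ‖pderiv 2 u x‖) := by
    funext x; simp [hg]
  rw [h2, eLpNorm_const_smul]
  calc _ ≤ ‖Λ‖ₑ * (ENNReal.ofReal X + ENNReal.ofReal X) := by
        gcongr
        refine (eLpNorm_add_le (hc 1).norm.aestronglyMeasurable (hc 2).norm.aestronglyMeasurable hp).trans ?_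
        rw [eLpNorm_norm, eLpNorm_norm]
        exact add_le_add (h 1) (h 2)
    _ = _ := by
        rw [Real.enorm_eq_ofReal hΛ.le, ← ENNReal.ofReal_add hX hX, ← ENNReal.ofReal_mul hΛ.le]
        congr 1; ring

/-! ### Supremum bounds: functions of the first coordinate -/

theorem enorm_line_sub_le {u : E3 → ℝ} (hu : ContDiff ℝ ∞ u) (i : Fin 3) (x : E3) {t h : ℝ}
    (ht : t ∈ Set.Icc 0 h) :
    ‖u x‖ₑ ≤ ‖u (x + t • stdBasis3 i)‖ₑ + ∫⁻ s in Set.Icc 0 h, ‖pderiv i u (x + s • stdBasis3 i)‖ₑ := by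
  have hc : Continuous fun s : ℝ => pderiv i u (x + s • stdBasis3 i) :=
    (contDiff_pderiv hu i).continuous.comp (by fun_prop)
  have h1 := intervalIntegral.integral_eq_sub_of_hasDerivAt (fun s _ => hasDerivAt_line hu i x s)
    (hc.intervalIntegrable 0 t)
  simp only [zero_smul, add_zero] at h1
  have h2 : u x = u (x + t • stdBasis3 i) - ∫ s in (0 : ℝ)..t, pderiv i u (x + s • stdBasis3 i) := by
    linarith
  have h3 : ‖∫ s in (0 : ℝ)..t, pderiv i u (x + s • stdBasis3 i)‖ₑ ≤
      ∫⁻ s in Set.Icc 0 h, ‖pderiv i u (x + s • stdBasis3 i)‖ₑ := by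
    rw [intervalIntegral.integral_of_le ht.1]
    exact (enorm_integral_le_lintegral_enorm _).trans (lintegral_mono_set
      (Set.Ioc_subset_Icc_self.trans (Set.Icc_subset_Icc_right ht.2)))
  calc ‖u x‖ₑ = ‖u (x + t • stdBasis3 i) + -∫ s in (0 : ℝ)..t, pderiv i u (x + s • stdBasis3 i)‖ₑ := by
        conv_lhs => rw [h2]
        rw [sub_eq_add_neg]
    _ ≤ _ := (enorm_add_le _ _).trans (by rw [enorm_neg]; gcongr)

theorem enorm_le_lintegral_line {u : E3 → ℝ} (hu : ContDiff ℝ ∞ u) (i : Fin 3) (x : E3) {h : ℝ}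
    (hh : 0 < h) :
    ‖u x‖ₑ ≤ ∫⁻ t in Set.Icc 0 h, (ENNReal.ofReal h⁻¹ * ‖u (x + t • stdBasis3 i)‖ₑ +
      ‖pderiv i u (x + t • stdBasis3 i)‖ₑ) := by
  set J := ∫⁻ s in Set.Icc 0 h, ‖pderiv i u (x + s • stdBasis3 i)‖ₑ with hJ
  have hc : Continuous fun s : ℝ => u (x + s • stdBasis3 i) := hu.continuous.comp (by fun_prop)
  have h1 : ‖u x‖ₑ * ENNReal.ofReal h ≤
      (∫⁻ t in Set.Icc 0 h, ‖u (x + t • stdBasis3 i)‖ₑ) + J * ENNReal.ofReal h := by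
    calc ‖u x‖ₑ * ENNReal.ofReal h = ∫⁻ _ in Set.Icc 0 h, ‖u x‖ₑ := by simp
      _ ≤ ∫⁻ t in Set.Icc 0 h, (‖u (x + t • stdBasis3 i)‖ₑ + J) :=
          setLIntegral_mono' measurableSet_Icc fun t ht => enorm_line_sub_le hu i x ht
      _ = _ := by rw [lintegral_add_right _ measurable_const]; simp
  have hne : ENNReal.ofReal h ≠ 0 := by simpa using hh
  rw [lintegral_add_left (hc.measurable.enorm.const_mul _), lintegral_const_mul' _ _ ENNReal.ofReal_ne_top,
    ENNReal.ofReal_inv_of_pos hh, ← hJ]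
  calc ‖u x‖ₑ = (ENNReal.ofReal h)⁻¹ * (‖u x‖ₑ * ENNReal.ofReal h) := by
        rw [mul_comm ‖u x‖ₑ, ← mul_assoc, ENNReal.inv_mul_cancel hne ENNReal.ofReal_ne_top, one_mul]
    _ ≤ (ENNReal.ofReal h)⁻¹ * ((∫⁻ t in Set.Icc 0 h, ‖u (x + t • stdBasis3 i)‖ₑ) + J * ENNReal.ofReal h) := by
        gcongr
    _ = _ := by
        rw [mul_add, mul_comm J, ← mul_assoc _ _ J, ENNReal.inv_mul_cancel hne ENNReal.ofReal_ne_top, one_mul]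

theorem lintegral_line_of_isLongitudinal {Λ : ℝ} (hΛ : 0 < Λ) {g : E3 → ℝ} (hg : IsLongitudinal g)
    (hm : StronglyMeasurable g) (x : E3) (h : ℝ) :
    ∫⁻ t in Set.Icc 0 h, ‖g (x + t • stdBasis3 0)‖ₑ =
      ENNReal.ofReal (Λ ^ 2)⁻¹ * ∫⁻ y in coordBox h Λ Λ, ‖g (x + y)‖ₑ := by
  rw [setLIntegral_coordBox _ _ _ (by
    exact (hm.comp_measurable (measurable_const_add x)).enorm)]
  have e : ∀ s t w : ℝ, g (x + (s • stdBasis3 0 + t • stdBasis3 1 + w • stdBasis3 2)) =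
      g (x + s • stdBasis3 0) := by
    intro s t w
    rw [← hg (x + s • stdBasis3 0) (t, w), transShift]
    congr 1; simp only [add_assoc]
  simp only [e, setLIntegral_const, Real.volume_Icc, sub_zero]
  rw [lintegral_mul_const' _ _ ENNReal.ofReal_ne_top, lintegral_mul_const' _ _ ENNReal.ofReal_ne_top,
    mul_assoc, ← ENNReal.ofReal_mul hΛ.le, mul_comm, mul_assoc, ← ENNReal.ofReal_mul (by positivity)]
  rw [← sq, mul_inv_cancel₀ (by positivity), ENNReal.ofReal_one, mul_one]

/-- An average over the box `[0, h] × [0, Λ]²` bounds the value of a function of the first coordinate. -/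
theorem abs_le_of_isLongitudinal {Λ : ℝ} (hΛ : 0 < Λ) {u : E3 → ℝ} (hn : IsNice Λ u)
    (hu : IsLongitudinal u) {q s : ℝ≥0∞} (hq : 1 ≤ q) (hs : 1 ≤ s) {X Y h : ℝ} (hX : 0 < X) (hY : 0 < Y)
    (hh : 0 < h) (huX : eLpNorm (pderiv 0 u) s (cellMeasure Λ) ≤ ENNReal.ofReal X)
    (huY : eLpNorm u q (cellMeasure Λ) ≤ ENNReal.ofReal Y) (x : E3) :
    |u x| ≤ (h * Λ ^ 2) ^ (-recip q) * Y + h * (h * Λ ^ 2) ^ (-recip s) * X := by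
  have h1 := enorm_le_lintegral_line hn.smooth 0 x hh
  have hc : Continuous fun s : ℝ => u (x + s • stdBasis3 0) := hn.smooth.continuous.comp (by fun_prop)
  have hbox : h * Λ * Λ = h * Λ ^ 2 := by ring
  have hB : 0 < h * Λ ^ 2 := by positivity
  rw [lintegral_add_left (hc.measurable.enorm.const_mul _), lintegral_const_mul' _ _ ENNReal.ofReal_ne_top,
    lintegral_line_of_isLongitudinal hΛ hu hn.stronglyMeasurable,
    lintegral_line_of_isLongitudinal hΛ (g := pderiv 0 u) (hu.pderivs [0]) (hn.pderivs [0]).stronglyMeasurable] at h1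
  have h2 := setLIntegral_coordBox_le hΛ hq hn.periodic hn.stronglyMeasurable hh.le hΛ.le le_rfl le_rfl x
  have h3 := setLIntegral_coordBox_le hΛ hs (hn.pderivs [0]).periodic (hn.pderivs [0]).stronglyMeasurable
    hh.le hΛ.le le_rfl le_rfl x
  rw [hbox] at h2 h3
  rw [Real.enorm_eq_ofReal_abs] at h1
  rw [← ENNReal.ofReal_le_ofReal_iff (by positivity)]
  refine h1.trans ?_
  calc _ ≤ ENNReal.ofReal h⁻¹ * (ENNReal.ofReal (Λ ^ 2)⁻¹ * (ENNReal.ofReal (h * Λ ^ 2) ^ (1 - recip q) *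
          ENNReal.ofReal Y)) + ENNReal.ofReal (Λ ^ 2)⁻¹ * (ENNReal.ofReal (h * Λ ^ 2) ^ (1 - recip s) *
          ENNReal.ofReal X) := by
        gcongr
        · exact h2.trans (by gcongr)
        · exact h3.trans (by gcongr; exact huX)
    _ = _ := by
        rw [ENNReal.ofReal_rpow_of_pos hB, ENNReal.ofReal_rpow_of_pos hB, ← ENNReal.ofReal_mul (by positivity),
          ← ENNReal.ofReal_mul (by positivity), ← ENNReal.ofReal_mul (by positivity),
          ← ENNReal.ofReal_mul (by positivity), ← ENNReal.ofReal_mul (by positivity),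
          ← ENNReal.ofReal_add (by positivity) (by positivity)]
        congr 1
        have e (c : ℝ) : (h * Λ ^ 2) ^ (1 - c) = (h * Λ ^ 2) * (h * Λ ^ 2) ^ (-c) := by
          rw [sub_eq_add_neg, Real.rpow_add hB, Real.rpow_one]
        rw [e, e]
        field_simp

/-- Writing positive reals as exponentials makes identities between products of powers linear in the
exponents. -/
theorem exists_exp_eq {x : ℝ} (hx : 0 < x) : ∃ l, Real.exp l = x := ⟨Real.log x, Real.exp_log hx⟩

/-- The bound of the supremum by derivatives of order `m` in dimension `1/κ`, for the class `𝒦` of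
functions. The exponent `θ` is the one with `0 = (1/r - mκ) θ + (1/q) (1 - θ)`. -/
def SupBound (𝒦 : ℝ → (E3 → ℝ) → Prop) (κ : ℝ) (m : ℕ) (q r : ℝ≥0∞) : Prop :=
  ∃ C : ℝ, 0 < C ∧ ∀ Λ : ℝ, 0 < Λ → ∀ u : E3 → ℝ, 𝒦 Λ u → ∀ X Y : ℝ, 0 < X → 0 < Y →
    (∀ l : List (Fin 3), l.length = m → eLpNorm (pderivs l u) r (cellMeasure Λ) ≤ ENNReal.ofReal X) →
    eLpNorm u q (cellMeasure Λ) ≤ ENNReal.ofReal Y → ∀ x,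
    |u x| ≤ C * Λ ^ (-(3 * κ - 1) * (m * (recip q / (m * κ - recip r + recip q)))) *
      X ^ (recip q / (m * κ - recip r + recip q)) * Y ^ (1 - recip q / (m * κ - recip r + recip q))

/-- The one-dimensional bound of the supremum by first derivatives. -/
theorem supBound_one_of_isLongitudinal {q s : ℝ≥0∞} (hq : 1 ≤ q) (hs : 1 ≤ s) (hqt : q ≠ ⊤) :
    SupBound (fun Λ u => IsNice Λ u ∧ IsLongitudinal u) 1 1 q s := by
  refine ⟨2, two_pos, fun Λ hΛ u ⟨hn, hu⟩ X Y hX hY huX huY x => ?_⟩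
  have hb := recip_pos hq hqt
  have hs1 := recip_le_one hs
  set b := recip q with hbdef
  set σ := recip s with hσ
  have huX' := huX [0] rfl
  have hD : 0 < 1 - σ + b := by linarith
  obtain ⟨l, rfl⟩ := exists_exp_eq hΛ
  obtain ⟨ξ, rfl⟩ := exists_exp_eq hX
  obtain ⟨η, rfl⟩ := exists_exp_eq hY
  -- the exponential is the scale `h` at which the two terms of the bound agree
  have h1 := abs_le_of_isLongitudinal hΛ hn hu hq hs hX hY
    (Real.exp_pos ((2 * (σ - b) * l + η - ξ) / (1 - σ + b))) huX' huY x
  rw [← hbdef, ← hσ] at h1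
  refine h1.trans (le_of_eq ?_)
  have hsq : Real.exp l ^ 2 = Real.exp (2 * l) := by rw [← Real.exp_nat_mul]; norm_num
  rw [hsq]
  simp only [← Real.exp_add, ← Real.exp_mul, Nat.cast_one, one_mul]
  have e : ∀ a c d : ℝ, 2 * Real.exp a * Real.exp c * Real.exp d =
      Real.exp (a + c + d) + Real.exp (a + c + d) := fun a c d => by
    rw [Real.exp_add, Real.exp_add]; ring
  rw [e]
  congr 2 <;> (field_simp; ring)

/-- Nirenberg's inequality with `q = ∞` bounds the first derivatives by the `m`-th ones and the
supremum itself, which can be absorbed. -/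
theorem SupBound.of_one {𝒦 : ℝ → (E3 → ℝ) → Prop} (h𝒦 : ∀ Λ u, 𝒦 Λ u → IsNice Λ u) {κ : ℝ} {m : ℕ}
    (hm : 1 ≤ m) {q r s : ℝ≥0∞} (hq : 1 ≤ q) (hqt : q ≠ ⊤) (hr : 1 ≤ r) (hs : 1 ≤ s) (hsr : recip s = recip r / m)
    (hκ : recip s ≤ κ) (h : SupBound 𝒦 κ 1 q s) : SupBound 𝒦 κ m q r := by
  rcases hm.eq_or_lt with rfl | hm1
  · obtain rfl : s = r := recip_injective hs hr (by simpa using hsr)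
    exact h
  obtain ⟨C, hC, hsup⟩ := h
  have hm0 : (0 : ℝ) < m := by positivity
  obtain ⟨C₁, hC₁, hN⟩ := exists_eLpNorm_pderivs_le (m := m) (j := 1) (by omega) (q := ⊤) (r := r) (p := s)
    le_top hr hs (by rw [hsr]; simp; ring)
  have hb := recip_pos hq hqt
  set b := recip q with hbdef
  set σ := recip s with hσ
  have hρ : recip r = m * σ := by rw [hsr]; field_simp
  have hD : 0 < κ - σ + b := by linarith
  have hD' : 0 < b + m * (κ - σ) := by
    have := mul_nonneg hm0.le (sub_nonneg.2 hκ); linarith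
  obtain ⟨c, rfl⟩ := exists_exp_eq hC
  obtain ⟨c₁, rfl⟩ := exists_exp_eq hC₁
  refine ⟨Real.exp ((c + b / (κ - σ + b) * c₁) * (m * (κ - σ + b) / (b + m * (κ - σ)))), Real.exp_pos _,
    fun Λ hΛ u hu X Y hX hY huX huY x => ?_⟩
  have hn := h𝒦 Λ u hu
  obtain ⟨M, hM⟩ := hn.bounded []
  -- Nirenberg's inequality is applied with `V` as the bound for `u`; the resulting inequality `h3` contains
  -- `V` on the right-hand side with an exponent less than one
  set V := ⨆ x, |u x| with hV
  have hbdd : BddAbove (Set.range fun x => |u x|) := ⟨M, by rintro _ ⟨y, rfl⟩; exact hM y⟩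
  have hxV : ∀ y, |u y| ≤ V := fun y => le_ciSup hbdd y
  refine (hxV x).trans ?_
  rcases ((abs_nonneg _).trans (hxV 0)).eq_or_lt with hV0 | hV0
  · rw [← hV0]; positivity
  have hVle : eLpNorm u ⊤ (cellMeasure Λ) ≤ ENNReal.ofReal V := by
    rw [eLpNorm_exponent_top]
    refine essSup_le_of_ae_le _ (Filter.Eventually.of_forall fun y => ?_)
    simp only [Real.enorm_eq_ofReal_abs]
    exact ENNReal.ofReal_le_ofReal (hxV y)
  have h1 := fun l hl => hN l hl Λ hΛ u hn X V hX hV0 huX hVle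
  have h2 := fun y => hsup Λ hΛ u hu _ Y (by positivity) hY h1 huY y
  have h3 : V ≤ _ := ciSup_le h2
  clear h2 hsup hN hxV hbdd
  clear_value V
  obtain ⟨l, rfl⟩ := exists_exp_eq hΛ
  obtain ⟨ξ, rfl⟩ := exists_exp_eq hX
  obtain ⟨η, rfl⟩ := exists_exp_eq hY
  obtain ⟨v, rfl⟩ := exists_exp_eq hV0
  simp only [← Real.exp_add, ← Real.exp_mul, Nat.cast_one, one_mul, Real.exp_le_exp] at h3 ⊢
  rw [hρ, ← hbdef]
  have hDm : (m : ℝ) * κ - m * σ + b = b + m * (κ - σ) := by ring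
  rw [hDm]
  have hm1' : (1 : ℝ) < m := by exact_mod_cast hm1
  have h4 := mul_le_mul_of_nonneg_left h3 (show 0 ≤ (κ - σ + b) * m by positivity)
  have h5 : v * (b + m * (κ - σ)) ≤ (c + b / (κ - σ + b) * c₁) * (m * (κ - σ + b)) +
      (l * (-(3 * κ - 1) * (m * b))) + ξ * b + η * (m * (κ - σ)) := by
    have e : (κ - σ + b) * m * (c + l * (-(3 * κ - 1) * (b / (κ - σ + b))) +
        (c₁ + (ξ * (1 / m) + v * (1 - 1 / m))) * (b / (κ - σ + b)) + η * (1 - b / (κ - σ + b))) =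
        (c + b / (κ - σ + b) * c₁) * (m * (κ - σ + b)) +
      (l * (-(3 * κ - 1) * (m * b))) + ξ * b + η * (m * (κ - σ)) + v * b * (m - 1) := by
      field_simp; ring
    rw [e] at h4
    linarith
  rw [← le_div_iff₀ hD'] at h5
  refine h5.trans (le_of_eq ?_)
  obtain ⟨E, hE⟩ : ∃ E, E = b + m * (κ - σ) := ⟨_, rfl⟩
  have e2 : m * (κ - σ) = E - b := by rw [hE]; ring
  rw [← hE] at hD' ⊢
  rw [e2]
  field_simp

/-! ### Supremum bounds: functions with vanishing transverse mean -/

theorem lintegral_coordBox_smul {f : E3 → ℝ≥0∞} (hf : Measurable f) {t h : ℝ} (ht : 0 < t) :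
    ∫⁻ y in coordBox h h h, f (t • y) =
      ENNReal.ofReal (t ^ 3)⁻¹ * ∫⁻ y in coordBox (t * h) (t * h) (t * h), f y := by
  have hmap := Measure.map_addHaar_smul (volume : Measure E3) ht.ne'
  have hpre : ∀ y : E3, t • y ∈ coordBox (t * h) (t * h) (t * h) ↔ y ∈ coordBox h h h := by
    intro y
    simp [coordBox, mul_nonneg_iff_of_pos_left ht, mul_le_mul_iff_of_pos_left ht]
  have hfi := hf.indicator (measurableSet_coordBox (t * h) (t * h) (t * h))
  calc ∫⁻ y in coordBox h h h, f (t • y)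
      = ∫⁻ y, (coordBox (t * h) (t * h) (t * h)).indicator f (t • y) := by
        rw [← lintegral_indicator (measurableSet_coordBox _ _ _)]
        refine lintegral_congr fun y => ?_
        by_cases hy : y ∈ coordBox h h h
        · rw [Set.indicator_of_mem hy, Set.indicator_of_mem ((hpre y).2 hy)]
        · rw [Set.indicator_of_notMem hy, Set.indicator_of_notMem fun h' => hy ((hpre y).1 h')]
    _ = ∫⁻ y, (coordBox (t * h) (t * h) (t * h)).indicator f y ∂(volume.map (t • ·)) := by
        rw [lintegral_map hfi (measurable_const_smul t)]
    _ = _ := by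
        rw [hmap, lintegral_smul_measure, lintegral_indicator (measurableSet_coordBox _ _ _)]
        have : Module.finrank ℝ E3 = 3 := by simp
        rw [this, abs_of_pos (by positivity), smul_eq_mul]

theorem lintegral_Icc_rpow_le {a : ℝ} (ha : a < 1) :
    ∫⁻ t in Set.Icc (0 : ℝ) 1, ENNReal.ofReal (t ^ (-a)) ≤ ENNReal.ofReal (1 / (1 - a)) := by
  have hint : IntervalIntegrable (fun t : ℝ => t ^ (-a)) volume 0 1 :=
    intervalIntegral.intervalIntegrable_rpow' (by linarith)
  have h1 : ∫ t in (0 : ℝ)..1, t ^ (-a) = 1 / (1 - a) := by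
    rw [integral_rpow (Or.inl (by linarith)), Real.one_rpow, Real.zero_rpow (by linarith), sub_zero,
      neg_add_eq_sub]
  rw [setLIntegral_congr Ioc_ae_eq_Icc.symm, ← h1, intervalIntegral.integral_of_le zero_le_one,
    ofReal_integral_eq_lintegral_ofReal
      ((intervalIntegrable_iff_integrableOn_Ioc_of_le zero_le_one).1 hint)]
  filter_upwards [ae_restrict_mem measurableSet_Ioc] with t ht using Real.rpow_nonneg ht.1.le _

/-- Morrey's estimate on a cube with corner `x`: the mean over `y` of `|u x| ≤ |u (x + y)| + |u (x + y) - u x|`,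
where the increment is the integral of the derivative along the segment from `x` to `x + y`. -/
theorem abs_le_of_recip_lt {Λ : ℝ} (hΛ : 0 < Λ) {u : E3 → ℝ} (hn : IsNice Λ u) {q s : ℝ≥0∞}
    (hq : 1 ≤ q) (hs : 1 ≤ s) (hs3 : 3 * recip s < 1) {X Y h : ℝ} (hX : 0 < X) (hY : 0 < Y)
    (hh : 0 < h) (hhΛ : h ≤ Λ)
    (huX : ∀ i, eLpNorm (pderiv i u) s (cellMeasure Λ) ≤ ENNReal.ofReal X)
    (huY : eLpNorm u q (cellMeasure Λ) ≤ ENNReal.ofReal Y) (x : E3) :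
    |u x| ≤ (h ^ 3) ^ (-recip q) * Y + 3 / (1 - 3 * recip s) * (h * (h ^ 3) ^ (-recip s) * X) := by
  set b := recip q with hb
  set σ := recip s with hσ
  have hD : 0 < 1 - 3 * σ := by linarith
  have hB : 0 < h ^ 3 := by positivity
  have hbox (c : ℝ) : c * c * c = c ^ 3 := by ring
  have hc (i : Fin 3) : Continuous (pderiv i u) := (contDiff_pderiv hn.smooth i).continuous
  -- the contribution of one partial derivative
  have hone : ∀ i : Fin 3, ∫⁻ y in coordBox h h h, ∫⁻ t in Set.Icc (0 : ℝ) 1, ‖pderiv i u (x + t • y)‖ₑ ≤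
      ENNReal.ofReal (1 / (1 - 3 * σ) * ((h ^ 3) ^ (1 - σ) * X)) := by
    intro i
    rw [lintegral_lintegral_swap (by
      have : Continuous fun z : E3 × ℝ => pderiv i u (x + z.2 • z.1) := (hc i).comp (by fun_prop)
      exact this.measurable.enorm.aemeasurable)]
    have h1 : ∀ t ∈ Set.Ioc (0 : ℝ) 1, ∫⁻ y in coordBox h h h, ‖pderiv i u (x + t • y)‖ₑ ≤
        ENNReal.ofReal (t ^ (-(3 * σ))) * ENNReal.ofReal ((h ^ 3) ^ (1 - σ) * X) := by
      intro t ht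
      have hth : t * h ≤ Λ := (mul_le_of_le_one_left hh.le ht.2).trans hhΛ
      rw [lintegral_coordBox_smul (f := fun z => ‖pderiv i u (x + z)‖ₑ)
        ((hc i).measurable.enorm.comp (measurable_const_add x)) ht.1]
      have h2 := setLIntegral_coordBox_le hΛ hs (hn.pderivs [i]).periodic (hn.pderivs [i]).stronglyMeasurable
        (mul_nonneg ht.1.le hh.le) (mul_nonneg ht.1.le hh.le) hth hth x
      have hpos : 0 < (t * h) ^ 3 := pow_pos (mul_pos ht.1 hh) 3
      rw [hbox, ← hσ, ENNReal.ofReal_rpow_of_pos hpos] at h2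
      calc _ ≤ ENNReal.ofReal (t ^ 3)⁻¹ * (ENNReal.ofReal (((t * h) ^ 3) ^ (1 - σ)) * ENNReal.ofReal X) := by
            gcongr
            exact h2.trans (by gcongr; exact huX i)
        _ = _ := by
            have ht3 := pow_pos ht.1 3
            rw [← ENNReal.ofReal_mul (by positivity), ← ENNReal.ofReal_mul (inv_pos.2 ht3).le,
              ← ENNReal.ofReal_mul (Real.rpow_nonneg ht.1.le _)]
            congr 1
            rw [mul_pow, Real.mul_rpow ht3.le hB.le, sub_eq_add_neg, Real.rpow_add ht3, Real.rpow_one,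
              show -(3 * σ) = ((3 : ℕ) : ℝ) * -σ by push_cast; ring, Real.rpow_mul ht.1.le, Real.rpow_natCast]
            have := ht.1
            field_simp
    rw [setLIntegral_congr Ioc_ae_eq_Icc.symm]
    calc _ ≤ ∫⁻ t in Set.Ioc (0 : ℝ) 1,
          ENNReal.ofReal (t ^ (-(3 * σ))) * ENNReal.ofReal ((h ^ 3) ^ (1 - σ) * X) :=
          setLIntegral_mono' measurableSet_Ioc h1
      _ ≤ _ := by
          rw [lintegral_mul_const' _ _ ENNReal.ofReal_ne_top, setLIntegral_congr Ioc_ae_eq_Icc,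
            ENNReal.ofReal_mul (one_div_nonneg.2 hD.le)]
          exact mul_le_mul_left (lintegral_Icc_rpow_le (by linarith)) _
  have hpt : ∀ y ∈ coordBox h h h, ‖u x‖ₑ ≤ ‖u (x + y)‖ₑ +
      ∑ i : Fin 3, ENNReal.ofReal h * ∫⁻ t in Set.Icc (0 : ℝ) 1, ‖pderiv i u (x + t • y)‖ₑ := by
    intro y hy
    have habs : ∀ i : Fin 3, |y i| ≤ h := by
      obtain ⟨h0, h1, h2⟩ := hy
      intro i; fin_cases i
      · exact abs_le.2 ⟨(neg_nonpos.2 hh.le).trans h0.1, h0.2⟩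
      · exact abs_le.2 ⟨(neg_nonpos.2 hh.le).trans h1.1, h1.2⟩
      · exact abs_le.2 ⟨(neg_nonpos.2 hh.le).trans h2.1, h2.2⟩
    have h1 : ‖u x‖ₑ ≤ ‖u (x + y)‖ₑ + ‖u (x + y) - u x‖ₑ := by
      calc ‖u x‖ₑ = ‖u (x + y) - (u (x + y) - u x)‖ₑ := by rw [sub_sub_cancel]
        _ ≤ _ := enorm_sub_le
    refine h1.trans (add_le_add_right ((enorm_sub_le_lintegral hn.smooth x y).trans ?_) _)
    have hm (i : Fin 3) : Measurable fun t : ℝ => ‖pderiv i u (x + t • y)‖ₑ :=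
      ((hc i).comp (by fun_prop : Continuous fun t : ℝ => x + t • y)).measurable.enorm
    simp_rw [← lintegral_const_mul' _ _ (ENNReal.ofReal_ne_top (r := h))]
    rw [← lintegral_finsetSum _ fun i _ => (hm i).const_mul _]
    refine lintegral_mono fun t => ?_
    have hi (i : Fin 3) : ‖y i * pderiv i u (x + t • y)‖ₑ ≤ ENNReal.ofReal h * ‖pderiv i u (x + t • y)‖ₑ := by
      rw [enorm_mul, Real.enorm_eq_ofReal_abs (y i)]
      gcongr; exact habs i
    rw [fderiv_apply_eq, Fin.sum_univ_three]
    exact (enorm_add_le _ _).trans (add_le_add ((enorm_add_le _ _).trans (add_le_add (hi 0) (hi 1))) (hi 2))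
  have hmeas (i : Fin 3) : Measurable fun y : E3 => ENNReal.ofReal h *
      ∫⁻ t in Set.Icc (0 : ℝ) 1, ‖pderiv i u (x + t • y)‖ₑ := by
    have : Continuous fun z : E3 × ℝ => pderiv i u (x + z.2 • z.1) := (hc i).comp (by fun_prop)
    exact (Measurable.lintegral_prod_right' this.measurable.enorm).const_mul _
  have hsum : ‖u x‖ₑ * ENNReal.ofReal (h ^ 3) ≤ ENNReal.ofReal ((h ^ 3) ^ (1 - b) * Y) +
      3 * ENNReal.ofReal (h * (1 / (1 - 3 * σ) * ((h ^ 3) ^ (1 - σ) * X))) := by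
    calc ‖u x‖ₑ * ENNReal.ofReal (h ^ 3) = ∫⁻ _ in coordBox h h h, ‖u x‖ₑ := by
          rw [setLIntegral_const, volume_coordBox hh.le hh.le, hbox]
      _ ≤ ∫⁻ y in coordBox h h h, (‖u (x + y)‖ₑ +
          ∑ i : Fin 3, ENNReal.ofReal h * ∫⁻ t in Set.Icc (0 : ℝ) 1, ‖pderiv i u (x + t • y)‖ₑ) :=
          setLIntegral_mono' (measurableSet_coordBox _ _ _) hpt
      _ = (∫⁻ y in coordBox h h h, ‖u (x + y)‖ₑ) + ∑ i : Fin 3, ENNReal.ofReal h *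
          ∫⁻ y in coordBox h h h, ∫⁻ t in Set.Icc (0 : ℝ) 1, ‖pderiv i u (x + t • y)‖ₑ := by
          rw [lintegral_add_right _ (Finset.measurable_sum _ fun i _ => hmeas i),
            lintegral_finsetSum _ fun i _ => hmeas i]
          simp_rw [lintegral_const_mul' _ _ (ENNReal.ofReal_ne_top (r := h))]
      _ ≤ _ := by
          refine add_le_add ?_ ?_
          · have h2 := setLIntegral_coordBox_le hΛ hq hn.periodic hn.stronglyMeasurable hh.le hh.le hhΛ hhΛ x
            rw [hbox, ← hb, ENNReal.ofReal_rpow_of_pos hB] at h2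
            rw [ENNReal.ofReal_mul (by positivity)]
            exact h2.trans (by gcongr)
          · calc _ ≤ ∑ _i : Fin 3, ENNReal.ofReal h *
                  ENNReal.ofReal (1 / (1 - 3 * σ) * ((h ^ 3) ^ (1 - σ) * X)) :=
                  Finset.sum_le_sum fun i _ => mul_le_mul_right (hone i) _
              _ = _ := by
                  rw [← ENNReal.ofReal_mul hh.le]; simp
  rw [Real.enorm_eq_ofReal_abs, ← ENNReal.ofReal_mul (abs_nonneg _),
    show (3 : ℝ≥0∞) = ENNReal.ofReal 3 by simp, ← ENNReal.ofReal_mul (by norm_num),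
    ← ENNReal.ofReal_add (by positivity) (by positivity), ENNReal.ofReal_le_ofReal_iff (by positivity),
    ← le_div_iff₀ hB] at hsum
  refine hsum.trans (le_of_eq ?_)
  have e (c : ℝ) : (h ^ 3) ^ (1 - c) = (h ^ 3) * (h ^ 3) ^ (-c) := by
    rw [sub_eq_add_neg, Real.rpow_add hB, Real.rpow_one]
  rw [e, e]
  field_simp

/-- Morrey's estimate at the scale that balances its two terms or, if that scale exceeds `Λ`, at the scale
`Λ`, where Poincaré's inequality controls the first term by the second. -/
theorem supBound_one_of_isMeanZero {q s : ℝ≥0∞} (hq : 1 ≤ q) (hs : 1 ≤ s) (hqt : q ≠ ⊤)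
    (hs3 : 3 * recip s < 1) :
    SupBound (fun Λ u => IsNice Λ u ∧ IsMeanZero Λ u) (1 / 3) 1 q s := by
  have hb := recip_pos hq hqt
  have hD1 : 0 < 1 - 3 * recip s := by linarith
  refine ⟨2 + 3 / (1 - 3 * recip s), by positivity, fun Λ hΛ u ⟨hn, hu⟩ X Y hX hY huX huY x => ?_⟩
  have huX' : ∀ i, eLpNorm (pderiv i u) s (cellMeasure Λ) ≤ ENNReal.ofReal X := fun i => huX [i] rfl
  set b := recip q with hbdef
  set σ := recip s with hσ
  have hD : 0 < 1 - 3 * σ + 3 * b := by linarith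
  have hθ : b / (((1 : ℕ) : ℝ) * (1 / 3) - σ + b) = 3 * b / (1 - 3 * σ + 3 * b) := by
    rw [div_eq_div_iff (by push_cast; linarith) hD.ne']; push_cast; ring
  have hΛ0 : Λ ^ (-(3 * (1 / 3 : ℝ) - 1) * (((1 : ℕ) : ℝ) * (3 * b / (1 - 3 * σ + 3 * b)))) = 1 := by
    norm_num
  rw [hθ, hΛ0, mul_one]
  set K := 3 / (1 - 3 * σ) with hK
  have hK0 : 0 < K := by positivity
  clear_value K
  obtain ⟨ξ, rfl⟩ := exists_exp_eq hX
  obtain ⟨η, rfl⟩ := exists_exp_eq hY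
  obtain ⟨l, rfl⟩ := exists_exp_eq hΛ
  have hcube (a : ℝ) : Real.exp a ^ 3 = Real.exp (3 * a) := by rw [← Real.exp_nat_mul]; norm_num
  have hD' := hD.ne'
  -- `exp ((η - ξ) / (1 - 3σ + 3b))` is the scale at which the two terms of Morrey's estimate agree
  rcases le_total ((η - ξ) / (1 - 3 * σ + 3 * b)) l with hl | hl
  · have h1 := abs_le_of_recip_lt hΛ hn hq hs hs3 hX hY
      (Real.exp_pos ((η - ξ) / (1 - 3 * σ + 3 * b))) (Real.exp_le_exp.2 hl) huX' huY x
    rw [← hbdef, ← hσ, ← hK, hcube] at h1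
    refine h1.trans ?_
    simp only [← Real.exp_add, ← Real.exp_mul]
    rw [mul_assoc (2 + K), ← Real.exp_add]
    have e1 : 3 * ((η - ξ) / (1 - 3 * σ + 3 * b)) * -b + η =
        ξ * (3 * b / (1 - 3 * σ + 3 * b)) + η * (1 - 3 * b / (1 - 3 * σ + 3 * b)) := by
      field_simp; ring
    have e2 : (η - ξ) / (1 - 3 * σ + 3 * b) + 3 * ((η - ξ) / (1 - 3 * σ + 3 * b)) * -σ + ξ =
        ξ * (3 * b / (1 - 3 * σ + 3 * b)) + η * (1 - 3 * b / (1 - 3 * σ + 3 * b)) := by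
      field_simp; ring
    rw [e1, e2]
    nlinarith [Real.exp_pos (ξ * (3 * b / (1 - 3 * σ + 3 * b)) + η * (1 - 3 * b / (1 - 3 * σ + 3 * b)))]
  · have hP := eLpNorm_le_of_isMeanZero hΛ hn hu hs hX.le huX'
    have h1 := abs_le_of_recip_lt hΛ hn hs hs hs3 hX (by positivity) hΛ le_rfl huX' hP x
    rw [← hσ, ← hK, hcube] at h1
    refine h1.trans ?_
    rw [show ∀ a c : ℝ, a * (2 * Real.exp l * c) = 2 * (a * Real.exp l * c) by intros; ring]
    simp only [← Real.exp_add, ← Real.exp_mul]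
    rw [mul_assoc (2 + K), ← Real.exp_add]
    have e1 : 3 * l * -σ + l + ξ = (1 - 3 * σ) * l + ξ := by ring
    have e2 : l + 3 * l * -σ + ξ = (1 - 3 * σ) * l + ξ := by ring
    rw [e1, e2, ← add_mul]
    refine mul_le_mul_of_nonneg_left (Real.exp_le_exp.2 ?_) (by positivity)
    have h2 := mul_le_mul_of_nonneg_left hl hD1.le
    refine (add_le_add_left h2 ξ).trans (le_of_eq ?_)
    field_simp; ring

/-! ### The Sobolev inequality on the cylinder -/

theorem norm_le_sum_abs (y : E3) : ‖y‖ ≤ |y 0| + |y 1| + |y 2| := by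
  conv_lhs => rw [E3_eq_sum y]
  have h (i : Fin 3) : ‖y i • stdBasis3 i‖ = |y i| := by
    rw [norm_smul, Real.norm_eq_abs]; simp [stdBasis3]
  calc _ ≤ ‖y 0 • stdBasis3 0‖ + ‖y 1 • stdBasis3 1‖ + ‖y 2 • stdBasis3 2‖ :=
        (norm_add_le _ _).trans (by gcongr; exact norm_add_le _ _)
    _ = _ := by rw [h, h, h]

/-- Three by three copies of the cell around the cell. -/
def fatCell (Λ : ℝ) : Set E3 := {x | x 1 ∈ Set.Icc (-Λ) (2 * Λ) ∧ x 2 ∈ Set.Icc (-Λ) (2 * Λ)}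

theorem isClosed_fatCell (Λ : ℝ) : IsClosed (fatCell Λ) := by
  have h (i : Fin 3) : Continuous fun x : E3 => x i := by fun_prop
  exact (isClosed_Icc.preimage (h 1)).inter (isClosed_Icc.preimage (h 2))

theorem setLIntegral_fatCell_le {Λ : ℝ} {F : E3 → ℝ≥0∞} (hF : IsTransPeriodic Λ F) :
    ∫⁻ x in fatCell Λ, F x ≤ 9 * ∫⁻ x, F x ∂(cellMeasure Λ) := by
  set v : Fin 3 × Fin 3 → E3 := fun n => periodHom Λ ((n.1 : ℤ) - 1, (n.2 : ℤ) - 1) with hv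
  have hcov : fatCell Λ ⊆ ⋃ n : Fin 3 × Fin 3, {x | x - v n ∈ cell Λ} := by
    intro x ⟨⟨h1, h2⟩, h3, h4⟩
    have key : ∀ t : ℝ, -Λ ≤ t → t ≤ 2 * Λ → ∃ n : Fin 3, t - (((n : ℤ) - 1 : ℤ) : ℝ) * Λ ∈ Set.Icc 0 Λ := by
      intro t ht1 ht2
      rcases le_total t 0 with h0 | h0
      · refine ⟨0, ?_, ?_⟩ <;> simp <;> linarith
      rcases le_total t Λ with h | h
      · refine ⟨1, ?_, ?_⟩ <;> simp <;> linarith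
      · refine ⟨2, ?_, ?_⟩ <;> norm_num <;> linarith
    obtain ⟨a, ha⟩ := key _ h1 h2
    obtain ⟨b, hb⟩ := key _ h3 h4
    refine Set.mem_iUnion.2 ⟨(a, b), ?_, ?_⟩
    · simpa [hv, periodHom_apply_one] using ha
    · simpa [hv, periodHom_apply_two] using hb
  have hone : ∀ n, ∫⁻ x in {x | x - v n ∈ cell Λ}, F x = ∫⁻ x, F x ∂(cellMeasure Λ) := by
    intro n
    have hm : MeasurableSet {x : E3 | x - v n ∈ cell Λ} := measurable_sub_const (v n) (measurableSet_cell Λ)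
    rw [cellMeasure, ← lintegral_indicator hm, ← lintegral_indicator (measurableSet_cell Λ),
      ← lintegral_add_right_eq_self _ (v n)]
    refine lintegral_congr fun x => ?_
    by_cases hx : x ∈ cell Λ
    · rw [Set.indicator_of_mem hx, Set.indicator_of_mem (by simpa using hx), hF.add_periodHom]
    · rw [Set.indicator_of_notMem hx, Set.indicator_of_notMem (by simpa using hx)]
  calc _ ≤ ∫⁻ x in ⋃ n : Fin 3 × Fin 3, {x | x - v n ∈ cell Λ}, F x := lintegral_mono_set hcov
    _ ≤ ∑' n : Fin 3 × Fin 3, ∫⁻ x in {x | x - v n ∈ cell Λ}, F x := lintegral_iUnion_le _ _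
    _ = _ := by
      rw [tsum_fintype]; simp only [hone, Finset.sum_const, nsmul_eq_mul]
      simp

theorem eLpNorm_fatCell_le {Λ : ℝ} {F : Type*} [NormedAddCommGroup F] {h : E3 → F}
    (hh : IsTransPeriodic Λ h) {p : ℝ≥0∞} (hp : 1 ≤ p) (hpt : p ≠ ⊤) :
    eLpNorm h p (volume.restrict (fatCell Λ)) ≤ 9 * eLpNorm h p (cellMeasure Λ) := by
  have hp0 : p ≠ 0 := (zero_lt_one.trans_le hp).ne'
  have hP : 1 ≤ p.toReal := by simpa using ENNReal.toReal_mono hpt hp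
  rw [eLpNorm_eq_lintegral_rpow_enorm_toReal hp0 hpt, eLpNorm_eq_lintegral_rpow_enorm_toReal hp0 hpt]
  have h1 := setLIntegral_fatCell_le (Λ := Λ) (F := fun x => ‖h x‖ₑ ^ p.toReal)
    (fun x => ⟨by simp only [(hh x).1], by simp only [(hh x).2]⟩)
  have hinv : 1 / p.toReal ≤ 1 := by rw [div_le_one (by linarith)]; exact hP
  calc _ ≤ (9 * ∫⁻ x, ‖h x‖ₑ ^ p.toReal ∂(cellMeasure Λ)) ^ (1 / p.toReal) :=
        ENNReal.rpow_le_rpow h1 (by positivity)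
    _ = (9 : ℝ≥0∞) ^ (1 / p.toReal) * (∫⁻ x, ‖h x‖ₑ ^ p.toReal ∂(cellMeasure Λ)) ^ (1 / p.toReal) :=
        ENNReal.mul_rpow_of_nonneg _ _ (by positivity)
    _ ≤ _ := by
        gcongr
        calc (9 : ℝ≥0∞) ^ (1 / p.toReal) ≤ 9 ^ (1 : ℝ) := ENNReal.rpow_le_rpow_of_exponent_le (by norm_num) hinv
          _ = 9 := ENNReal.rpow_one _

/-- Cutoff functions equal to one on `[-R, R] × [0, Λ]²`, supported over `[-Λ, 2Λ]²`, with slope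
of order `1/Λ`. -/
theorem exists_cutoff : ∃ K : ℝ, 0 < K ∧ ∀ Λ : ℝ, 0 < Λ → ∀ R : ℝ, Λ ≤ R → ∃ χ : E3 → ℝ,
    ContDiff ℝ 1 χ ∧ HasCompactSupport χ ∧ (∀ x, |χ x| ≤ 1) ∧ (∀ x ∈ cell Λ, |x 0| ≤ R → χ x = 1) ∧
    (∀ x, x ∉ fatCell Λ → χ x = 0) ∧ ∀ x, ‖fderiv ℝ χ x‖ ≤ K / Λ := by
  -- `ρ` equals one on `[0, 1]` and vanishes off `(-1, 2)`; the cutoff is a product of rescaled copies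
  let ρ : ContDiffBump (1 / 2 : ℝ) := ⟨1 / 2, 3 / 2, by norm_num, by norm_num⟩
  have hρ1 : ∀ t ∈ Set.Icc (0 : ℝ) 1, ρ t = 1 := fun t ht => by
    refine ρ.one_of_mem_closedBall ?_
    rw [Metric.mem_closedBall, Real.dist_eq, abs_le]
    constructor <;> (simp only [ρ]; linarith [ht.1, ht.2])
  have hρ0 : ∀ t, t ∉ Set.Ioo (-1 : ℝ) 2 → ρ t = 0 := fun t ht => by
    refine ρ.zero_of_le_dist ?_
    by_contra! hlt
    rw [Real.dist_eq, abs_lt] at hlt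
    simp only [ρ] at hlt
    exact ht ⟨by linarith [hlt.1], by linarith [hlt.2]⟩
  have hρb : ∀ t, |ρ t| ≤ 1 := fun t => by rw [abs_of_nonneg ρ.nonneg]; exact ρ.le_one
  have hρc : ContDiff ℝ 1 ρ := ρ.contDiff
  obtain ⟨K, hK⟩ := (ρ.hasCompactSupport.deriv).exists_bound_of_continuous (hρc.continuous_deriv le_rfl)
  have hK0 : 0 ≤ K := (norm_nonneg _).trans (hK 0)
  refine ⟨3 * (K + 1), by positivity, fun Λ hΛ R hR => ?_⟩
  have hR0 : 0 < R := hΛ.trans_le hR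
  let f : Fin 3 → ℝ → ℝ → E3 → ℝ := fun i c d x => ρ (c * x i + d)
  have hf : ∀ i c d, ContDiff ℝ 1 (f i c d) := fun i c d => hρc.comp (by fun_prop)
  have hfd : ∀ i c d x, |c| ≤ 1 / Λ → ‖fderiv ℝ (f i c d) x‖ ≤ (K + 1) / Λ := by
    intro i c d x hc
    have h1 : HasFDerivAt (fun x : E3 => c * x i + d) (c • (EuclideanSpace.proj i : E3 →L[ℝ] ℝ)) x := by
      have := (EuclideanSpace.proj i : E3 →L[ℝ] ℝ).hasFDerivAt (x := x)
      exact (this.const_mul c).add_const d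
    have h2 := ((hρc.differentiable (by simp) (c * x i + d)).hasDerivAt.comp_hasFDerivAt x h1)
    have h3 : fderiv ℝ (f i c d) x = _ := h2.fderiv
    rw [h3]
    refine ContinuousLinearMap.opNorm_le_bound _ (by positivity) fun y => ?_
    have h4 : |y i| ≤ ‖y‖ := PiLp.norm_apply_le y i
    have h5 := hK (c * x i + d)
    simp only [smul_apply, smul_eq_mul, norm_mul, Real.norm_eq_abs] at h5 ⊢
    calc |deriv ρ (c * x i + d)| * (|c| * |(EuclideanSpace.proj i : E3 →L[ℝ] ℝ) y|)
        ≤ K * (1 / Λ * ‖y‖) := by gcongr; exact h4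
      _ ≤ (K + 1) / Λ * ‖y‖ := by
          rw [← mul_assoc, mul_one_div]; gcongr; linarith
  -- the first coordinate is mapped so that `[-R, R]` becomes `[0, 1]`
  set a := f 0 (1 / (2 * R)) (1 / 2) with ha
  set b := f 1 (1 / Λ) 0 with hb
  set c := f 2 (1 / Λ) 0 with hc
  have hca : ContDiff ℝ 1 a := hf _ _ _
  have hcb : ContDiff ℝ 1 b := hf _ _ _
  have hcc : ContDiff ℝ 1 c := hf _ _ _
  have hab : ∀ x, |a x| ≤ 1 := fun x => hρb _
  have hbb : ∀ x, |b x| ≤ 1 := fun x => hρb _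
  have hcb' : ∀ x, |c x| ≤ 1 := fun x => hρb _
  have hda : ∀ x, ‖fderiv ℝ a x‖ ≤ (K + 1) / Λ := fun x => hfd _ _ _ _ (by
    rw [abs_of_pos (by positivity)]; gcongr; linarith)
  have hdb : ∀ x, ‖fderiv ℝ b x‖ ≤ (K + 1) / Λ := fun x => hfd _ _ _ _ (abs_of_pos (by positivity)).le
  have hdc : ∀ x, ‖fderiv ℝ c x‖ ≤ (K + 1) / Λ := fun x => hfd _ _ _ _ (abs_of_pos (by positivity)).le
  have hsuppa : ∀ x, a x ≠ 0 → |x 0| ≤ 3 * R := by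
    intro x hx
    by_contra! hlt
    refine hx (hρ0 _ fun ⟨h1, h2⟩ => ?_)
    rw [one_div_mul_eq_div, ← sub_lt_iff_lt_add, lt_div_iff₀ (by positivity)] at h1
    rw [one_div_mul_eq_div, ← lt_sub_iff_add_lt, div_lt_iff₀ (by positivity)] at h2
    rcases lt_abs.1 hlt with h | h <;> linarith
  have hsuppb : ∀ i x, f i (1 / Λ) 0 x ≠ 0 → x i ∈ Set.Icc (-Λ) (2 * Λ) := by
    intro i x hx
    by_contra hlt
    refine hx (hρ0 _ fun ⟨h1, h2⟩ => hlt ?_)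
    rw [one_div_mul_eq_div, add_zero, lt_div_iff₀ (by positivity)] at h1
    rw [one_div_mul_eq_div, add_zero, div_lt_iff₀ (by positivity)] at h2
    exact ⟨by linarith, h2.le⟩
  refine ⟨fun x => a x * (b x * c x), hca.mul (hcb.mul hcc), ?_, fun x => ?_, fun x hx hxR => ?_,
    fun x hx => ?_, fun x => ?_⟩
  · refine HasCompactSupport.intro (isCompact_closedBall 0 (3 * R + 2 * Λ + 2 * Λ)) fun x hx => ?_
    by_contra hne
    have hne := mul_ne_zero_iff.1 hne
    rw [mul_ne_zero_iff] at hne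
    have h0 := hsuppa x hne.1
    have h1 := hsuppb 1 x hne.2.1
    have h2 := hsuppb 2 x hne.2.2
    have h1' : |x 1| ≤ 2 * Λ := abs_le.2 ⟨by linarith [h1.1], h1.2⟩
    have h2' : |x 2| ≤ 2 * Λ := abs_le.2 ⟨by linarith [h2.1], h2.2⟩
    exact hx (mem_closedBall_zero_iff.2 ((norm_le_sum_abs x).trans (by linarith)))
  · rw [abs_mul, abs_mul]
    exact mul_le_one₀ (hab x) (by positivity) (mul_le_one₀ (hbb x) (by positivity) (hcb' x))
  · have h0 := abs_le.1 hxR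
    have e0 : a x = 1 := hρ1 _ ⟨by
      rw [one_div_mul_eq_div, ← sub_le_iff_le_add, le_div_iff₀ (by positivity)]; linarith, by
      rw [one_div_mul_eq_div, ← le_sub_iff_add_le, div_le_iff₀ (by positivity)]; linarith⟩
    have e1 : ∀ i : Fin 3, x i ∈ Set.Icc 0 Λ → f i (1 / Λ) 0 x = 1 := fun i hi => hρ1 _ ⟨by
      have := hi.1; positivity, by
      rw [one_div_mul_eq_div, add_zero, div_le_iff₀ (by positivity)]; linarith [hi.2]⟩
    simp only [e0, hb, hc, e1 1 hx.1, e1 2 hx.2, mul_one]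
  · by_contra hne
    have hne := mul_ne_zero_iff.1 hne
    rw [mul_ne_zero_iff] at hne
    exact hx ⟨hsuppb 1 x hne.2.1, hsuppb 2 x hne.2.2⟩
  · have d {g : E3 → ℝ} (hg : ContDiff ℝ 1 g) : DifferentiableAt ℝ g x := hg.differentiable (by simp) x
    have e1 : fderiv ℝ (fun x => b x * c x) x = b x • fderiv ℝ c x + c x • fderiv ℝ b x :=
      fderiv_fun_mul (d hcb) (d hcc)
    have e2 : fderiv ℝ (fun x => a x * (b x * c x)) x =
        a x • fderiv ℝ (fun x => b x * c x) x + (b x * c x) • fderiv ℝ a x :=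
      fderiv_fun_mul (d hca) (d (hcb.mul hcc))
    have n (s : ℝ) (hs : |s| ≤ 1) (L : E3 →L[ℝ] ℝ) : ‖s • L‖ ≤ ‖L‖ := by
      rw [norm_smul, Real.norm_eq_abs]; exact mul_le_of_le_one_left (norm_nonneg _) hs
    rw [e2, e1]
    have hbc : |b x * c x| ≤ 1 := by rw [abs_mul]; exact mul_le_one₀ (hbb x) (by positivity) (hcb' x)
    calc _ ≤ ‖b x • fderiv ℝ c x + c x • fderiv ℝ b x‖ + ‖fderiv ℝ a x‖ :=
          (norm_add_le _ _).trans (add_le_add (n _ (hab x) _) (n _ hbc _))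
      _ ≤ (K + 1) / Λ + (K + 1) / Λ + (K + 1) / Λ := by
          gcongr
          · exact (norm_add_le _ _).trans
              (add_le_add ((n _ (hbb x) _).trans (hdc x)) ((n _ (hcb' x) _).trans (hdb x)))
          · exact hda x
      _ = _ := by ring

theorem isTransPeriodic_fderiv {Λ : ℝ} {g : E3 → ℝ} (hg : IsTransPeriodic Λ g) :
    IsTransPeriodic Λ (fderiv ℝ g) := by
  have h1 : (fun x => g (x + Λ • stdBasis3 1)) = g := funext fun x => (hg x).1
  have h2 : (fun x => g (x + Λ • stdBasis3 2)) = g := funext fun x => (hg x).2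
  intro x
  constructor
  · conv_rhs => rw [← h1]
    rw [fderiv_comp_add_right]
  · conv_rhs => rw [← h2]
    rw [fderiv_comp_add_right]

/-- The Sobolev inequality for periodic functions; the second term cannot be omitted without
a condition on the transverse mean. -/
theorem exists_eLpNorm_le_fderiv_add {p p' : ℝ≥0} (hp : 1 ≤ p) (hpp' : (p' : ℝ)⁻¹ = (p : ℝ)⁻¹ - 3⁻¹) :
    ∃ C : ℝ, 0 < C ∧ ∀ Λ : ℝ, 0 < Λ → ∀ g : E3 → ℝ, ContDiff ℝ 1 g → IsTransPeriodic Λ g →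
      eLpNorm g p' (cellMeasure Λ) ≤ ENNReal.ofReal C * (eLpNorm (fderiv ℝ g) p (cellMeasure Λ) +
        ENNReal.ofReal Λ⁻¹ * eLpNorm g p (cellMeasure Λ)) := by
  obtain ⟨K, hK0, hK⟩ := exists_cutoff
  set S := SNormLESNormFDerivOfEqConst ℝ (volume : Measure E3) p with hS
  refine ⟨((S : ℝ) + 1) * (9 * (1 + K)), by positivity, fun Λ hΛ g hg hgp => ?_⟩
  set Z : ℝ≥0∞ := ENNReal.ofReal (((S : ℝ) + 1) * (9 * (1 + K))) * (eLpNorm (fderiv ℝ g) p (cellMeasure Λ) +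
        ENNReal.ofReal Λ⁻¹ * eLpNorm g p (cellMeasure Λ)) with hZ
  have hp1 : (1 : ℝ≥0∞) ≤ p := by exact_mod_cast hp
  have hgc := hg.continuous
  have hdc : Continuous (fderiv ℝ g) := hg.continuous_fderiv (by simp)
  -- Sobolev's inequality for the compactly supported function `g χ`
  have hR : ∀ R : ℝ, Λ ≤ R → eLpNorm ({x : E3 | |x 0| ≤ R}.indicator g) p' (cellMeasure Λ) ≤ Z := by
    intro R hR
    obtain ⟨χ, hχ, hχc, hχ1, hχe, hχ0, hχd⟩ := hK Λ hΛ R hR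
    have hsob := eLpNorm_le_eLpNorm_fderiv_of_eq (F := ℝ) (volume : Measure E3) (u := fun x => g x * χ x)
      (hg.mul hχ) hχc.mul_left hp (by simp) (p' := p') (by rw [hpp', finrank_euclideanSpace_fin]; norm_num)
    have hd0 : ∀ x, x ∉ fatCell Λ → fderiv ℝ χ x = 0 := by
      intro x hx
      have : χ =ᶠ[nhds x] fun _ => 0 := by
        filter_upwards [(isClosed_fatCell Λ).isOpen_compl.mem_nhds hx] with y hy using hχ0 y hy
      rw [this.fderiv_eq]; simp
    set h : E3 → ℝ := fun x => ‖fderiv ℝ g x‖ + K / Λ * ‖g x‖ with hh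
    have hpt : ∀ x, ‖fderiv ℝ (fun x => g x * χ x) x‖ ≤ ‖(fatCell Λ).indicator h x‖ := by
      intro x
      have e : fderiv ℝ (fun x => g x * χ x) x = g x • fderiv ℝ χ x + χ x • fderiv ℝ g x :=
        fderiv_fun_mul (hg.differentiable (by simp) x) (hχ.differentiable (by simp) x)
      rw [e]
      by_cases hx : x ∈ fatCell Λ
      · rw [Set.indicator_of_mem hx, hh, Real.norm_eq_abs (_ + _), abs_of_nonneg (by positivity)]
        calc _ ≤ ‖g x‖ * ‖fderiv ℝ χ x‖ + |χ x| * ‖fderiv ℝ g x‖ := by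
              refine (norm_add_le _ _).trans (le_of_eq ?_); rw [norm_smul, norm_smul, Real.norm_eq_abs (χ x)]
          _ ≤ ‖g x‖ * (K / Λ) + 1 * ‖fderiv ℝ g x‖ := by gcongr; exacts [hχd x, hχ1 x]
          _ = _ := by ring
      · rw [hχ0 x hx, hd0 x hx]; simp
    have hper : IsTransPeriodic Λ h := fun x => by
      have h1 := isTransPeriodic_fderiv hgp x
      simp only [hh, h1.1, h1.2, (hgp x).1, (hgp x).2, and_self]
    have hcell : eLpNorm h p (cellMeasure Λ) ≤ eLpNorm (fderiv ℝ g) p (cellMeasure Λ) +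
        ENNReal.ofReal (K / Λ) * eLpNorm g p (cellMeasure Λ) := by
      refine (eLpNorm_add_le hdc.norm.aestronglyMeasurable
        (continuous_const.mul hgc.norm).aestronglyMeasurable hp1).trans ?_
      rw [eLpNorm_norm]
      gcongr
      have := eLpNorm_const_smul (K / Λ) (fun x => ‖g x‖) p (cellMeasure Λ)
      rw [eLpNorm_norm, Real.enorm_eq_ofReal (by positivity)] at this
      exact this.le
    calc eLpNorm ({x : E3 | |x 0| ≤ R}.indicator g) p' (cellMeasure Λ)
        ≤ eLpNorm (fun x => g x * χ x) p' (cellMeasure Λ) := by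
          refine eLpNorm_mono_ae ?_
          filter_upwards [ae_restrict_mem (measurableSet_cell Λ)] with x hx
          by_cases hxR : |x 0| ≤ R
          · rw [Set.indicator_of_mem (by exact hxR), hχe x hx hxR, mul_one]
          · rw [Set.indicator_of_notMem (by exact hxR), norm_zero]; exact norm_nonneg _
      _ ≤ eLpNorm (fun x => g x * χ x) p' volume := eLpNorm_mono_measure _ Measure.restrict_le_self
      _ ≤ S * eLpNorm (fderiv ℝ fun x => g x * χ x) p volume := hsob
      _ ≤ S * eLpNorm ((fatCell Λ).indicator h) p volume := by gcongr; exact eLpNorm_mono hpt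
      _ = S * eLpNorm h p (volume.restrict (fatCell Λ)) := by
          rw [eLpNorm_indicator_eq_eLpNorm_restrict (isClosed_fatCell Λ).measurableSet]
      _ ≤ S * (9 * (eLpNorm (fderiv ℝ g) p (cellMeasure Λ) +
            ENNReal.ofReal (K / Λ) * eLpNorm g p (cellMeasure Λ))) := by
          gcongr
          exact (eLpNorm_fatCell_le hper hp1 ENNReal.coe_ne_top).trans (by gcongr)
      _ ≤ ENNReal.ofReal (S + 1) * (9 * (ENNReal.ofReal (1 + K) * (eLpNorm (fderiv ℝ g) p (cellMeasure Λ) +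
            ENNReal.ofReal Λ⁻¹ * eLpNorm g p (cellMeasure Λ)))) := by
          gcongr ?_ * (9 * ?_)
          · rw [← ENNReal.ofReal_coe_nnreal]; exact ENNReal.ofReal_le_ofReal (by linarith)
          · rw [mul_add, ← mul_assoc, ← ENNReal.ofReal_mul (by positivity)]
            refine add_le_add (le_mul_of_one_le_left' (by rw [ENNReal.one_le_ofReal]; linarith)) ?_
            gcongr
            rw [div_eq_mul_inv]; gcongr; linarith
      _ = Z := by
          rw [hZ, ENNReal.ofReal_mul (by positivity), ENNReal.ofReal_mul (by norm_num)]
          rw [show ENNReal.ofReal 9 = 9 by simp]; ring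
  -- let `R → ∞`
  have hlim := Lp.eLpNorm_lim_le_liminf_eLpNorm (p := (p' : ℝ≥0∞)) (μ := cellMeasure Λ)
    (f := fun n : ℕ => {x : E3 | |x 0| ≤ Λ + n}.indicator g)
    (fun n => hgc.aestronglyMeasurable.indicator
      (measurableSet_le (by fun_prop) measurable_const)) g (Filter.Eventually.of_forall fun x => by
      refine tendsto_const_nhds.congr' ?_
      filter_upwards [Filter.eventually_ge_atTop ⌈|x 0|⌉₊] with n hn
      rw [Set.indicator_of_mem]
      have := Nat.ceil_le.1 hn
      change |x 0| ≤ Λ + n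
      linarith)
  refine hlim.trans ?_
  calc _ ≤ Filter.liminf (fun _ : ℕ => Z) Filter.atTop :=
        Filter.liminf_le_liminf (Filter.Eventually.of_forall fun n => hR _ (by simp))
    _ = Z := Filter.liminf_const _

/-! ### Sobolev inequalities for functions with vanishing transverse mean -/

theorem norm_fderiv_le_sum (u : E3 → ℝ) (x : E3) :
    ‖fderiv ℝ u x‖ ≤ |pderiv 0 u x| + |pderiv 1 u x| + |pderiv 2 u x| := by
  refine ContinuousLinearMap.opNorm_le_bound _ (by positivity) fun y => ?_
  rw [fderiv_apply_eq, Real.norm_eq_abs]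
  have h (i : Fin 3) : |y i * pderiv i u x| ≤ |pderiv i u x| * ‖y‖ := by
    rw [abs_mul, mul_comm]; gcongr; exact PiLp.norm_apply_le y i
  calc _ ≤ |y 0 * pderiv 0 u x| + |y 1 * pderiv 1 u x| + |y 2 * pderiv 2 u x| :=
        (abs_add_le _ _).trans (by gcongr; exact abs_add_le _ _)
    _ ≤ |pderiv 0 u x| * ‖y‖ + |pderiv 1 u x| * ‖y‖ + |pderiv 2 u x| * ‖y‖ := by gcongr <;> exact h _
    _ = _ := by ring

theorem eLpNorm_fderiv_le {μ : Measure E3} {u : E3 → ℝ} (hu : ContDiff ℝ ∞ u) {p : ℝ≥0∞} (hp : 1 ≤ p)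
    {X : ℝ} (hX : 0 ≤ X) (h : ∀ i, eLpNorm (pderiv i u) p μ ≤ ENNReal.ofReal X) :
    eLpNorm (fderiv ℝ u) p μ ≤ ENNReal.ofReal (3 * X) := by
  have hc (i : Fin 3) : Continuous (pderiv i u) := (contDiff_pderiv hu i).continuous
  have hm (i : Fin 3) : AEStronglyMeasurable (fun x => |pderiv i u x|) μ := (hc i).abs.aestronglyMeasurable
  have hn (i : Fin 3) : eLpNorm (fun x => |pderiv i u x|) p μ ≤ ENNReal.ofReal X := by
    have := eLpNorm_norm (p := p) (μ := μ) (pderiv i u)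
    simp only [Real.norm_eq_abs] at this
    rw [this]; exact h i
  calc eLpNorm (fderiv ℝ u) p μ
      ≤ eLpNorm (fun x => |pderiv 0 u x| + |pderiv 1 u x| + |pderiv 2 u x|) p μ :=
        eLpNorm_mono fun x => (norm_fderiv_le_sum u x).trans (le_abs_self _)
    _ ≤ ENNReal.ofReal X + ENNReal.ofReal X + ENNReal.ofReal X :=
        (eLpNorm_add_le ((hm 0).add (hm 1)) (hm 2) hp).trans
          (add_le_add ((eLpNorm_add_le (hm 0) (hm 1) hp).trans (add_le_add (hn 0) (hn 1))) (hn 2))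
    _ = _ := by
        rw [← ENNReal.ofReal_add hX hX, ← ENNReal.ofReal_add (by positivity) hX]; ring_nf

/-- Sobolev's inequality for first derivatives. The term of lower order is removed by Poincaré's inequality;
as a consequence, the constant does not depend on `Λ`. -/
theorem exists_eLpNorm_le_of_isMeanZero_one {r p : ℝ≥0∞} (hr : 1 ≤ r) (hp : 1 ≤ p)
    (h : recip p = recip r - 1 / 3) (hp0 : 0 < recip p) :
    ∃ C : ℝ, 0 < C ∧ ∀ Λ : ℝ, 0 < Λ → ∀ u : E3 → ℝ, IsNice Λ u → IsMeanZero Λ u → ∀ X : ℝ, 0 < X →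
      (∀ i, eLpNorm (pderiv i u) r (cellMeasure Λ) ≤ ENNReal.ofReal X) →
      eLpNorm u p (cellMeasure Λ) ≤ ENNReal.ofReal (C * X) := by
  have hrt : r ≠ ⊤ := by rintro rfl; rw [recip_top] at h; linarith
  have hpt : p ≠ ⊤ := by rintro rfl; rw [recip_top] at hp0; exact lt_irrefl _ hp0
  lift r to ℝ≥0 using hrt
  lift p to ℝ≥0 using hpt
  have e (s : ℝ≥0) : recip s = (s : ℝ)⁻¹ := by simp [recip, ENNReal.toReal_inv]
  rw [e, e] at h
  obtain ⟨C, hC, hS⟩ := exists_eLpNorm_le_fderiv_add (p := r) (p' := p) (by exact_mod_cast hr)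
    (by rw [h]; norm_num)
  refine ⟨C * 5, by positivity, fun Λ hΛ u hn hu X hX hX' => ?_⟩
  refine (hS Λ hΛ u (hn.smooth.of_le (by exact_mod_cast le_top)) hn.periodic).trans ?_
  calc _ ≤ ENNReal.ofReal C * (ENNReal.ofReal (3 * X) + ENNReal.ofReal Λ⁻¹ * ENNReal.ofReal (2 * Λ * X)) := by
        gcongr
        · exact eLpNorm_fderiv_le hn.smooth hr hX.le hX'
        · exact eLpNorm_le_of_isMeanZero hΛ hn hu hr hX.le hX'
    _ = _ := by
        rw [← ENNReal.ofReal_mul (by positivity), ← ENNReal.ofReal_add (by positivity) (by positivity),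
          ← ENNReal.ofReal_mul hC.le]
        congr 1
        field_simp; ring

/-- Sobolev's inequality for derivatives of order `m`, by iteration. -/
theorem exists_eLpNorm_le_of_isMeanZero {m : ℕ} {r p : ℝ≥0∞} (hr : 1 ≤ r) (hp : 1 ≤ p)
    (h : recip p = recip r - (m : ℝ) / 3) (hp0 : 0 < recip p) :
    ∃ C : ℝ, 0 < C ∧ ∀ Λ : ℝ, 0 < Λ → ∀ u : E3 → ℝ, IsNice Λ u → IsMeanZero Λ u → ∀ X : ℝ, 0 < X →
      (∀ l : List (Fin 3), l.length = m → eLpNorm (pderivs l u) r (cellMeasure Λ) ≤ ENNReal.ofReal X) →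
      eLpNorm u p (cellMeasure Λ) ≤ ENNReal.ofReal (C * X) := by
  induction m generalizing p with
  | zero =>
    obtain rfl : p = r := recip_injective hp hr (by simpa using h)
    exact ⟨1, one_pos, fun Λ hΛ u hn hu X hX hX' => by simpa using! hX' [] rfl⟩
  | succ m ih =>
    push_cast at h
    have hle := recip_le_one hr
    obtain ⟨p₁, hp₁, hpe⟩ := exists_recip_eq (t := recip p + 1 / 3) (by linarith) (by
      have : (0 : ℝ) ≤ m := by positivity
      linarith)
    obtain ⟨C₁, hC₁, h₁⟩ := ih hp₁ (by rw [hpe, h]; ring) (by rw [hpe]; linarith)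
    obtain ⟨C₂, hC₂, h₂⟩ := exists_eLpNorm_le_of_isMeanZero_one hp₁ hp (by rw [hpe]; ring) hp0
    refine ⟨C₂ * C₁, by positivity, fun Λ hΛ u hn hu X hX hX' => ?_⟩
    rw [mul_assoc]
    refine h₂ Λ hΛ u hn hu _ (by positivity) fun i => ?_
    refine h₁ Λ hΛ (pderiv i u) (hn.pderivs [i]) (hu.pderiv hΛ hn i) X hX fun l hl => ?_
    have := hX' (l ++ [i]) (by simp [hl])
    rwa [pderivs_append] at this

theorem lintegral_fiber_le {Λ : ℝ} {F : E3 → ℝ≥0∞} (hF : IsTransPeriodic Λ F)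
    (hΛ : 0 < Λ) (hm : Measurable F) (x : E3) :
    ∫⁻ s in Set.Icc 0 Λ, ∫⁻ t in Set.Icc 0 Λ, ∫⁻ w in Set.Icc 0 Λ,
      F (x + s • stdBasis3 0 + t • stdBasis3 1 + w • stdBasis3 2) ≤ ∫⁻ y, F y ∂(cellMeasure Λ) := by
  have h := setLIntegral_coordBox Λ Λ Λ (f := fun y => F (x + y)) (hm.comp (measurable_const_add x))
  simp only [← add_assoc] at h
  rw [← h]
  calc ∫⁻ y in coordBox Λ Λ Λ, F (x + y) ≤ ∫⁻ y in cell Λ, F (x + y) :=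
        lintegral_mono_set fun y hy => ⟨hy.2.1, hy.2.2⟩
    _ = ∫⁻ y in cell Λ, F (y + x) := by simp only [add_comm]
    _ = _ := lintegral_cell_add hΛ hF x

/-- The embedding of `W^{3,1}` into bounded functions: the fundamental theorem of calculus is used
in the three directions one after the other. -/
theorem abs_le_of_pderivs_three {Λ : ℝ} (hΛ : 0 < Λ) {u : E3 → ℝ} (hn : IsNice Λ u)
    (hu : IsMeanZero Λ u) {X : ℝ} (hX : 0 < X)
    (h : ∀ l : List (Fin 3), l.length = 3 → eLpNorm (pderivs l u) 1 (cellMeasure Λ) ≤ ENNReal.ofReal X)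
    (x : E3) : |u x| ≤ 27 * X := by
  set c := ENNReal.ofReal Λ⁻¹ with hc
  -- the integrands after one, two and three applications of the fundamental theorem of calculus
  let T (i : Fin 3) (v : E3 → ℝ) (y : E3) : ℝ≥0∞ := c * ‖v y‖ₑ + ‖pderiv i v y‖ₑ
  let T₂ (v : E3 → ℝ) (y : E3) : ℝ≥0∞ := c * T 2 v y + T 2 (pderiv 1 v) y
  let T₃ (v : E3 → ℝ) (y : E3) : ℝ≥0∞ := c * T₂ v y + T₂ (pderiv 0 v) y
  have hcont {v : E3 → ℝ} (hv : ContDiff ℝ ∞ v) : Measurable fun y => ‖v y‖ₑ :=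
    hv.continuous.measurable.enorm
  have hTm (i : Fin 3) {v : E3 → ℝ} (hv : ContDiff ℝ ∞ v) : Measurable (T i v) :=
    ((hcont hv).const_mul _).add (hcont (contDiff_pderiv hv i))
  have hT₂m {v : E3 → ℝ} (hv : ContDiff ℝ ∞ v) : Measurable (T₂ v) :=
    ((hTm 2 hv).const_mul _).add (hTm 2 (contDiff_pderiv hv 1))
  have hT₃m {v : E3 → ℝ} (hv : ContDiff ℝ ∞ v) : Measurable (T₃ v) :=
    ((hT₂m hv).const_mul _).add (hT₂m (contDiff_pderiv hv 0))
  have hline (i : Fin 3) (y : E3) {F : E3 → ℝ≥0∞} (hF : Measurable F) :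
      Measurable fun t : ℝ => F (y + t • stdBasis3 i) :=
    hF.comp (by fun_prop)
  have h1 {v : E3 → ℝ} (hv : ContDiff ℝ ∞ v) (i : Fin 3) (y : E3) :
      ‖v y‖ₑ ≤ ∫⁻ t in Set.Icc 0 Λ, T i v (y + t • stdBasis3 i) := enorm_le_lintegral_line hv i y hΛ
  have h2 {v : E3 → ℝ} (hv : ContDiff ℝ ∞ v) (y : E3) :
      T 1 v y ≤ ∫⁻ w in Set.Icc 0 Λ, T₂ v (y + w • stdBasis3 2) := by
    simp only [T₂]
    rw [lintegral_add_left (hline 2 y ((hTm 2 hv).const_mul c)), lintegral_const_mul' _ _ ENNReal.ofReal_ne_top]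
    exact add_le_add (mul_le_mul_right (h1 hv 2 y) _) (h1 (contDiff_pderiv hv 1) 2 y)
  have hm2 {v : E3 → ℝ} (hv : ContDiff ℝ ∞ v) (y : E3) : Measurable fun t : ℝ =>
      ∫⁻ w in Set.Icc 0 Λ, T₂ v (y + t • stdBasis3 1 + w • stdBasis3 2) := by
    have : Measurable fun z : ℝ × ℝ => T₂ v (y + z.1 • stdBasis3 1 + z.2 • stdBasis3 2) :=
      (hT₂m hv).comp (by fun_prop)
    exact this.lintegral_prod_right'
  have h3 {v : E3 → ℝ} (hv : ContDiff ℝ ∞ v) (y : E3) :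
      ‖v y‖ₑ ≤ ∫⁻ t in Set.Icc 0 Λ, ∫⁻ w in Set.Icc 0 Λ, T₂ v (y + t • stdBasis3 1 + w • stdBasis3 2) :=
    (h1 hv 1 y).trans (lintegral_mono fun t => h2 hv _)
  have h4 {v : E3 → ℝ} (hv : ContDiff ℝ ∞ v) (y : E3) : T 0 v y ≤ ∫⁻ t in Set.Icc 0 Λ,
      ∫⁻ w in Set.Icc 0 Λ, T₃ v (y + t • stdBasis3 1 + w • stdBasis3 2) := by
    have e : ∀ t : ℝ, ∫⁻ w in Set.Icc 0 Λ, T₃ v (y + t • stdBasis3 1 + w • stdBasis3 2) =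
        c * (∫⁻ w in Set.Icc 0 Λ, T₂ v (y + t • stdBasis3 1 + w • stdBasis3 2)) +
        ∫⁻ w in Set.Icc 0 Λ, T₂ (pderiv 0 v) (y + t • stdBasis3 1 + w • stdBasis3 2) := fun t => by
      simp only [T₃]
      rw [lintegral_add_left (hline 2 _ ((hT₂m hv).const_mul c)), lintegral_const_mul' _ _ ENNReal.ofReal_ne_top]
    simp only [e]
    rw [lintegral_add_left ((hm2 hv y).const_mul c), lintegral_const_mul' _ _ ENNReal.ofReal_ne_top]
    exact add_le_add (mul_le_mul_right (h3 hv y) _) (h3 (contDiff_pderiv hv 0) y)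
  have hper : IsTransPeriodic Λ (T₃ u) := by
    have hp (l : List (Fin 3)) := hn.periodic.pderivs l
    intro y
    have e (z : E3) (hz : ∀ l : List (Fin 3), pderivs l u z = pderivs l u y) : T₃ u z = T₃ u y := by
      simp only [T₃, T₂, T]
      rw [show u z = u y from hz [], show pderiv 2 u z = pderiv 2 u y from hz [2],
        show pderiv 1 u z = pderiv 1 u y from hz [1], show pderiv 0 u z = pderiv 0 u y from hz [0],
        show pderiv 2 (pderiv 1 u) z = pderiv 2 (pderiv 1 u) y from hz [2, 1],
        show pderiv 2 (pderiv 0 u) z = pderiv 2 (pderiv 0 u) y from hz [2, 0],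
        show pderiv 1 (pderiv 0 u) z = pderiv 1 (pderiv 0 u) y from hz [1, 0],
        show pderiv 2 (pderiv 1 (pderiv 0 u)) z = pderiv 2 (pderiv 1 (pderiv 0 u)) y from hz [2, 1, 0]]
    exact ⟨e _ fun l => (hp l y).1, e _ fun l => (hp l y).2⟩
  -- lower derivatives are controlled through Poincaré's inequality
  have hc2 (A : ℝ) (hA : 0 ≤ A) : c * ENNReal.ofReal (2 * Λ * A) = ENNReal.ofReal (2 * A) := by
    rw [hc, ← ENNReal.ofReal_mul (by positivity)]; congr 1; field_simp
  have n3 : ∀ l : List (Fin 3), l.length = 3 → ∫⁻ y, ‖pderivs l u y‖ₑ ∂(cellMeasure Λ) ≤ ENNReal.ofReal X :=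
    fun l hl => by rw [← eLpNorm_one_eq_lintegral_enorm]; exact h l hl
  have down : ∀ (k : ℕ) (A : ℝ), 0 ≤ A → (∀ l : List (Fin 3), l.length = k + 1 →
      ∫⁻ y, ‖pderivs l u y‖ₑ ∂(cellMeasure Λ) ≤ ENNReal.ofReal A) → ∀ l : List (Fin 3), l.length = k →
      ∫⁻ y, ‖pderivs l u y‖ₑ ∂(cellMeasure Λ) ≤ ENNReal.ofReal (2 * Λ * A) := by
    intro k A hA hk l hl
    rw [← eLpNorm_one_eq_lintegral_enorm]
    refine eLpNorm_le_of_isMeanZero hΛ (hn.pderivs l) (hu.pderivs hΛ hn l) le_rfl hA fun i => ?_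
    rw [eLpNorm_one_eq_lintegral_enorm]
    exact hk (i :: l) (by simp [hl])
  have n2 := down 2 X hX.le n3
  have n1 := down 1 _ (by positivity) n2
  have n0 := down 0 _ (by positivity) n1
  have hint {F G : E3 → ℝ≥0∞} (hF : Measurable F) {A B : ℝ} (hA : 0 ≤ A) (hB : 0 ≤ B)
      (h1 : ∫⁻ y, F y ∂(cellMeasure Λ) ≤ ENNReal.ofReal (2 * Λ * A))
      (h2 : ∫⁻ y, G y ∂(cellMeasure Λ) ≤ ENNReal.ofReal B) :
      ∫⁻ y, (c * F y + G y) ∂(cellMeasure Λ) ≤ ENNReal.ofReal (2 * A + B) := by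
    rw [lintegral_add_left (hF.const_mul c), lintegral_const_mul' _ _ ENNReal.ofReal_ne_top,
      ENNReal.ofReal_add (by positivity) hB, ← hc2 A hA]
    gcongr
  have hs (l : List (Fin 3)) : ContDiff ℝ ∞ (pderivs l u) := (hn.pderivs l).smooth
  have t1 (l : List (Fin 3)) (A : ℝ) (hA : 0 ≤ A) (hl : ∫⁻ y, ‖pderivs l u y‖ₑ ∂(cellMeasure Λ) ≤
      ENNReal.ofReal (2 * Λ * A)) (hl' : ∫⁻ y, ‖pderivs (2 :: l) u y‖ₑ ∂(cellMeasure Λ) ≤ ENNReal.ofReal A) :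
      ∫⁻ y, T 2 (pderivs l u) y ∂(cellMeasure Λ) ≤ ENNReal.ofReal (3 * A) :=
    (hint (hcont (hs l)) hA hA hl hl').trans (by rw [show 2 * A + A = 3 * A by ring])
  have t2 (l : List (Fin 3)) (A : ℝ) (hA : 0 ≤ A)
      (hl : ∫⁻ y, T 2 (pderivs l u) y ∂(cellMeasure Λ) ≤ ENNReal.ofReal (2 * Λ * A))
      (hl' : ∫⁻ y, T 2 (pderivs (1 :: l) u) y ∂(cellMeasure Λ) ≤ ENNReal.ofReal A) :
      ∫⁻ y, T₂ (pderivs l u) y ∂(cellMeasure Λ) ≤ ENNReal.ofReal (3 * A) :=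
    (hint (hTm 2 (hs l)) hA hA hl hl').trans (by rw [show 2 * A + A = 3 * A by ring])
  have b0 := t1 [] _ (by positivity) (n0 [] rfl) (n1 [2] rfl)
  have b1 := fun i => t1 [i] _ (by positivity) (n1 [i] rfl) (n2 [2, i] rfl)
  have b2 := t1 [1, 0] _ (by positivity) (n2 [1, 0] rfl) (n3 [2, 1, 0] rfl)
  have d0 := t2 [] (3 * (2 * Λ * X)) (by positivity) (b0.trans (le_of_eq (by ring_nf))) (b1 1)
  have d1 := t2 [0] (3 * X) (by positivity) ((b1 0).trans (le_of_eq (by ring_nf))) b2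
  have e0 := hint (hT₂m hn.smooth) (A := 3 * (3 * X)) (by positivity) (by positivity)
    (d0.trans (le_of_eq (by ring_nf))) d1
  rw [← ENNReal.ofReal_le_ofReal_iff (by positivity), ← Real.enorm_eq_ofReal_abs]
  calc ‖u x‖ₑ ≤ ∫⁻ s in Set.Icc 0 Λ, ∫⁻ t in Set.Icc 0 Λ, ∫⁻ w in Set.Icc 0 Λ,
        T₃ u (x + s • stdBasis3 0 + t • stdBasis3 1 + w • stdBasis3 2) :=
        (h1 hn.smooth 0 x).trans (lintegral_mono fun s => h4 hn.smooth _)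
    _ ≤ ∫⁻ y, T₃ u y ∂(cellMeasure Λ) := lintegral_fiber_le hper hΛ (hT₃m hn.smooth) x
    _ ≤ _ := e0
    _ = _ := by ring_nf

/-! ### The critical exponent -/

/-- The `W^{1,1}` Sobolev inequality applied to `|u| ^ (1 + 2t/3)`. -/
theorem exists_lintegral_rpow_add_le {t : ℝ} (ht : 1 ≤ t) :
    ∃ C : ℝ, 0 < C ∧ ∀ Λ : ℝ, 0 < Λ → ∀ u : E3 → ℝ, IsNice Λ u → IsMeanZero Λ u → ∀ X : ℝ, 0 < X →
      (∀ i, eLpNorm (pderiv i u) 3 (cellMeasure Λ) ≤ ENNReal.ofReal X) →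
      ∫⁻ x, ‖u x‖ₑ ^ (t + 3 / 2) ∂(cellMeasure Λ) ≤
        ENNReal.ofReal (C * X ^ (3 / 2 : ℝ)) * ∫⁻ x, ‖u x‖ₑ ^ t ∂(cellMeasure Λ) := by
  obtain ⟨S, hS, hSob⟩ := exists_eLpNorm_le_fderiv_add (p := 1) (p' := 3 / 2) le_rfl (by norm_num)
  -- with this `σ` the left-hand side of Sobolev's inequality contains `|u| ^ (3σ/2) = |u| ^ (t + 3/2)`, and
  -- Hölder's inequality on the right-hand side leads to `|u| ^ (3(σ - 1)/2) = |u| ^ t`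
  set σ : ℝ := 1 + 2 * t / 3 with hσ
  have hσ1 : 1 < σ := by rw [hσ]; linarith
  refine ⟨(S * (3 * σ + 2)) ^ (3 / 2 : ℝ), by positivity, fun Λ hΛ u hn hu X hX hX' => ?_⟩
  have hu1 : ContDiff ℝ 1 u := hn.smooth.of_le (by exact_mod_cast le_top)
  have hc := hu1.continuous
  have hper : IsTransPeriodic Λ fun x => ‖u x‖ ^ σ := fun x => by
    simp only [(hn.periodic x).1, (hn.periodic x).2, and_self]
  have h1 := hSob Λ hΛ _ (hu1.norm_rpow hσ1) hper
  set μ := cellMeasure Λ with hμ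
  set I := ∫⁻ x, ‖u x‖ₑ ^ t ∂μ with hI
  have hen : ∀ x, ‖‖u x‖ ^ σ‖ₑ = ‖u x‖ₑ ^ σ := fun x => by
    rw [Real.enorm_rpow_of_nonneg (norm_nonneg _) (by positivity), enorm_norm]
  have hmu : Measurable fun x => ‖u x‖ₑ := hc.measurable.enorm
  -- Hölder's inequality with exponents `3/2` and `3`
  have hH {E : Type} [NormedAddCommGroup E] (v : E3 → E) (hv : Continuous v) :
      ∫⁻ x, ‖u x‖ₑ ^ (σ - 1) * ‖v x‖ₑ ∂μ ≤ I ^ (2 / 3 : ℝ) * eLpNorm v 3 μ := by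
    have hconj : (3 / 2 : ℝ).HolderConjugate 3 := by
      rw [Real.holderConjugate_iff]; norm_num
    refine (ENNReal.lintegral_mul_le_Lp_mul_Lq μ hconj (hmu.pow_const _).aemeasurable
      (by fun_prop)).trans (le_of_eq ?_)
    rw [eLpNorm_eq_lintegral_rpow_enorm_toReal (by norm_num) (by norm_num)]
    congr 2
    · simp only [← ENNReal.rpow_mul, hI]
      congr 1; funext x; congr 1; rw [hσ]; ring
    · norm_num
  have hL : eLpNorm (fun x => ‖u x‖ ^ σ) ((3 / 2 : ℝ≥0) : ℝ≥0∞) μ =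
      (∫⁻ x, ‖u x‖ₑ ^ (t + 3 / 2) ∂μ) ^ (2 / 3 : ℝ) := by
    rw [eLpNorm_eq_lintegral_rpow_enorm_toReal (by norm_num) ENNReal.coe_ne_top]
    have e : ((3 / 2 : ℝ≥0) : ℝ) = 3 / 2 := by simp
    simp only [hen, ← ENNReal.rpow_mul, ENNReal.coe_toReal, e]
    rw [show (1 : ℝ) / (3 / 2) = 2 / 3 by norm_num, show σ * (3 / 2) = t + 3 / 2 by rw [hσ]; ring]
  have hd : eLpNorm (fderiv ℝ fun x => ‖u x‖ ^ σ) ((1 : ℝ≥0) : ℝ≥0∞) μ ≤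
      ENNReal.ofReal σ * (I ^ (2 / 3 : ℝ) * ENNReal.ofReal (3 * X)) := by
    rw [ENNReal.coe_one, eLpNorm_one_eq_lintegral_enorm]
    have hfc : Continuous (fderiv ℝ u) := hu1.continuous_fderiv (by simp)
    calc _ ≤ ∫⁻ x, ENNReal.ofReal σ * (‖u x‖ₑ ^ (σ - 1) * ‖fderiv ℝ u x‖ₑ) ∂μ := by
          refine lintegral_mono fun x => ?_
          obtain ⟨s, hs⟩ : ∃ s : ℝ≥0, (s : ℝ) = σ := ⟨⟨σ, by positivity⟩, rfl⟩
          rw [← hs, ENNReal.ofReal_coe_nnreal, ← mul_assoc]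
          exact enorm_fderiv_norm_rpow_le (hu1.differentiable (by simp))
            (by rw [← hs] at hσ1; exact_mod_cast hσ1)
      _ ≤ _ := by
          rw [lintegral_const_mul' _ _ ENNReal.ofReal_ne_top]
          gcongr
          exact (hH _ hfc).trans (by gcongr; exact eLpNorm_fderiv_le hn.smooth (by norm_num) hX.le hX')
  have hz : eLpNorm (fun x => ‖u x‖ ^ σ) ((1 : ℝ≥0) : ℝ≥0∞) μ ≤
      I ^ (2 / 3 : ℝ) * ENNReal.ofReal (2 * Λ * X) := by
    rw [ENNReal.coe_one, eLpNorm_one_eq_lintegral_enorm]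
    calc _ = ∫⁻ x, ‖u x‖ₑ ^ (σ - 1) * ‖u x‖ₑ ∂μ := by
          refine lintegral_congr fun x => ?_
          rw [hen]
          conv_rhs => rw [← ENNReal.rpow_one ‖u x‖ₑ, ← ENNReal.rpow_mul, one_mul,
            ← ENNReal.rpow_add_of_nonneg _ _ (by linarith) (by norm_num)]
          ring_nf
      _ ≤ _ := (hH u hc).trans (by gcongr; exact eLpNorm_le_of_isMeanZero hΛ hn hu (by norm_num) hX.le hX')
  rw [hL] at h1
  have h2 : (∫⁻ x, ‖u x‖ₑ ^ (t + 3 / 2) ∂μ) ^ (2 / 3 : ℝ) ≤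
      ENNReal.ofReal (S * (3 * σ + 2) * X) * I ^ (2 / 3 : ℝ) := by
    refine h1.trans ?_
    calc _ ≤ ENNReal.ofReal S * (ENNReal.ofReal σ * (I ^ (2 / 3 : ℝ) * ENNReal.ofReal (3 * X)) +
          ENNReal.ofReal Λ⁻¹ * (I ^ (2 / 3 : ℝ) * ENNReal.ofReal (2 * Λ * X))) := by gcongr
      _ = ENNReal.ofReal S * (ENNReal.ofReal σ * ENNReal.ofReal (3 * X) +
          ENNReal.ofReal Λ⁻¹ * ENNReal.ofReal (2 * Λ * X)) * I ^ (2 / 3 : ℝ) := by ring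
      _ = _ := by
          rw [← ENNReal.ofReal_mul (by positivity), ← ENNReal.ofReal_mul (by positivity),
            ← ENNReal.ofReal_add (by positivity) (by positivity), ← ENNReal.ofReal_mul hS.le]
          congr 2; field_simp
  have h3 := ENNReal.rpow_le_rpow h2 (show (0 : ℝ) ≤ 3 / 2 by norm_num)
  rw [ENNReal.mul_rpow_of_nonneg _ _ (by norm_num), ← ENNReal.rpow_mul, ← ENNReal.rpow_mul,
    ENNReal.ofReal_rpow_of_pos (by positivity), Real.mul_rpow (by positivity) hX.le] at h3
  norm_num at h3
  norm_num
  exact h3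

/-- Iteration of the preceding estimate raises the exponent by any multiple of `3/2`. -/
theorem exists_lintegral_rpow_le {q : ℝ} (hq : 1 ≤ q) (n : ℕ) :
    ∃ C : ℝ, 0 < C ∧ ∀ Λ : ℝ, 0 < Λ → ∀ u : E3 → ℝ, IsNice Λ u → IsMeanZero Λ u → ∀ X : ℝ, 0 < X →
      (∀ i, eLpNorm (pderiv i u) 3 (cellMeasure Λ) ≤ ENNReal.ofReal X) →
      ∫⁻ x, ‖u x‖ₑ ^ (q + 3 / 2 * n) ∂(cellMeasure Λ) ≤
        ENNReal.ofReal (C * X ^ (3 / 2 * n : ℝ)) * ∫⁻ x, ‖u x‖ₑ ^ q ∂(cellMeasure Λ) := by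
  induction n with
  | zero => exact ⟨1, one_pos, fun Λ hΛ u hn hu X hX hX' => by simp⟩
  | succ n ih =>
    obtain ⟨C, hC, h⟩ := ih
    obtain ⟨D, hD, h'⟩ := exists_lintegral_rpow_add_le (t := q + 3 / 2 * n) (by
      have : (0 : ℝ) ≤ n := by positivity
      linarith)
    refine ⟨D * C, by positivity, fun Λ hΛ u hn hu X hX hX' => ?_⟩
    have h1 := h' Λ hΛ u hn hu X hX hX'
    have e : q + 3 / 2 * ((n + 1 : ℕ) : ℝ) = q + 3 / 2 * n + 3 / 2 := by push_cast; ring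
    rw [e]
    refine h1.trans ((mul_le_mul_right (h Λ hΛ u hn hu X hX hX') _).trans (le_of_eq ?_))
    rw [← mul_assoc, ← ENNReal.ofReal_mul (by positivity)]
    congr 2
    rw [show (3 / 2 * ((n + 1 : ℕ) : ℝ)) = 3 / 2 + 3 / 2 * n by push_cast; ring, Real.rpow_add hX]
    ring

/-- The critical inequality: gradients in `L³` control all finite exponents. -/
theorem exists_eLpNorm_le_of_critical {q p : ℝ≥0∞} (hq : 1 ≤ q) (hqt : q ≠ ⊤) (hp : 1 ≤ p) {θ : ℝ}
    (hθ0 : 0 < θ) (hθ1 : θ < 1) (h : recip p = (1 - θ) * recip q) :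
    ∃ C : ℝ, 0 < C ∧ ∀ Λ : ℝ, 0 < Λ → ∀ u : E3 → ℝ, IsNice Λ u → IsMeanZero Λ u → ∀ X Y : ℝ,
      0 < X → 0 < Y → (∀ i, eLpNorm (pderiv i u) 3 (cellMeasure Λ) ≤ ENNReal.ofReal X) →
      eLpNorm u q (cellMeasure Λ) ≤ ENNReal.ofReal Y →
      eLpNorm u p (cellMeasure Λ) ≤ ENNReal.ofReal (C * (X ^ θ * Y ^ (1 - θ))) := by
  have hq0 : q ≠ 0 := (zero_lt_one.trans_le hq).ne'
  set Q := q.toReal with hQ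
  have hQ1 : 1 ≤ Q := by simpa using ENNReal.toReal_mono hqt hq
  have hQ0 : 0 < Q := by linarith
  have hrq : recip q = Q⁻¹ := by rw [recip, ENNReal.toReal_inv]
  -- an exponent `t` so large that `p` lies between `q` and `t`
  obtain ⟨n, hn⟩ := exists_nat_gt (Q / (1 - θ))
  have h1θ : 0 < 1 - θ := by linarith
  have hn0 : (0 : ℝ) < n := (by positivity : 0 < Q / (1 - θ)).trans hn
  set t := Q + 3 / 2 * n with ht
  have ht0 : 0 < t := by positivity
  have htn : t = Q + 3 / 2 * n := rfl
  obtain ⟨C, hC, hI⟩ := exists_lintegral_rpow_le hQ1 n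
  set τ := θ * t / (3 / 2 * n) with hτ
  have hτ0 : 0 ≤ τ := by positivity
  have hτ1 : τ ≤ 1 := by
    rw [hτ, div_le_one (by positivity)]
    rw [div_lt_iff₀ h1θ] at hn
    have := mul_pos hn0 h1θ
    rw [htn]; nlinarith
  refine ⟨(C ^ t⁻¹) ^ τ, by positivity, fun Λ hΛ u hnu hu X Y hX hY hX' hY' => ?_⟩
  have hpt1 : (1 : ℝ≥0∞) ≤ ENNReal.ofReal t := by rw [ENNReal.one_le_ofReal]; linarith
  have htop : eLpNorm u (ENNReal.ofReal t) (cellMeasure Λ) ≤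
      ENNReal.ofReal (C ^ t⁻¹ * X ^ (3 / 2 * n / t) * Y ^ (Q / t)) := by
    rw [eLpNorm_eq_lintegral_rpow_enorm_toReal hq0 hqt, one_div, ENNReal.rpow_inv_le_iff (by linarith), ← hQ,
      ENNReal.ofReal_rpow_of_pos hY] at hY'
    rw [eLpNorm_eq_lintegral_rpow_enorm_toReal (by simpa using ht0) ENNReal.ofReal_ne_top,
      ENNReal.toReal_ofReal ht0.le, one_div, ENNReal.rpow_inv_le_iff ht0, ENNReal.ofReal_rpow_of_pos (by positivity)]
    refine (hI Λ hΛ u hnu hu X hX hX').trans ((mul_le_mul_right hY' _).trans (le_of_eq ?_))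
    rw [← ENNReal.ofReal_mul (by positivity)]
    congr 1
    rw [Real.mul_rpow (by positivity) (by positivity), Real.mul_rpow (by positivity) (by positivity),
      ← Real.rpow_mul hC.le, ← Real.rpow_mul hX.le, ← Real.rpow_mul hY.le]
    rw [inv_mul_cancel₀ ht0.ne', Real.rpow_one, div_mul_cancel₀ _ ht0.ne', div_mul_cancel₀ _ ht0.ne']
  have hrt : recip (ENNReal.ofReal t) = t⁻¹ := by
    rw [recip, ENNReal.toReal_inv, ENNReal.toReal_ofReal ht0.le]
  have hτQ : τ * (Q / t) = τ - θ := by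
    rw [hτ, htn]; field_simp; ring
  refine (eLpNorm_le_of_recip_eq (hnu.stronglyMeasurable.aestronglyMeasurable) hp hq hpt1 hτ0 hτ1 ?_ hY.le
    (by positivity) hY' htop).trans (le_of_eq ?_)
  · rw [h, hrq, hrt]
    have : τ * t⁻¹ = (τ - θ) * Q⁻¹ := by rw [← hτQ]; field_simp
    rw [this]; ring
  · congr 1
    rw [Real.mul_rpow (by positivity) (by positivity), Real.mul_rpow (by positivity) (by positivity),
      ← Real.rpow_mul hX.le, ← Real.rpow_mul hY.le, mul_comm (Q / t), hτQ]
    have e1 : 3 / 2 * n / t * τ = θ := by rw [hτ]; field_simp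
    rw [e1, show 1 - θ = (1 - τ) + (τ - θ) by ring, Real.rpow_add hY]
    ring

/-! ### The full range of exponents for smooth functions -/

/-- The Gagliardo-Nirenberg inequality in dimension `1/κ` for the class `𝒦` of functions. The
right-hand side is expressed by upper bounds `X`, `Y` of the norms of the data, which avoids
products of infinite and vanishing norms. -/
def GNBound (𝒦 : ℝ → (E3 → ℝ) → Prop) (κ : ℝ) (m j : ℕ) (q r p : ℝ≥0∞) (θ : ℝ) : Prop :=
  ∃ C : ℝ, 0 < C ∧ ∀ Λ : ℝ, 0 < Λ → ∀ u : E3 → ℝ, 𝒦 Λ u → ∀ X Y : ℝ, 0 < X → 0 < Y →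
    (∀ l : List (Fin 3), l.length = m → eLpNorm (pderivs l u) r (cellMeasure Λ) ≤ ENNReal.ofReal X) →
    eLpNorm u q (cellMeasure Λ) ≤ ENNReal.ofReal Y → ∀ l : List (Fin 3), l.length = j →
    eLpNorm (pderivs l u) p (cellMeasure Λ) ≤
      ENNReal.ofReal (C * Λ ^ (-(3 * κ - 1) * (m * θ - j)) * X ^ θ * Y ^ (1 - θ))

/-- For `θ = 0` the inequality is trivial. -/
theorem GNBound.of_zero {𝒦 : ℝ → (E3 → ℝ) → Prop} {κ : ℝ} {m : ℕ} {q r p : ℝ≥0∞} (hq : 1 ≤ q) (hp : 1 ≤ p)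
    (h : recip p = recip q) : GNBound 𝒦 κ m 0 q r p 0 := by
  obtain rfl := recip_injective hp hq h
  refine ⟨1, one_pos, fun Λ hΛ u hu X Y hX hY hX' hY' l hl => ?_⟩
  obtain rfl := List.length_eq_zero_iff.1 hl
  simpa [pderivs] using hY'

/-- Interpolation between `q` and `p'`, where the norm in `L^{p'}` is controlled with weight `t`. -/
theorem GNBound.of_interpolation {𝒦 : ℝ → (E3 → ℝ) → Prop} (h𝒦 : ∀ Λ u, 𝒦 Λ u → IsNice Λ u) {κ : ℝ} {m : ℕ}
    {q r p p' : ℝ≥0∞} (hq : 1 ≤ q) (hp : 1 ≤ p) (hp' : 1 ≤ p') {t τ : ℝ} (hτ0 : 0 ≤ τ) (hτ1 : τ ≤ 1)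
    (h : GNBound 𝒦 κ m 0 q r p' t) (hpq : recip p = (1 - τ) * recip q + τ * recip p') :
    GNBound 𝒦 κ m 0 q r p (t * τ) := by
  obtain ⟨C, hC, hb⟩ := h
  refine ⟨C ^ τ, by positivity, fun Λ hΛ u hu X Y hX hY hX' hY' l hl => ?_⟩
  obtain rfl := List.length_eq_zero_iff.1 hl
  have h1 := hb Λ hΛ u hu X Y hX hY hX' hY' [] rfl
  refine (eLpNorm_le_of_recip_eq (h𝒦 Λ u hu).stronglyMeasurable.aestronglyMeasurable hp hq hp' hτ0 hτ1 hpq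
    hY.le (by positivity) hY' h1).trans (le_of_eq ?_)
  congr 1
  obtain ⟨c, rfl⟩ := exists_exp_eq hC
  obtain ⟨l, rfl⟩ := exists_exp_eq hΛ
  obtain ⟨ξ, rfl⟩ := exists_exp_eq hX
  obtain ⟨η, rfl⟩ := exists_exp_eq hY
  simp only [← Real.exp_add, ← Real.exp_mul]
  congr 1
  push_cast
  ring

theorem GNBound.of_supBound {𝒦 : ℝ → (E3 → ℝ) → Prop} {κ : ℝ} {m : ℕ} {q r : ℝ≥0∞}
    (h : SupBound 𝒦 κ m q r) :
    GNBound 𝒦 κ m 0 q r ⊤ (recip q / (m * κ - recip r + recip q)) := by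
  obtain ⟨C, hC, hb⟩ := h
  refine ⟨C, hC, fun Λ hΛ u hu X Y hX hY hX' hY' l hl => ?_⟩
  obtain rfl := List.length_eq_zero_iff.1 hl
  rw [eLpNorm_exponent_top]
  refine essSup_le_of_ae_le _ (Filter.Eventually.of_forall fun y => ?_)
  simp only [Real.enorm_eq_ofReal_abs]
  refine ENNReal.ofReal_le_ofReal ?_
  simpa using! hb Λ hΛ u hu X Y hX hY hX' hY' y

/-- A bound of the supremum implies, by interpolation with `L^q`, the inequality of order zero for all
admissible exponents. -/
theorem GNBound.of_supBound_of_recip_eq {𝒦 : ℝ → (E3 → ℝ) → Prop} (h𝒦 : ∀ Λ u, 𝒦 Λ u → IsNice Λ u) {κ : ℝ}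
    {m : ℕ} {q r p : ℝ≥0∞} (hq : 1 ≤ q) (hqt : q ≠ ⊤) (hp : 1 ≤ p) {θ : ℝ} (hθ : 0 ≤ θ)
    (hκ : recip r ≤ m * κ) (hpqr : recip p = (recip r - m * κ) * θ + recip q * (1 - θ))
    (h : SupBound 𝒦 κ m q r) : GNBound 𝒦 κ m 0 q r p θ := by
  have hb := recip_pos hq hqt
  have hD : 0 < m * κ - recip r + recip q := by linarith
  have hp0 := recip_nonneg p
  have h1 := GNBound.of_interpolation h𝒦 hq hp le_top
    (τ := θ * (m * κ - recip r + recip q) / recip q) (by positivity)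
    (by rw [div_le_one hb]; linarith) (GNBound.of_supBound h) (by
      rw [recip_top, hpqr]; field_simp; ring)
  rwa [show recip q / (m * κ - recip r + recip q) * (θ * (m * κ - recip r + recip q) / recip q) = θ by
    field_simp] at h1

/-- The class of functions of the first coordinate. -/
def LongitudinalClass (Λ : ℝ) (u : E3 → ℝ) : Prop := IsNice Λ u ∧ IsLongitudinal u

/-- The class of functions with vanishing transverse mean. -/
def MeanZeroClass (Λ : ℝ) (u : E3 → ℝ) : Prop := IsNice Λ u ∧ IsMeanZero Λ u

/-- The one-dimensional inequality of order zero. -/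
theorem gnBound_zero_of_isLongitudinal {m : ℕ} (hm : 1 ≤ m) {q r p : ℝ≥0∞} (hq : 1 ≤ q) (hr : 1 ≤ r)
    (hp : 1 ≤ p) {θ : ℝ} (hθ : 0 ≤ θ) (h : recip p = (recip r - m) * θ + recip q * (1 - θ))
    (hd : ¬ (q = ⊤ ∧ 0 < θ ∧ m = 1 ∧ r = 1)) : GNBound LongitudinalClass 1 m 0 q r p θ := by
  rcases hθ.eq_or_lt with rfl | hθ0
  · exact GNBound.of_zero hq hp (by simpa using h)
  have hm1 : (1 : ℝ) ≤ m := by exact_mod_cast hm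
  have hr1 := recip_le_one hr
  -- for `q = ∞` and `θ > 0`, the relation between the exponents gives `m ≤ 1/r`
  have hqt : q ≠ ⊤ := by
    rintro rfl
    have hp0 := recip_nonneg p
    rw [h, recip_top, zero_mul, add_zero] at hp0
    have h1 := nonneg_of_mul_nonneg_left hp0 hθ0
    have hm' : (m : ℝ) = 1 := by linarith
    have hr' : recip r = 1 := by linarith
    refine hd ⟨rfl, hθ0, by exact_mod_cast hm', recip_injective hr le_rfl ?_⟩
    rw [hr']; simp [recip]
  obtain ⟨s, hs, hse⟩ := exists_recip_eq (t := recip r / m) (div_nonneg (recip_nonneg r) (by positivity))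
    (by rw [div_le_one (by positivity)]; linarith)
  have hs1 := recip_le_one hs
  exact GNBound.of_supBound_of_recip_eq (fun Λ u h => h.1) hq hqt hp hθ (by linarith) (by simpa using h)
    (SupBound.of_one (fun Λ u h => h.1) hm hq hqt hr hs hse hs1 (supBound_one_of_isLongitudinal hq hs hqt))

/-- A Sobolev inequality with target `L^{p'}` implies the inequality of order zero between `q` and `p'`. -/
theorem gnBound_zero_of_sobolev {m : ℕ} {q r p p' : ℝ≥0∞} (hq : 1 ≤ q) (hp : 1 ≤ p) (hp' : 1 ≤ p') {θ : ℝ}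
    (hθ0 : 0 ≤ θ) (hθ1 : θ ≤ 1) (h : recip p = recip p' * θ + recip q * (1 - θ))
    (hS : ∃ C : ℝ, 0 < C ∧ ∀ Λ : ℝ, 0 < Λ → ∀ u : E3 → ℝ, IsNice Λ u → IsMeanZero Λ u → ∀ X : ℝ, 0 < X →
      (∀ l : List (Fin 3), l.length = m → eLpNorm (pderivs l u) r (cellMeasure Λ) ≤ ENNReal.ofReal X) →
      eLpNorm u p' (cellMeasure Λ) ≤ ENNReal.ofReal (C * X)) :
    GNBound MeanZeroClass (1 / 3) m 0 q r p θ := by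
  have h1 : GNBound MeanZeroClass (1 / 3) m 0 q r p' 1 := by
    obtain ⟨C, hC, hb⟩ := hS
    refine ⟨C, hC, fun Λ hΛ u hu X Y hX hY hX' hY' l hl => ?_⟩
    obtain rfl := List.length_eq_zero_iff.1 hl
    simpa using! hb Λ hΛ u hu.1 hu.2 X hX hX'
  rw [← one_mul θ]
  exact h1.of_interpolation (fun Λ u h => h.1) hq hp hp' hθ0 hθ1 (by rw [h]; ring)

/-- The three-dimensional inequality of order zero. According to the sign of `m - 3/r`, the endpoint of the
interpolation is Sobolev's inequality, a borderline case, or Morrey's estimate. -/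
theorem gnBound_zero_of_isMeanZero {m : ℕ} (hm : 1 ≤ m) {q r p : ℝ≥0∞} (hq : 1 ≤ q) (hr : 1 ≤ r)
    (hp : 1 ≤ p) {θ : ℝ} (hθ : 0 ≤ θ) (hθ1 : θ ≤ 1)
    (h : recip p = (recip r - m / 3) * θ + recip q * (1 - θ))
    (hcrit : ¬ (θ = 1 ∧ 1 < r ∧ (m : ℝ) = 3 * recip r))
    (hd : ¬ (q = ⊤ ∧ 0 < θ ∧ 1 < r ∧ (m : ℝ) = 3 * recip r)) :
    GNBound MeanZeroClass (1 / 3) m 0 q r p θ := by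
  rcases hθ.eq_or_lt with rfl | hθ0
  · exact GNBound.of_zero hq hp (by simpa using h)
  have hm1 : (1 : ℝ) ≤ m := by exact_mod_cast hm
  have hr1 := recip_le_one hr
  rcases lt_trichotomy ((m : ℝ) / 3) (recip r) with hlt | heq | hgt
  · obtain ⟨p', hp', he⟩ := exists_recip_eq (t := recip r - m / 3) (by linarith) (by linarith)
    exact gnBound_zero_of_sobolev hq hp hp' hθ hθ1 (by rw [he]; exact h)
      (exists_eLpNorm_le_of_isMeanZero hr hp' he (by rw [he]; linarith))
  -- for `m = 3/r` and `r = 1`, the endpoint is the bound of the supremum in `W^{3,1}`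
  · rcases hr.eq_or_lt with rfl | hr'
    · have hm3 : m = 3 := by
        have : recip 1 = 1 := by simp [recip]
        rw [this, div_eq_one_iff_eq (by norm_num)] at heq
        exact_mod_cast heq
      subst hm3
      refine gnBound_zero_of_sobolev (p' := ⊤) hq hp le_top hθ hθ1 (by rw [h, heq, recip_top]; ring)
        ⟨27, by norm_num, fun Λ hΛ u hn hu X hX hX' => ?_⟩
      rw [eLpNorm_exponent_top]
      refine essSup_le_of_ae_le _ (Filter.Eventually.of_forall fun y => ?_)
      simp only [Real.enorm_eq_ofReal_abs]
      exact ENNReal.ofReal_le_ofReal (abs_le_of_pderivs_three hΛ hn hu hX hX' y)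
    -- for `m = 3/r` and `r > 1`, first derivatives lie in `L³`, which is critical
    · have hm3 : (m : ℝ) = 3 * recip r := by linarith
      have hqt : q ≠ ⊤ := fun hq' => hd ⟨hq', hθ0, hr', hm3⟩
      have hθ1' : θ < 1 := lt_of_le_of_ne hθ1 fun hθ' => hcrit ⟨hθ', hr', hm3⟩
      obtain ⟨C, hC, hb⟩ := exists_eLpNorm_le_of_critical hq hqt hp hθ0 hθ1' (by rw [h, heq]; ring)
      have h3 : recip 3 = 1 / 3 := by simp [recip]
      obtain ⟨D, hD, hS⟩ := exists_eLpNorm_le_of_isMeanZero (m := m - 1) (r := r) (p := 3) hr (by norm_num)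
        (by rw [h3, ← heq, Nat.cast_sub hm]; push_cast; ring) (by rw [h3]; norm_num)
      refine ⟨C * D ^ θ, by positivity, fun Λ hΛ u hu X Y hX hY hX' hY' l hl => ?_⟩
      obtain rfl := List.length_eq_zero_iff.1 hl
      refine (hb Λ hΛ u hu.1 hu.2 (D * X) Y (by positivity) hY (fun i => ?_) hY').trans (le_of_eq ?_)
      · refine hS Λ hΛ (pderiv i u) (hu.1.pderivs [i]) (hu.2.pderiv hΛ hu.1 i) X hX fun l hl => ?_
        have := hX' (l ++ [i]) (by simp [hl]; omega)
        rwa [pderivs_append] at this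
      · rw [Real.mul_rpow hD.le hX.le]; norm_num; ring_nf
  · have hqt : q ≠ ⊤ := by
      rintro rfl
      have hp0 := recip_nonneg p
      rw [h, recip_top, zero_mul, add_zero] at hp0
      have h1 := nonneg_of_mul_nonneg_left hp0 hθ0
      linarith
    have hm0 : (0 : ℝ) < m := by linarith
    obtain ⟨s, hs, hse⟩ := exists_recip_eq (t := recip r / m) (div_nonneg (recip_nonneg r) hm0.le)
      (by rw [div_le_one hm0]; linarith)
    have hs3 : 3 * recip s < 1 := by
      rw [hse, mul_div_assoc', div_lt_one hm0]; linarith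
    exact GNBound.of_supBound_of_recip_eq (fun Λ u h => h.1) hq hqt hp hθ (by linarith) (by rw [h]; ring)
      (SupBound.of_one (fun Λ u h => h.1) hm hq hqt hr hs hse (by linarith)
        (supBound_one_of_isMeanZero hq hs hqt hs3))

/-- Derivatives of order `j` reduce to order zero: the derivative itself is controlled on the line
between `(0, q)` and `(m, r)`, and it has `m - j` further derivatives in `L^r`. -/
theorem GNBound.of_order_zero {𝒦 : ℝ → (E3 → ℝ) → Prop} (h𝒦 : ∀ Λ u, 𝒦 Λ u → IsNice Λ u)
    (hd : ∀ Λ, 0 < Λ → ∀ u, 𝒦 Λ u → ∀ l, 𝒦 Λ (pderivs l u)) {κ : ℝ} {m j : ℕ} (hj : j < m)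
    {q q' r p : ℝ≥0∞} (hq : 1 ≤ q) (hq' : 1 ≤ q') (hr : 1 ≤ r) {θ : ℝ}
    (hqe : recip q' = (j : ℝ) / m * recip r + (1 - (j : ℝ) / m) * recip q)
    (h : GNBound 𝒦 κ (m - j) 0 q' r p ((m * θ - j) / (m - j))) : GNBound 𝒦 κ m j q r p θ := by
  obtain ⟨C, hC, hb⟩ := h
  obtain ⟨D, hD, hN⟩ := exists_eLpNorm_pderivs_le hj hq hr hq' hqe
  have hmj : (0 : ℝ) < m - j := by rw [sub_pos]; exact_mod_cast hj
  have hm0 : (0 : ℝ) < m := by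
    have : (0 : ℝ) ≤ j := by positivity
    linarith
  refine ⟨C * D ^ (1 - (m * θ - j) / (m - j)), by positivity, fun Λ hΛ u hu X Y hX hY hX' hY' l hl => ?_⟩
  have h1 := hN l hl Λ hΛ u (h𝒦 Λ u hu) X Y hX hY hX' hY'
  have h2 := hb Λ hΛ (pderivs l u) (hd Λ hΛ u hu l) X _ hX (by positivity) (fun l' hl' => by
    rw [← pderivs_append]; exact hX' _ (by simp [hl, hl']; omega)) h1 [] rfl
  refine h2.trans (le_of_eq ?_)
  congr 1
  obtain ⟨c, rfl⟩ := exists_exp_eq hC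
  obtain ⟨d, rfl⟩ := exists_exp_eq hD
  obtain ⟨w, rfl⟩ := exists_exp_eq hΛ
  obtain ⟨ξ, rfl⟩ := exists_exp_eq hX
  obtain ⟨η, rfl⟩ := exists_exp_eq hY
  simp only [← Real.exp_add, ← Real.exp_mul]
  congr 1
  rw [Nat.cast_sub hj.le]
  field_simp
  push_cast
  ring

/-- The exponent of the `j`-th derivatives in Nirenberg's inequality. -/
theorem exists_intermediate_exponent {m j : ℕ} (hj : j < m) {q r : ℝ≥0∞} (hq : 1 ≤ q) (hr : 1 ≤ r) :
    ∃ q' : ℝ≥0∞, 1 ≤ q' ∧ recip q' = (j : ℝ) / m * recip r + (1 - (j : ℝ) / m) * recip q := by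
  have hm0 : (0 : ℝ) < m := by exact_mod_cast (Nat.zero_le j).trans_lt hj
  have h1 : 0 ≤ (j : ℝ) / m := by positivity
  have h2 : 0 ≤ 1 - (j : ℝ) / m := by
    rw [sub_nonneg, div_le_one hm0]; exact_mod_cast hj.le
  have hr0 := recip_nonneg r
  have hq0 := recip_nonneg q
  exact exists_recip_eq (by positivity) (by nlinarith [recip_le_one hr, recip_le_one hq])

/-- The one-dimensional Gagliardo-Nirenberg inequality for functions of the first coordinate. -/
theorem gnBound_of_isLongitudinal {m j : ℕ} (hj : j < m) {q r p : ℝ≥0∞} (hq : 1 ≤ q) (hr : 1 ≤ r)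
    (hp : 1 ≤ p) {θ : ℝ} (h : GNRelation 1 m j q r p θ) (hd : ¬ GNDegenerate 1 m j q r θ) :
    GNBound LongitudinalClass 1 m j q r p θ := by
  obtain ⟨q', hq', hqe⟩ := exists_intermediate_exponent hj hq hr
  obtain ⟨h, hθ, hθ1⟩ := h
  have hmj : (0 : ℝ) < m - j := by rw [sub_pos]; exact_mod_cast hj
  have hj0 : (0 : ℝ) ≤ j := by positivity
  have hm0 : (0 : ℝ) < m := by linarith
  rw [div_le_iff₀ hm0] at hθ
  refine GNBound.of_order_zero (fun Λ u h => h.1) (fun Λ hΛ u hu l => ⟨hu.1.pderivs l, hu.2.pderivs l⟩) hj hq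
    hq' hr hqe (gnBound_zero_of_isLongitudinal (by omega) hq' hr hp (div_nonneg (by linarith) hmj.le) ?_ ?_)
  · rw [h, hqe, Nat.cast_sub hj.le]; push_cast; field_simp; ring
  -- `q' = ∞` and `r = 1` force `j = 0` and `q = ∞`
  · rintro ⟨rfl, hθ0, hm1, rfl⟩
    have e1 : recip 1 = 1 := by simp [recip]
    rw [recip_top, e1] at hqe
    have hq0 := recip_nonneg q
    have h2 : 0 < 1 - (j : ℝ) / m := by rw [sub_pos, div_lt_one hm0]; linarith
    have h3 : 0 ≤ (j : ℝ) / m := by positivity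
    have h4 : (j : ℝ) / m = 0 := by nlinarith [mul_nonneg h2.le hq0]
    have h5 : recip q = 0 := by rw [h4] at hqe; linarith
    have hj1 : j = 0 := by
      rw [div_eq_zero_iff] at h4
      exact_mod_cast h4.resolve_right hm0.ne'
    subst hj1
    refine hd ⟨rfl, recip_injective hq le_top (by rw [h5, recip_top]), ?_, Or.inl ⟨rfl, hm1, rfl⟩⟩
    have := (div_pos_iff_of_pos_right hmj).1 hθ0
    push_cast at this
    rw [sub_zero] at this
    exact pos_of_mul_pos_right this hm0.le

/-- The three-dimensional Gagliardo-Nirenberg inequality for functions with vanishing transverse mean. -/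
theorem gnBound_of_isMeanZero {m j : ℕ} (hj : j < m) {q r p : ℝ≥0∞} (hq : 1 ≤ q) (hr : 1 ≤ r)
    (hp : 1 ≤ p) {θ : ℝ} (h : GNRelation 3 m j q r p θ) (hc : ¬ GNCritical m j r θ)
    (hd : ¬ GNDegenerate 3 m j q r θ) :
    GNBound MeanZeroClass (1 / 3) m j q r p θ := by
  obtain ⟨q', hq', hqe⟩ := exists_intermediate_exponent hj hq hr
  obtain ⟨h, hθ, hθ1⟩ := h
  have hmj : (0 : ℝ) < m - j := by rw [sub_pos]; exact_mod_cast hj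
  have hj0 : (0 : ℝ) ≤ j := by positivity
  have hm0 : (0 : ℝ) < m := by linarith
  rw [div_le_iff₀ hm0] at hθ
  refine GNBound.of_order_zero (fun Λ u h => h.1)
    (fun Λ hΛ u hu l => ⟨hu.1.pderivs l, hu.2.pderivs hΛ hu.1 l⟩) hj hq
    hq' hr hqe (gnBound_zero_of_isMeanZero (by omega) hq' hr hp (div_nonneg (by linarith) hmj.le) ?_ ?_ ?_ ?_)
  · rw [div_le_one hmj]; nlinarith
  · rw [h, hqe, Nat.cast_sub hj.le]; push_cast; field_simp; ring
  · rintro ⟨hθ', hr1, hm3⟩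
    rw [Nat.cast_sub hj.le] at hm3
    rw [div_eq_one_iff_eq hmj.ne'] at hθ'
    refine hc ⟨?_, hr1, lt_top_iff_ne_top.2 ?_, 0, by push_cast; linarith⟩
    · exact mul_left_cancel₀ hm0.ne' (by linarith)
    · rintro rfl
      rw [recip_top] at hm3; linarith
  -- `q' = ∞` and `r < ∞` force `j = 0` and `q = ∞`
  · rintro ⟨rfl, hθ0, hr1, hm3⟩
    rw [Nat.cast_sub hj.le] at hm3
    rw [recip_top] at hqe
    have hq0 := recip_nonneg q
    have hr0 : 0 < recip r := by linarith
    have h2 : 0 < 1 - (j : ℝ) / m := by rw [sub_pos, div_lt_one hm0]; linarith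
    have h3 : 0 ≤ (j : ℝ) / m := by positivity
    have h4 : (j : ℝ) / m * recip r = 0 := by nlinarith [mul_nonneg h2.le hq0, mul_nonneg h3 hr0.le]
    have h5 : recip q = 0 := by
      rw [h4, zero_add] at hqe
      exact (mul_eq_zero.1 hqe.symm).resolve_left h2.ne'
    have hj1 : j = 0 := by
      rw [mul_eq_zero, div_eq_zero_iff] at h4
      exact_mod_cast (h4.resolve_right hr0.ne').resolve_right hm0.ne'
    subst hj1
    refine hd ⟨rfl, recip_injective hq le_top (by rw [h5, recip_top]), ?_, Or.inr ⟨rfl, hr1, by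
      push_cast at hm3; linarith⟩⟩
    have := (div_pos_iff_of_pos_right hmj).1 hθ0
    push_cast at this
    rw [sub_zero] at this
    exact pos_of_mul_pos_right this hm0.le

/-! ### The transverse mean of a smooth function -/

theorem IsNice.aestronglyMeasurable_shift {Λ : ℝ} {u : E3 → ℝ} (hn : IsNice Λ u) (x : E3) (ν : Measure (ℝ × ℝ)) :
    AEStronglyMeasurable (fun s => u (x + transShift s)) ν :=
  (hn.stronglyMeasurable.comp_measurable (measurable_transShift.const_add x)).aestronglyMeasurable

theorem IsNice.integrable_shift {Λ : ℝ} (hΛ : 0 < Λ) {u : E3 → ℝ} (hn : IsNice Λ u) (x : E3) :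
    Integrable (fun s => u (x + transShift s)) (transMeasure Λ) := by
  have := isProbabilityMeasure_transMeasure hΛ
  obtain ⟨M, hM⟩ := hn.bounded []
  exact Integrable.of_bound (hn.aestronglyMeasurable_shift x _) M (Filter.Eventually.of_forall fun s => hM _)

theorem IsNice.hasFDerivAt_transMean {Λ : ℝ} (hΛ : 0 < Λ) {u : E3 → ℝ} (hn : IsNice Λ u) (x : E3) :
    HasFDerivAt (transMean Λ u) (∫ s, fderiv ℝ u (x + transShift s) ∂(transMeasure Λ)) x := by
  have := isProbabilityMeasure_transMeasure hΛ
  choose K hK using fun i : Fin 3 => hn.bounded [i]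
  have hd : Continuous (fderiv ℝ u) := hn.smooth.continuous_fderiv (by simp)
  refine hasFDerivAt_integral_of_dominated_of_fderiv_le (s := Set.univ) (bound := fun _ => K 0 + K 1 + K 2)
    (F' := fun x s => fderiv ℝ u (x + transShift s))
    Filter.univ_mem (Filter.Eventually.of_forall fun y => hn.aestronglyMeasurable_shift y _)
    (hn.integrable_shift hΛ x) ?_ (Filter.Eventually.of_forall fun s y _ => ?_) (integrable_const _)
    (Filter.Eventually.of_forall fun s y _ => ?_)
  · exact (hd.stronglyMeasurable.comp_measurable (measurable_transShift.const_add x)).aestronglyMeasurable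
  · refine (norm_fderiv_le_sum u _).trans (add_le_add (add_le_add (hK 0 _) (hK 1 _)) (hK 2 _))
  · have h1 : HasFDerivAt u (fderiv ℝ u (y + transShift s)) (y + transShift s) :=
      (hn.smooth.differentiable (by simp) _).hasFDerivAt
    simpa using! h1.comp y ((hasFDerivAt_id y).add_const (transShift s))

theorem IsNice.fderiv_transMean_apply {Λ : ℝ} (hΛ : 0 < Λ) {u : E3 → ℝ} (hn : IsNice Λ u) (x y : E3) :
    fderiv ℝ (transMean Λ u) x y = y 0 * transMean Λ (pderiv 0 u) x + y 1 * transMean Λ (pderiv 1 u) x +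
      y 2 * transMean Λ (pderiv 2 u) x := by
  have := isProbabilityMeasure_transMeasure hΛ
  choose K hK using fun i : Fin 3 => hn.bounded [i]
  have hd : Continuous (fderiv ℝ u) := hn.smooth.continuous_fderiv (by simp)
  have hint : Integrable (fun s => fderiv ℝ u (x + transShift s)) (transMeasure Λ) :=
    Integrable.of_bound
      (hd.stronglyMeasurable.comp_measurable (measurable_transShift.const_add x)).aestronglyMeasurable
      (K 0 + K 1 + K 2) (Filter.Eventually.of_forall fun s =>
        (norm_fderiv_le_sum u _).trans (add_le_add (add_le_add (hK 0 _) (hK 1 _)) (hK 2 _)))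
  have hi (i : Fin 3) : Integrable (fun s => pderiv i u (x + transShift s)) (transMeasure Λ) :=
    (hn.pderivs [i]).integrable_shift hΛ x
  rw [(hn.hasFDerivAt_transMean hΛ x).fderiv, ContinuousLinearMap.integral_apply hint]
  simp only [fderiv_apply_eq]
  have e1 := integral_add (((hi 0).const_mul (y 0)).add ((hi 1).const_mul (y 1))) ((hi 2).const_mul (y 2))
  have e2 := integral_add ((hi 0).const_mul (y 0)) ((hi 1).const_mul (y 1))
  simp only [integral_const_mul] at e1 e2
  refine e1.trans (congrArg₂ _ e2 rfl)

theorem IsNice.pderiv_transMean {Λ : ℝ} (hΛ : 0 < Λ) {u : E3 → ℝ} (hn : IsNice Λ u) (i : Fin 3) :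
    pderiv i (transMean Λ u) = transMean Λ (pderiv i u) := by
  funext x
  rw [pderiv, hn.fderiv_transMean_apply hΛ]
  fin_cases i <;> simp

/-- Taking the transverse mean commutes with differentiation. -/
theorem IsNice.pderivs_transMean {Λ : ℝ} (hΛ : 0 < Λ) {u : E3 → ℝ} (hn : IsNice Λ u) (l : List (Fin 3)) :
    _root_.pderivs l (_root_.transMean Λ u) = _root_.transMean Λ (_root_.pderivs l u) := by
  induction l with
  | nil => rfl
  | cons i l ih => rw [_root_.pderivs, ih, (hn.pderivs l).pderiv_transMean hΛ]; rfl

theorem IsNice.contDiff_transMean {Λ : ℝ} (hΛ : 0 < Λ) {u : E3 → ℝ} (hn : IsNice Λ u) :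
    ContDiff ℝ ∞ (transMean Λ u) := by
  rw [contDiff_infty]
  intro n
  induction n generalizing u with
  | zero =>
    rw [Nat.cast_zero, contDiff_zero]
    exact continuous_iff_continuousAt.2 fun x => (hn.hasFDerivAt_transMean hΛ x).continuousAt
  | succ n ih =>
    rw [Nat.cast_succ, contDiff_succ_iff_fderiv_apply]
    refine ⟨fun x => (hn.hasFDerivAt_transMean hΛ x).differentiableAt, by simp, fun y => ?_⟩
    simp only [hn.fderiv_transMean_apply hΛ]
    have h (i : Fin 3) : ContDiff ℝ n (transMean Λ (pderiv i u)) := ih (hn.pderivs [i])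
    exact ((contDiff_const.mul (h 0)).add (contDiff_const.mul (h 1))).add (contDiff_const.mul (h 2))

theorem abs_transMean_le {Λ : ℝ} (hΛ : 0 < Λ) {u : E3 → ℝ} {M : ℝ} (hM : ∀ x, |u x| ≤ M) (x : E3) :
    |transMean Λ u x| ≤ M := by
  have := isProbabilityMeasure_transMeasure hΛ
  have h := norm_integral_le_of_norm_le_const (μ := transMeasure Λ) (f := fun s => u (x + transShift s))
    (C := M) (Filter.Eventually.of_forall fun s => hM _)
  simpa using! h

theorem isTransPeriodic_transMean {Λ : ℝ} {u : E3 → ℝ} (hu : IsTransPeriodic Λ u) :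
    IsTransPeriodic Λ (transMean Λ u) := by
  intro x
  simp only [transMean, add_right_comm x]
  exact ⟨by simp only [(hu _).1], by simp only [(hu _).2]⟩

theorem IsNice.transMean {Λ : ℝ} (hΛ : 0 < Λ) {u : E3 → ℝ} (hn : IsNice Λ u) : IsNice Λ (_root_.transMean Λ u) where
  smooth := hn.contDiff_transMean hΛ
  periodic := isTransPeriodic_transMean hn.periodic
  bounded l := by
    obtain ⟨M, hM⟩ := hn.bounded l
    rw [hn.pderivs_transMean hΛ]
    exact ⟨M, abs_transMean_le hΛ hM⟩

theorem pderivs_sub {u v : E3 → ℝ} (hu : ContDiff ℝ ∞ u) (hv : ContDiff ℝ ∞ v) (l : List (Fin 3)) :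
    pderivs l (fun x => u x - v x) = fun x => pderivs l u x - pderivs l v x := by
  induction l with
  | nil => rfl
  | cons i l ih =>
    simp only [pderivs]
    rw [ih]
    funext x
    simp only [pderiv]
    rw [fderiv_fun_sub ((contDiff_pderivs hu l).differentiable (by simp) x)
      ((contDiff_pderivs hv l).differentiable (by simp) x)]
    rfl

theorem IsNice.sub {Λ : ℝ} {u v : E3 → ℝ} (hu : IsNice Λ u) (hv : IsNice Λ v) :
    IsNice Λ fun x => u x - v x where
  smooth := hu.smooth.sub hv.smooth
  periodic x := by
    simp only [(hu.periodic x).1, (hu.periodic x).2, (hv.periodic x).1, (hv.periodic x).2, and_self]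
  bounded l := by
    obtain ⟨M, hM⟩ := hu.bounded l
    obtain ⟨K, hK⟩ := hv.bounded l
    refine ⟨M + K, fun x => ?_⟩
    rw [pderivs_sub hu.smooth hv.smooth]
    exact (abs_sub _ _).trans (add_le_add (hM x) (hK x))

/-- The integral of a doubly periodic function over a period square is invariant under translations. -/
theorem setIntegral_square_add {Λ : ℝ} (hΛ : 0 < Λ) {g : ℝ × ℝ → ℝ} (hg : Continuous g)
    (h1 : ∀ a b, g (a + Λ, b) = g (a, b)) (h2 : ∀ a b, g (a, b + Λ) = g (a, b)) (c : ℝ × ℝ) :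
    ∫ z in Set.Icc 0 Λ ×ˢ Set.Icc 0 Λ, g (z + c) = ∫ z in Set.Icc 0 Λ ×ˢ Set.Icc 0 Λ, g z := by
  have hint (f : ℝ × ℝ → ℝ) (hf : Continuous f) : ∫ z in Set.Icc 0 Λ ×ˢ Set.Icc 0 Λ, f z =
      ∫ a in (0 : ℝ)..Λ, ∫ b in (0 : ℝ)..Λ, f (a, b) := by
    rw [Measure.volume_eq_prod, setIntegral_prod _
      (hf.continuousOn.integrableOn_compact (isCompact_Icc.prod isCompact_Icc))]
    simp only [integral_Icc_eq_integral_Ioc, intervalIntegral.integral_of_le hΛ.le]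
  rw [hint _ (by fun_prop), hint _ hg]
  have hb (a : ℝ) : ∫ b in (0 : ℝ)..Λ, g ((a, b) + c) = ∫ b in (0 : ℝ)..Λ, g (a + c.1, b) := by
    have hp : Function.Periodic (fun b => g (a + c.1, b)) Λ := fun b => h2 _ _
    have e1 : ∫ b in (0 : ℝ)..Λ, g ((a, b) + c) = ∫ b in (0 + c.2)..(Λ + c.2), g (a + c.1, b) :=
      intervalIntegral.integral_comp_add_right (fun b => g (a + c.1, b)) c.2
    rw [e1, zero_add, add_comm Λ]
    simpa using hp.intervalIntegral_add_eq c.2 0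
  simp only [hb]
  have hp : Function.Periodic (fun a => ∫ b in (0 : ℝ)..Λ, g (a, b)) Λ := fun a => by simp only [h1]
  have e1 : ∫ a in (0 : ℝ)..Λ, ∫ b in (0 : ℝ)..Λ, g (a + c.1, b) =
      ∫ a in (0 + c.1)..(Λ + c.1), ∫ b in (0 : ℝ)..Λ, g (a, b) :=
    intervalIntegral.integral_comp_add_right (fun a => ∫ b in (0 : ℝ)..Λ, g (a, b)) c.1
  rw [e1, zero_add, add_comm Λ]
  simpa using hp.intervalIntegral_add_eq c.1 0

theorem IsNice.isLongitudinal_transMean {Λ : ℝ} (hΛ : 0 < Λ) {u : E3 → ℝ} (hn : IsNice Λ u) :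
    IsLongitudinal (_root_.transMean Λ u) := by
  intro x c
  have hc : Continuous fun z : ℝ × ℝ => u (x + transShift z) :=
    hn.smooth.continuous.comp (by unfold transShift; fun_prop)
  have h := setIntegral_square_add hΛ hc
    (fun a b => by
      have := (hn.periodic (x + transShift (a, b))).1
      rw [← this]; congr 1; simp only [transShift, add_smul]; abel)
    (fun a b => by
      have := (hn.periodic (x + transShift (a, b))).2
      rw [← this]; congr 1; simp only [transShift, add_smul]; abel) c
  simp only [_root_.transMean, transMeasure, ProbabilityTheory.cond, integral_smul_measure]
  rw [← h]
  congr 1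
  refine integral_congr_ae (Filter.Eventually.of_forall fun z => ?_)
  change u _ = u _
  congr 1; simp only [transShift, Prod.fst_add, Prod.snd_add, add_smul]; abel

theorem IsNice.longitudinalClass_transMean {Λ : ℝ} (hΛ : 0 < Λ) {u : E3 → ℝ} (hn : IsNice Λ u) :
    LongitudinalClass Λ (_root_.transMean Λ u) :=
  ⟨hn.transMean hΛ, hn.isLongitudinal_transMean hΛ⟩

theorem IsNice.meanZeroClass_sub_transMean {Λ : ℝ} (hΛ : 0 < Λ) {u : E3 → ℝ} (hn : IsNice Λ u) :
    MeanZeroClass Λ fun x => u x - _root_.transMean Λ u x := by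
  refine ⟨hn.sub (hn.transMean hΛ), fun x => ?_⟩
  have := isProbabilityMeasure_transMeasure hΛ
  rw [_root_.transMean, integral_sub (hn.integrable_shift hΛ x) ((hn.transMean hΛ).integrable_shift hΛ x)]
  simp only [(hn.isLongitudinal_transMean hΛ) x]
  rw [integral_const, probReal_univ, one_smul, sub_eq_zero]
  rfl

theorem enorm_transMean_le (Λ : ℝ) (u : E3 → ℝ) (x : E3) :
    ‖transMean Λ u x‖ₑ ≤ ∫⁻ s, ‖u (x + transShift s)‖ₑ ∂(transMeasure Λ) :=
  enorm_integral_le_lintegral_enorm _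

theorem eLpNorm_transMean_le {Λ : ℝ} (hΛ : 0 < Λ) {u : E3 → ℝ} (hn : IsNice Λ u) {p : ℝ≥0∞} (hp : 1 ≤ p) :
    eLpNorm (transMean Λ u) p (cellMeasure Λ) ≤ eLpNorm u p (cellMeasure Λ) := by
  have := isProbabilityMeasure_transMeasure hΛ
  exact eLpNorm_cell_le_of_le_average hΛ hp hn.periodic hn.stronglyMeasurable (transMeasure Λ)
    measurable_transShift (enorm_transMean_le Λ u)

theorem eLpNorm_sub_transMean_le {Λ : ℝ} (hΛ : 0 < Λ) {u : E3 → ℝ} (hn : IsNice Λ u) {p : ℝ≥0∞} (hp : 1 ≤ p)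
    {X : ℝ} (h : eLpNorm u p (cellMeasure Λ) ≤ ENNReal.ofReal X) :
    eLpNorm (fun x => u x - transMean Λ u x) p (cellMeasure Λ) ≤ ENNReal.ofReal (2 * X) := by
  refine (eLpNorm_sub_le hn.stronglyMeasurable.aestronglyMeasurable
    (hn.transMean hΛ).stronglyMeasurable.aestronglyMeasurable hp).trans ?_
  rw [ENNReal.ofReal_mul zero_le_two, ENNReal.ofReal_ofNat, two_mul]
  exact add_le_add h ((eLpNorm_transMean_le hΛ hn hp).trans h)

/-! ### Local estimates -/

/-- The `L¹` norm over the ball of radius `R` around the origin. -/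
noncomputable def ballNorm (R : ℝ) (f : E3 → ℝ) : ℝ≥0∞ := ∫⁻ x in Metric.closedBall 0 R, ‖f x‖ₑ

theorem ballNorm_mono {R R' : ℝ} (h : R ≤ R') (f : E3 → ℝ) : ballNorm R f ≤ ballNorm R' f :=
  lintegral_mono_set (Metric.closedBall_subset_closedBall h)

/-- Averaging over translations by vectors of length at most `d` does not increase the `L¹`
norm, provided that the radius of the ball is enlarged by `d`. -/
theorem setLIntegral_ball_average_le {F : E3 → ℝ≥0∞} (hF : Measurable F) {S : Type*} [MeasurableSpace S]
    (ν : Measure S) [IsProbabilityMeasure ν] {τ : S → E3} (hτ : Measurable τ) {d : ℝ}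
    (hd : ∀ᵐ s ∂ν, ‖τ s‖ ≤ d) (R : ℝ) :
    ∫⁻ x in Metric.closedBall (0 : E3) R, ∫⁻ s, F (x + τ s) ∂ν ≤ ∫⁻ x in Metric.closedBall (0 : E3) (R + d), F x := by
  rw [lintegral_lintegral_swap (by exact (hF.comp (by fun_prop)).aemeasurable)]
  calc ∫⁻ s, (∫⁻ x in Metric.closedBall (0 : E3) R, F (x + τ s)) ∂ν
      ≤ ∫⁻ _, (∫⁻ x in Metric.closedBall (0 : E3) (R + d), F x) ∂ν := by
        refine lintegral_mono_ae ?_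
        filter_upwards [hd] with s hs
        rw [← lintegral_indicator measurableSet_closedBall, ← lintegral_indicator measurableSet_closedBall,
          ← lintegral_add_right_eq_self ((Metric.closedBall (0 : E3) (R + d)).indicator F) (τ s)]
        refine lintegral_mono fun x => ?_
        by_cases hx : x ∈ Metric.closedBall (0 : E3) R
        · have hx' : x + τ s ∈ Metric.closedBall (0 : E3) (R + d) := by
            rw [mem_closedBall_zero_iff] at hx ⊢
            exact (norm_add_le _ _).trans (add_le_add hx hs)
          rw [Set.indicator_of_mem hx, Set.indicator_of_mem hx']
        · rw [Set.indicator_of_notMem hx]; exact zero_le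
    _ = _ := by simp

theorem norm_transShift_le {Λ : ℝ} {s : ℝ × ℝ} (h : s.1 ∈ Set.Icc 0 Λ ∧ s.2 ∈ Set.Icc 0 Λ) :
    ‖transShift s‖ ≤ 2 * Λ := by
  refine (norm_le_sum_abs _).trans ?_
  rw [transShift_apply_zero, transShift_apply_one, transShift_apply_two, abs_zero, abs_of_nonneg h.1.1,
    abs_of_nonneg h.2.1]
  linarith [h.1.2, h.2.2]

theorem ballNorm_transMean_le {Λ : ℝ} (hΛ : 0 < Λ) {f : E3 → ℝ} (hf : Measurable f) (R : ℝ) :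
    ballNorm R (transMean Λ f) ≤ ballNorm (R + 2 * Λ) f := by
  have := isProbabilityMeasure_transMeasure hΛ
  refine (lintegral_mono fun x => enorm_transMean_le Λ f x).trans ?_
  exact setLIntegral_ball_average_le hf.enorm (transMeasure Λ) measurable_transShift
    ((ae_transMeasure_mem Λ).mono fun s hs => norm_transShift_le hs) R

/-- Integration of the one-dimensional estimate over all segments of length one in direction `i` that start
in the ball. -/
theorem exists_ballNorm_pderiv_le {k : ℕ} (hk : 1 < k) : ∃ C : ℝ≥0, ∀ f : E3 → ℝ, ContDiff ℝ ∞ f →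
    ∀ (i : Fin 3) (R : ℝ), ballNorm R (pderiv i f) ≤
      C * (ballNorm (R + 1) f + ballNorm (R + 1) (pderivs (List.replicate k i) f)) := by
  obtain ⟨C, hC, h⟩ := exists_iteratedDeriv_zero_le hk
  refine ⟨C.toNNReal, fun f hf i R => ?_⟩
  have hI : IsProbabilityMeasure (volume.restrict (Set.Icc (0 : ℝ) 1)) := ⟨by simp⟩
  have hcont (g : E3 → ℝ) (hg : ContDiff ℝ ∞ g) (x : E3) : Continuous fun t : ℝ => g (x + t • stdBasis3 i) :=
    hg.continuous.comp (by fun_prop)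
  have hk' := contDiff_pderivs hf (List.replicate k i)
  have hof (g : E3 → ℝ) (hg : ContDiff ℝ ∞ g) (x : E3) : ENNReal.ofReal (∫ t in (0 : ℝ)..1,
      |g (x + t • stdBasis3 i)|) = ∫⁻ t in Set.Icc (0 : ℝ) 1, ‖g (x + t • stdBasis3 i)‖ₑ := by
    rw [intervalIntegral.integral_of_le zero_le_one, ← integral_Icc_eq_integral_Ioc]
    have := ofReal_integral_norm_eq_lintegral_enorm (μ := volume.restrict (Set.Icc (0 : ℝ) 1))
      (f := fun t : ℝ => g (x + t • stdBasis3 i)) ((hcont g hg x).integrableOn_Icc)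
    simpa only [Real.norm_eq_abs] using this
  have hpt : ∀ x, ‖pderiv i f x‖ₑ ≤ C.toNNReal * ((∫⁻ t in Set.Icc (0 : ℝ) 1, ‖f (x + t • stdBasis3 i)‖ₑ) +
      ∫⁻ t in Set.Icc (0 : ℝ) 1, ‖pderivs (List.replicate k i) f (x + t • stdBasis3 i)‖ₑ) := by
    intro x
    have h1 := h _ (contDiff_line hf i x)
    rw [iteratedDeriv_line hf, iteratedDeriv_line hf] at h1
    simp only [zero_smul, add_zero] at h1
    have hnn (g : E3 → ℝ) : 0 ≤ ∫ t in (0 : ℝ)..1, |g (x + t • stdBasis3 i)| :=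
      intervalIntegral.integral_nonneg zero_le_one fun t _ => abs_nonneg _
    rw [← hof f hf, ← hof _ hk', ← ENNReal.ofReal_add (hnn _) (hnn _), Real.enorm_eq_ofReal_abs]
    change _ ≤ ENNReal.ofReal C * _
    rw [← ENNReal.ofReal_mul hC.le]
    exact ENNReal.ofReal_le_ofReal h1
  have hme (g : E3 → ℝ) (hg : ContDiff ℝ ∞ g) :
      Measurable fun x => ∫⁻ t in Set.Icc (0 : ℝ) 1, ‖g (x + t • stdBasis3 i)‖ₑ := by
    have : Continuous fun z : E3 × ℝ => g (z.1 + z.2 • stdBasis3 i) := hg.continuous.comp (by fun_prop)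
    exact this.measurable.enorm.lintegral_prod_right'
  have hav (g : E3 → ℝ) (hg : ContDiff ℝ ∞ g) : ∫⁻ x in Metric.closedBall (0 : E3) R,
      ∫⁻ t in Set.Icc (0 : ℝ) 1, ‖g (x + t • stdBasis3 i)‖ₑ ≤ ballNorm (R + 1) g := by
    refine setLIntegral_ball_average_le (F := fun x => ‖g x‖ₑ) hg.continuous.measurable.enorm
      (volume.restrict (Set.Icc (0 : ℝ) 1)) (τ := fun t => t • stdBasis3 i) (by fun_prop) ?_ R
    filter_upwards [ae_restrict_mem measurableSet_Icc] with t ht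
    rw [norm_smul, Real.norm_eq_abs, abs_of_nonneg ht.1]
    simpa [stdBasis3] using ht.2
  calc ballNorm R (pderiv i f) ≤ _ := lintegral_mono hpt
    _ ≤ _ := by
      rw [lintegral_const_mul' _ _ ENNReal.coe_ne_top, lintegral_add_left (hme f hf)]
      gcongr
      · exact hav f hf
      · exact hav _ hk'

/-- Intermediate derivatives are locally controlled by those of order `0` and `m`. -/
theorem exists_ballNorm_pderivs_le {m j : ℕ} (hj : j < m) : ∃ C : ℝ≥0, ∀ f : E3 → ℝ, ContDiff ℝ ∞ f →
    ∀ (l : List (Fin 3)), l.length = j → ∀ R : ℝ, ballNorm R (pderivs l f) ≤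
      C * (ballNorm (R + j) f + ∑ I : Fin m → Fin 3, ballNorm (R + j) (pderivs (List.ofFn I) f)) := by
  induction j with
  | zero =>
    refine ⟨1, fun f hf l hl R => ?_⟩
    obtain rfl := List.length_eq_zero_iff.1 hl
    simp [pderivs]
  | succ j ih =>
    obtain ⟨C, hC⟩ := ih (by omega)
    obtain ⟨D, hD⟩ := exists_ballNorm_pderiv_le (k := m - j) (by omega)
    refine ⟨D * (C + 1), fun f hf l hl R => ?_⟩
    obtain ⟨i, l, rfl⟩ := List.exists_cons_of_length_eq_add_one hl
    have hl' : l.length = j := by simpa using hl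
    have h1 := hD _ (contDiff_pderivs hf l) i R
    have h2 := hC f hf l hl' (R + 1)
    have e : R + 1 + (j : ℝ) = R + ((j + 1 : ℕ) : ℝ) := by push_cast; ring
    rw [e] at h2
    set S := ballNorm (R + ((j + 1 : ℕ) : ℝ)) f +
      ∑ I : Fin m → Fin 3, ballNorm (R + ((j + 1 : ℕ) : ℝ)) (pderivs (List.ofFn I) f) with hS
    have h3 : ballNorm (R + 1) (pderivs (List.replicate (m - j) i) (pderivs l f)) ≤ S := by
      rw [← pderivs_append]
      have hlen : (List.replicate (m - j) i ++ l).length = m := by simp [hl']; omega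
      obtain ⟨I, hI⟩ : ∃ I : Fin m → Fin 3, List.ofFn I = List.replicate (m - j) i ++ l := by
        generalize List.replicate (m - j) i ++ l = l₀ at hlen
        subst hlen; exact ⟨_, List.ofFn_get _⟩
      rw [← hI]
      refine (ballNorm_mono (R' := R + ((j + 1 : ℕ) : ℝ)) (by push_cast; linarith [j.cast_nonneg (α := ℝ)]) _).trans ?_
      refine le_trans ?_ (le_add_left le_rfl)
      exact Finset.single_le_sum (f := fun I : Fin m → Fin 3 => ballNorm (R + ((j + 1 : ℕ) : ℝ))
        (pderivs (List.ofFn I) f)) (fun _ _ => zero_le) (Finset.mem_univ I)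
    calc ballNorm R (pderivs (i :: l) f) ≤ D * (C * S + S) := h1.trans (by gcongr)
      _ = _ := by push_cast; ring

/-! ### Integration by parts -/

theorem hasCompactSupport_pderivs {φ : E3 → ℝ} (hφ : HasCompactSupport φ) (l : List (Fin 3)) :
    HasCompactSupport (pderivs l φ) := by
  induction l with
  | nil => exact hφ
  | cons i l ih => exact ih.fderiv_apply (𝕜 := ℝ) _

theorem integral_mul_pderiv {f φ : E3 → ℝ} (hf : ContDiff ℝ ∞ f) (hφ : ContDiff ℝ ∞ φ)
    (hc : HasCompactSupport φ) (i : Fin 3) :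
    ∫ x, f x * pderiv i φ x = -∫ x, pderiv i f x * φ x := by
  have hd := contDiff_pderiv hf i
  have hd' := contDiff_pderiv hφ i
  exact integral_mul_fderiv_eq_neg_fderiv_mul_of_integrable
    ((hd.continuous.mul hφ.continuous).integrable_of_hasCompactSupport hc.mul_left)
    ((hf.continuous.mul hd'.continuous).integrable_of_hasCompactSupport
      (hasCompactSupport_pderivs hc [i]).mul_left)
    ((hf.continuous.mul hφ.continuous).integrable_of_hasCompactSupport hc.mul_left)
    (fun x _ => hf.differentiable (by simp) x) (fun x _ => hφ.differentiable (by simp) x)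

theorem integral_mul_pderivs {f φ : E3 → ℝ} (hf : ContDiff ℝ ∞ f) (hφ : ContDiff ℝ ∞ φ)
    (hc : HasCompactSupport φ) (l : List (Fin 3)) :
    ∫ x, f x * pderivs l φ x = (-1) ^ l.length * ∫ x, pderivs l f x * φ x := by
  induction l generalizing f with
  | nil => simp [pderivs]
  | cons i l ih =>
    simp only [pderivs, List.length_cons]
    rw [integral_mul_pderiv hf (contDiff_pderivs hφ l) (hasCompactSupport_pderivs hc l) i,
      ih (contDiff_pderiv hf i), pow_succ]
    have : pderivs l (pderiv i f) = pderiv i (pderivs l f) := by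
      have := pderivs_perm hf (List.perm_append_singleton i l)
      rwa [pderivs_append] at this
    rw [this]; ring

/-! ### Local `L¹` convergence -/

/-- Convergence in `L¹` on all balls. -/
def LocTendsto (f : ℕ → E3 → ℝ) (g : E3 → ℝ) : Prop :=
  ∀ R : ℝ, Filter.Tendsto (fun n => ballNorm R fun x => f n x - g x) Filter.atTop (nhds 0)

/-- The Cauchy property in `L¹` on all balls. -/
def LocCauchy (f : ℕ → E3 → ℝ) : Prop :=
  ∀ R : ℝ, Filter.Tendsto (fun p : ℕ × ℕ => ballNorm R fun x => f p.1 x - f p.2 x) Filter.atTop (nhds 0)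

theorem ballNorm_add_le {f g : E3 → ℝ} (hf : AEStronglyMeasurable f) (R : ℝ) :
    ballNorm R (fun x => f x + g x) ≤ ballNorm R f + ballNorm R g := by
  unfold ballNorm
  rw [← lintegral_add_left' hf.enorm.restrict]
  exact lintegral_mono fun x => enorm_add_le _ _

theorem ballNorm_sub_comm (f g : E3 → ℝ) (R : ℝ) :
    ballNorm R (fun x => f x - g x) = ballNorm R fun x => g x - f x :=
  lintegral_congr fun _ => enorm_sub_rev _ _

theorem ballNorm_sub_le {f g h : E3 → ℝ} (hf : AEStronglyMeasurable f) (hg : AEStronglyMeasurable g) (R : ℝ) :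
    ballNorm R (fun x => f x - h x) ≤ ballNorm R (fun x => f x - g x) + ballNorm R fun x => h x - g x := by
  rw [ballNorm_sub_comm h g]
  refine le_trans (le_of_eq ?_) (ballNorm_add_le (hf.sub hg) R)
  congr 1; funext x; simp

theorem LocTendsto.locCauchy {f : ℕ → E3 → ℝ} {g : E3 → ℝ} (hf : ∀ n, AEStronglyMeasurable (f n))
    (hg : AEStronglyMeasurable g) (h : LocTendsto f g) : LocCauchy f := by
  intro R
  have h1 : Filter.Tendsto (fun p : ℕ × ℕ => (ballNorm R fun x => f p.1 x - g x) +
      ballNorm R fun x => f p.2 x - g x) Filter.atTop (nhds (0 + 0)) := by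
    rw [← Filter.prod_atTop_atTop_eq]
    exact ((h R).comp Filter.tendsto_fst).add ((h R).comp Filter.tendsto_snd)
  rw [add_zero] at h1
  exact tendsto_of_tendsto_of_tendsto_of_le_of_le tendsto_const_nhds h1 (fun _ => zero_le)
    fun p => ballNorm_sub_le (hf _) hg R

theorem ballNorm_eq_eLpNorm (R : ℝ) (f : E3 → ℝ) :
    ballNorm R f = eLpNorm f 1 (volume.restrict (Metric.closedBall 0 R)) := by
  rw [eLpNorm_one_eq_lintegral_enorm]; rfl

/-- Completeness: the limits on the balls of integer radius are compatible and define one function. -/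
theorem LocCauchy.exists_locTendsto {f : ℕ → E3 → ℝ} (hf : ∀ n, LocallyIntegrable (f n)) (h : LocCauchy f) :
    ∃ g, LocallyIntegrable g ∧ LocTendsto f g := by
  have hball (N : ℕ) : ∃ g : E3 → ℝ, MemLp g 1 (volume.restrict (Metric.closedBall 0 (N : ℝ))) ∧
      Filter.Tendsto (fun n => ballNorm N fun x => f n x - g x) Filter.atTop (nhds 0) := by
    set μ := (volume : Measure E3).restrict (Metric.closedBall 0 (N : ℝ)) with hμ
    have hm (n : ℕ) : MemLp (f n) 1 μ :=
      memLp_one_iff_integrable.2 ((hf n).integrableOn_isCompact (isCompact_closedBall _ _))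
    have hc : CauchySeq fun n => (hm n).toLp (f n) := by
      rw [Lp.cauchySeq_Lp_iff_cauchySeq_eLpNorm]
      refine (h N).congr fun p => ?_
      rw [ballNorm_eq_eLpNorm]
      refine eLpNorm_congr_ae ?_
      filter_upwards [(hm p.1).coeFn_toLp, (hm p.2).coeFn_toLp] with x h1 h2
      simp [h1, h2]
    obtain ⟨G, hG⟩ := cauchySeq_tendsto_of_complete hc
    refine ⟨G, Lp.memLp G, ?_⟩
    have h2 : Filter.Tendsto (fun n => (hm n).toLp (f n)) Filter.atTop (nhds ((Lp.memLp G).toLp G)) := by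
      rwa [Lp.toLp_coeFn]
    rw [Lp.tendsto_Lp_iff_tendsto_eLpNorm''] at h2
    simpa only [ballNorm_eq_eLpNorm] using! h2
  choose g hg hlim using hball
  have hgm (N k : ℕ) (hk : k ≤ N) : ∀ᵐ x, x ∈ Metric.closedBall (0 : E3) k → g k x = g N x := by
    rw [← ae_restrict_iff' measurableSet_closedBall]
    set μ := (volume : Measure E3).restrict (Metric.closedBall 0 (k : ℝ)) with hμ
    have hle : μ ≤ volume.restrict (Metric.closedBall 0 (N : ℝ)) :=
      Measure.restrict_mono_set _ (Metric.closedBall_subset_closedBall (by exact_mod_cast hk))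
    have hgN : MemLp (g N) 1 μ := (hg N).mono_measure hle
    have h1 : Filter.Tendsto (fun n => (ballNorm k fun x => f n x - g k x) + ballNorm N fun x => f n x - g N x)
        Filter.atTop (nhds 0) := by simpa using (hlim k).add (hlim N)
    have h2 : eLpNorm (g k - g N) 1 μ ≤ 0 := by
      refine ge_of_tendsto' h1 fun n => ?_
      have hfn : AEStronglyMeasurable (f n) μ := (hf n).aestronglyMeasurable.restrict
      rw [ballNorm_eq_eLpNorm, ← hμ]
      calc eLpNorm (g k - g N) 1 μ = eLpNorm ((fun x => f n x - g N x) - fun x => f n x - g k x) 1 μ := by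
            congr 1; funext x; simp
        _ ≤ eLpNorm (fun x => f n x - g N x) 1 μ + eLpNorm (fun x => f n x - g k x) 1 μ :=
            eLpNorm_sub_le (hfn.sub hgN.1) (hfn.sub (hg k).1) le_rfl
        _ ≤ _ := by
            rw [add_comm]
            gcongr
            rw [← ballNorm_eq_eLpNorm]
            exact ballNorm_mono (by exact_mod_cast hk) _
    have h3 := (eLpNorm_eq_zero_iff ((hg k).1.sub hgN.1) one_ne_zero).1 (le_antisymm h2 zero_le)
    filter_upwards [h3] with x hx
    simpa [sub_eq_zero] using hx
  set G : E3 → ℝ := fun x => g ⌈‖x‖⌉₊ x with hG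
  have hGN (N : ℕ) : ∀ᵐ x ∂(volume.restrict (Metric.closedBall (0 : E3) N)), G x = g N x := by
    rw [ae_restrict_iff' measurableSet_closedBall]
    have : ∀ᵐ x : E3, ∀ k : ℕ, k ≤ N → x ∈ Metric.closedBall (0 : E3) k → g k x = g N x :=
      ae_all_iff.2 fun k => by
        by_cases hk : k ≤ N
        · filter_upwards [hgm N k hk] with x hx _ using hx
        · exact Filter.Eventually.of_forall fun x h => absurd h hk
    filter_upwards [this] with x hx hxN
    rw [mem_closedBall_zero_iff] at hxN
    exact hx _ (Nat.ceil_le.2 hxN) (mem_closedBall_zero_iff.2 (Nat.le_ceil _))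
  refine ⟨G, locallyIntegrable_iff.2 fun K hK => ?_, fun R => ?_⟩
  · obtain ⟨R, hR⟩ := hK.isBounded.subset_closedBall (0 : E3)
    have h1 : IntegrableOn G (Metric.closedBall (0 : E3) ⌈R⌉₊) :=
      (memLp_one_iff_integrable.1 (hg ⌈R⌉₊)).congr ((hGN _).mono fun x hx => hx.symm)
    exact h1.mono_set (hR.trans (Metric.closedBall_subset_closedBall (Nat.le_ceil R)))
  · refine tendsto_of_tendsto_of_tendsto_of_le_of_le tendsto_const_nhds (hlim ⌈R⌉₊) (fun _ => zero_le) fun n => ?_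
    refine (ballNorm_mono (Nat.le_ceil R) _).trans (le_of_eq (lintegral_congr_ae ?_))
    filter_upwards [hGN ⌈R⌉₊] with x hx
    rw [hx]

/-- Local convergence in `L¹` implies convergence almost everywhere along a subsequence. -/
theorem LocTendsto.exists_subseq {f : ℕ → E3 → ℝ} {g : E3 → ℝ} (hf : ∀ n, AEStronglyMeasurable (f n))
    (hg : AEStronglyMeasurable g) (h : LocTendsto f g) : ∃ φ : ℕ → ℕ, StrictMono φ ∧
      ∀ᵐ x, Filter.Tendsto (fun k => f (φ k) x) Filter.atTop (nhds (g x)) := by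
  -- the distances along the subsequence are summable on every ball
  obtain ⟨φ, hφ, hb⟩ := Filter.extraction_forall_of_eventually'
    (P := fun k n => (ballNorm k fun x => f n x - g x) ≤ (2⁻¹ : ℝ≥0∞) ^ k) fun k =>
    Filter.eventually_atTop.1 ((h k).eventually_le_const (ENNReal.pow_pos (by simp) k))
  refine ⟨φ, hφ, ?_⟩
  have hN (N : ℕ) : ∀ᵐ x, x ∈ Metric.closedBall (0 : E3) N →
      Filter.Tendsto (fun k => f (φ k) x) Filter.atTop (nhds (g x)) := by
    rw [← ae_restrict_iff' measurableSet_closedBall]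
    have hm (k : ℕ) : AEMeasurable (fun x => ‖f (φ (k + N)) x - g x‖ₑ)
        (volume.restrict (Metric.closedBall (0 : E3) N)) := ((hf _).sub hg).enorm.restrict
    have h1 : ∫⁻ x in Metric.closedBall (0 : E3) N, ∑' k, ‖f (φ (k + N)) x - g x‖ₑ ≤ 2 := by
      rw [lintegral_tsum hm]
      calc _ ≤ ∑' k : ℕ, (2⁻¹ : ℝ≥0∞) ^ k := by
            refine ENNReal.tsum_le_tsum fun k => ?_
            calc _ ≤ ballNorm ((k + N : ℕ) : ℝ) fun x => f (φ (k + N)) x - g x :=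
                  ballNorm_mono (by push_cast; linarith [k.cast_nonneg (α := ℝ)]) _
              _ ≤ (2⁻¹ : ℝ≥0∞) ^ (k + N) := hb _
              _ ≤ _ := pow_le_pow_of_le_one zero_le (by simp) (Nat.le_add_right _ _)
        _ = 2 := by rw [ENNReal.tsum_geometric, ENNReal.one_sub_inv_two, inv_inv]
    have h2 := ae_lt_top' (AEMeasurable.tsum hm) (h1.trans_lt (by simp)).ne
    filter_upwards [h2] with x hx
    rw [← Filter.tendsto_add_atTop_iff_nat N, tendsto_iff_edist_tendsto_0]
    simpa only [edist_eq_enorm_sub] using ENNReal.tendsto_atTop_zero_of_tsum_ne_top hx.ne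
  filter_upwards [ae_all_iff.2 hN] with x hx
  exact hx ⌈‖x‖⌉₊ (mem_closedBall_zero_iff.2 (Nat.le_ceil _))

/-- Fatou's lemma for local convergence in `L¹`. -/
theorem LocTendsto.eLpNorm_le {f : ℕ → E3 → ℝ} {g : E3 → ℝ} (hf : ∀ n, AEStronglyMeasurable (f n))
    (hg : AEStronglyMeasurable g) (h : LocTendsto f g) {Λ : ℝ} {p Z : ℝ≥0∞}
    (hZ : ∀ n, eLpNorm (f n) p (cellMeasure Λ) ≤ Z) : eLpNorm g p (cellMeasure Λ) ≤ Z := by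
  obtain ⟨φ, -, hφ⟩ := h.exists_subseq hf hg
  refine (Lp.eLpNorm_lim_le_liminf_eLpNorm (f := fun k => f (φ k)) (fun n => (hf _).restrict) g
    (ae_restrict_of_ae hφ)).trans ?_
  calc _ ≤ Filter.liminf (fun _ : ℕ => Z) Filter.atTop :=
        Filter.liminf_le_liminf (Filter.Eventually.of_forall fun n => hZ _)
    _ = Z := Filter.liminf_const _

/-- The local Cauchy property is inherited by the derivatives of intermediate order. -/
theorem locCauchy_pderivs {m j : ℕ} (hj : j < m) {f : ℕ → E3 → ℝ} (hf : ∀ n, ContDiff ℝ ∞ (f n))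
    (h0 : LocCauchy f) (hm : ∀ I : Fin m → Fin 3, LocCauchy fun n => pderivs (List.ofFn I) (f n))
    (l : List (Fin 3)) (hl : l.length = j) : LocCauchy fun n => pderivs l (f n) := by
  obtain ⟨C, hC⟩ := exists_ballNorm_pderivs_le hj
  intro R
  have h1 : Filter.Tendsto (fun p : ℕ × ℕ => (C : ℝ≥0∞) * ((ballNorm (R + j) fun x => f p.1 x - f p.2 x) +
      ∑ I : Fin m → Fin 3, ballNorm (R + j) fun x => pderivs (List.ofFn I) (f p.1) x -
        pderivs (List.ofFn I) (f p.2) x)) Filter.atTop (nhds (C * (0 + ∑ I : Fin m → Fin 3, 0))) :=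
    ENNReal.Tendsto.const_mul ((h0 _).add (tendsto_finsetSum _ fun I _ => hm I _)) (Or.inr ENNReal.coe_ne_top)
  simp only [Finset.sum_const_zero, add_zero, mul_zero] at h1
  refine tendsto_of_tendsto_of_tendsto_of_le_of_le tendsto_const_nhds h1 (fun _ => zero_le) fun p => ?_
  have := hC _ ((hf p.1).sub (hf p.2)) l hl R
  simpa only [pderivs_sub (hf p.1) (hf p.2)] using this

theorem LocTendsto.tendsto_integral_mul {f : ℕ → E3 → ℝ} {g : E3 → ℝ} (hf : ∀ n, LocallyIntegrable (f n))
    (hg : LocallyIntegrable g) (h : LocTendsto f g) {ψ : E3 → ℝ} (hψ : Continuous ψ)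
    (hc : HasCompactSupport ψ) :
    Filter.Tendsto (fun n => ∫ x, f n x * ψ x) Filter.atTop (nhds (∫ x, g x * ψ x)) := by
  obtain ⟨M, hM⟩ := hc.exists_bound_of_continuous hψ
  obtain ⟨R, hR⟩ := hc.isCompact.isBounded.subset_closedBall (0 : E3)
  have hi (u : E3 → ℝ) (hu : LocallyIntegrable u) : Integrable fun x => u x * ψ x := by
    simpa only [smul_eq_mul] using hu.integrable_smul_right_of_hasCompactSupport hψ hc
  rw [tendsto_iff_edist_tendsto_0]
  have h1 : Filter.Tendsto (fun n => ENNReal.ofReal M * ballNorm R fun x => f n x - g x) Filter.atTop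
      (nhds (ENNReal.ofReal M * 0)) := ENNReal.Tendsto.const_mul (h R) (Or.inr ENNReal.ofReal_ne_top)
  rw [mul_zero] at h1
  refine tendsto_of_tendsto_of_tendsto_of_le_of_le tendsto_const_nhds h1 (fun _ => zero_le) fun n => ?_
  rw [edist_eq_enorm_sub, ← integral_sub (hi _ (hf n)) (hi _ hg)]
  refine (enorm_integral_le_lintegral_enorm _).trans ?_
  rw [ballNorm, ← lintegral_const_mul' _ _ ENNReal.ofReal_ne_top, ← lintegral_indicator measurableSet_closedBall]
  refine lintegral_mono fun x => ?_
  change ‖f n x * ψ x - g x * ψ x‖ₑ ≤ _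
  rw [← sub_mul, enorm_mul]
  by_cases hx : x ∈ Metric.closedBall (0 : E3) R
  · rw [Set.indicator_of_mem hx, mul_comm, Real.enorm_eq_ofReal_abs (ψ x)]
    gcongr; exact hM x
  · rw [image_eq_zero_of_notMem_tsupport fun h => hx (hR h)]
    simp

/-- The tensor with the given components. -/
noncomputable def tensorOf {j : ℕ} (H : (Fin j → Fin 3) → E3 → ℝ) (x : E3) : GradTensor j :=
  WithLp.toLp 2 fun I => H I x

theorem tensorOf_eq_sum {j : ℕ} (H : (Fin j → Fin 3) → E3 → ℝ) :
    tensorOf H = fun x => ∑ I, H I x • (EuclideanSpace.single I (1 : ℝ) : GradTensor j) := by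
  funext x
  ext J
  simp [tensorOf, Pi.single_apply, Finset.sum_ite_eq]

theorem locallyIntegrable_tensorOf {j : ℕ} {H : (Fin j → Fin 3) → E3 → ℝ} (hH : ∀ I, LocallyIntegrable (H I)) :
    LocallyIntegrable (tensorOf H) := by
  rw [tensorOf_eq_sum]
  refine locallyIntegrable_finsetSum _ fun I _ => ?_
  rw [locallyIntegrable_iff]
  intro K hK
  exact ((hH I).integrableOn_isCompact hK).smul_const _

theorem eLpNorm_tensorOf_le {j : ℕ} {H : (Fin j → Fin 3) → E3 → ℝ} {μ : Measure E3}
    (hH : ∀ I, AEStronglyMeasurable (H I) μ) {p Z : ℝ≥0∞} (hp : 1 ≤ p) (hZ : ∀ I, eLpNorm (H I) p μ ≤ Z) :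
    eLpNorm (tensorOf H) p μ ≤ 3 ^ j * Z := by
  have e : tensorOf H = ∑ I, fun x => H I x • (EuclideanSpace.single I (1 : ℝ) : GradTensor j) := by
    rw [tensorOf_eq_sum]; funext x; simp
  rw [e]
  refine (eLpNorm_sum_le (fun I _ => (hH I).smul_const _) hp).trans ?_
  calc _ ≤ ∑ _I : Fin j → Fin 3, Z := by
        refine Finset.sum_le_sum fun I _ => le_trans (eLpNorm_mono fun x => ?_) (hZ I)
        rw [norm_smul]; simp
    _ = _ := by simp

theorem isWeakGradient_tensorOf {j : ℕ} {f : ℕ → E3 → ℝ} (hf : ∀ n, ContDiff ℝ ∞ (f n)) {v : E3 → ℝ}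
    (hv : LocallyIntegrable v) (h0 : LocTendsto f v) {H : (Fin j → Fin 3) → E3 → ℝ}
    (hH : ∀ I, LocallyIntegrable (H I)) (h : ∀ I, LocTendsto (fun n => pderivs (List.ofFn I) (f n)) (H I)) :
    IsWeakGradient j v (tensorOf H) := by
  refine ⟨hv, locallyIntegrable_tensorOf hH, fun φ hφ hc I => ?_⟩
  simp only [iteratedFDeriv_eq_pderivs hφ]
  have h1 := h0.tendsto_integral_mul (fun n => (hf n).continuous.locallyIntegrable) hv
    (contDiff_pderivs hφ (List.ofFn I)).continuous (hasCompactSupport_pderivs hc _)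
  have h2 := (h I).tendsto_integral_mul
    (fun n => (contDiff_pderivs (hf n) (List.ofFn I)).continuous.locallyIntegrable) (hH I) hφ.continuous hc
  have h3 := h2.const_mul ((-1 : ℝ) ^ j)
  refine tendsto_nhds_unique h1 (h3.congr fun n => ?_)
  rw [integral_mul_pderivs (hf n) hφ hc]
  simp

/-- Smooth approximations transfer the Gagliardo-Nirenberg inequality to weak derivatives; the factor
two leaves room for the removal of the transverse mean. -/
theorem exists_isWeakGradient_of_locTendsto {𝒦 : ℝ → (E3 → ℝ) → Prop} (h𝒦 : ∀ Λ u, 𝒦 Λ u → IsNice Λ u)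
    {m j : ℕ} (hj : j < m) {Λ : ℝ} (hΛ : 0 < Λ) {f : ℕ → E3 → ℝ} (hf : ∀ n, 𝒦 Λ (f n)) {v : E3 → ℝ}
    (hv : LocallyIntegrable v) (h0 : LocTendsto f v)
    (hm : ∀ I : Fin m → Fin 3, LocCauchy fun n => pderivs (List.ofFn I) (f n)) {q r A B : ℝ≥0∞}
    (hA : A ≠ ⊤) (hB : B ≠ ⊤)
    (hfA : ∀ X : ℝ, A ≤ ENNReal.ofReal X → ∀ n l, List.length l = m →
      eLpNorm (pderivs l (f n)) r (cellMeasure Λ) ≤ ENNReal.ofReal (2 * X))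
    (hfB : ∀ Y : ℝ, B ≤ ENNReal.ofReal Y → ∀ n, eLpNorm (f n) q (cellMeasure Λ) ≤ ENNReal.ofReal (2 * Y)) :
    ∃ H : E3 → GradTensor j, IsWeakGradient j v H ∧ ∀ (κ : ℝ) (p : ℝ≥0∞) (θ : ℝ), 1 ≤ p → 0 ≤ θ → θ ≤ 1 →
      ∀ h : GNBound 𝒦 κ m j q r p θ, eLpNorm H p (cellMeasure Λ) ≤
        ENNReal.ofReal (2 * 3 ^ j * h.choose * Λ ^ (-(3 * κ - 1) * (m * θ - j))) * A ^ θ * B ^ (1 - θ) := by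
  have hs (n : ℕ) : ContDiff ℝ ∞ (f n) := (h𝒦 _ _ (hf n)).smooth
  have hcau := locCauchy_pderivs hj hs
    (h0.locCauchy (fun n => (hs n).continuous.aestronglyMeasurable) hv.aestronglyMeasurable) hm
  have hex (I : Fin j → Fin 3) := (hcau (List.ofFn I) (by simp)).exists_locTendsto
    fun n => (contDiff_pderivs (hs n) _).continuous.locallyIntegrable
  choose H hHi hHl using hex
  refine ⟨tensorOf H, isWeakGradient_tensorOf hs hv h0 hHi hHl, fun κ p θ hp hθ0 hθ1 h => ?_⟩
  obtain ⟨hC, hb⟩ := h.choose_spec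
  set C := h.choose with hCdef
  set P := Λ ^ (-(3 * κ - 1) * (m * θ - j)) with hP
  have hP0 : 0 < P := Real.rpow_pos_of_pos hΛ _
  have key : ∀ X Y : ℝ, 0 < X → 0 < Y → A ≤ ENNReal.ofReal X → B ≤ ENNReal.ofReal Y →
      eLpNorm (tensorOf H) p (cellMeasure Λ) ≤
        ENNReal.ofReal (2 * 3 ^ j * C * P) * ENNReal.ofReal X ^ θ * ENNReal.ofReal Y ^ (1 - θ) := by
    intro X Y hX hY hAX hBY
    have h1 : ∀ I, eLpNorm (H I) p (cellMeasure Λ) ≤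
        ENNReal.ofReal (C * P * (2 * X) ^ θ * (2 * Y) ^ (1 - θ)) := fun I =>
      (hHl I).eLpNorm_le (fun n => (contDiff_pderivs (hs n) _).continuous.aestronglyMeasurable)
        (hHi I).aestronglyMeasurable fun n => hb Λ hΛ (f n) (hf n) _ _ (by positivity) (by positivity)
          (fun l hl => hfA X hAX n l hl) (hfB Y hBY n) _ (by simp)
    refine (eLpNorm_tensorOf_le (fun I => (hHi I).aestronglyMeasurable.restrict) hp h1).trans (le_of_eq ?_)
    rw [ENNReal.ofReal_rpow_of_pos hX, ENNReal.ofReal_rpow_of_pos hY,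
      show (3 : ℝ≥0∞) ^ j = ENNReal.ofReal (3 ^ j) by rw [ENNReal.ofReal_pow (by norm_num)]; simp,
      ← ENNReal.ofReal_mul (by positivity), ← ENNReal.ofReal_mul (by positivity),
      ← ENNReal.ofReal_mul (by positivity), Real.mul_rpow two_pos.le hX.le, Real.mul_rpow two_pos.le hY.le]
    congr 1
    have h2 : (2 : ℝ) ^ θ * 2 ^ (1 - θ) = 2 := by rw [← Real.rpow_add two_pos]; simp
    linear_combination (3 ^ j * (C * P) * X ^ θ * Y ^ (1 - θ)) * h2
  -- let the upper bounds decrease to the norms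
  have hseq (a : ℝ≥0∞) (ha : a ≠ ⊤) : Filter.Tendsto (fun n : ℕ => ENNReal.ofReal (a.toReal + 1 / ((n : ℝ) + 1)))
      Filter.atTop (nhds a) := by
    have h1 : Filter.Tendsto (fun n : ℕ => a.toReal + 1 / ((n : ℝ) + 1)) Filter.atTop (nhds (a.toReal + 0)) :=
      tendsto_const_nhds.add tendsto_one_div_add_atTop_nhds_zero_nat
    have h2 := (ENNReal.continuous_ofReal.tendsto _).comp h1
    rwa [add_zero, ENNReal.ofReal_toReal ha] at h2
  have hpos (a : ℝ≥0∞) (n : ℕ) : 0 < a.toReal + 1 / ((n : ℝ) + 1) := by positivity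
  have hle (a : ℝ≥0∞) (ha : a ≠ ⊤) (n : ℕ) : a ≤ ENNReal.ofReal (a.toReal + 1 / ((n : ℝ) + 1)) := by
    rw [ENNReal.le_ofReal_iff_toReal_le ha (hpos a n).le]
    have : 0 ≤ 1 / ((n : ℝ) + 1) := by positivity
    linarith
  have hAθ : A ^ θ ≠ ⊤ := ENNReal.rpow_ne_top_of_nonneg hθ0 hA
  have hBθ : B ^ (1 - θ) ≠ ⊤ := ENNReal.rpow_ne_top_of_nonneg (by linarith) hB
  refine ge_of_tendsto' (ENNReal.Tendsto.mul (ENNReal.Tendsto.const_mul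
    ((ENNReal.continuous_rpow_const.tendsto A).comp (hseq A hA)) (Or.inr ENNReal.ofReal_ne_top))
    (Or.inr hBθ) ((ENNReal.continuous_rpow_const.tendsto B).comp (hseq B hB))
    (Or.inr (ENNReal.mul_ne_top ENNReal.ofReal_ne_top hAθ))) fun n => ?_
  exact key _ _ (hpos A n) (hpos B n) (hle A hA n) (hle B hB n)

/-! ### Convolution with a test function -/

/-- The convolution `ψ * f`. -/
noncomputable def smear (ψ f : E3 → ℝ) (x : E3) : ℝ := ∫ t, ψ (x - t) * f t

theorem smear_eq_convolution (ψ f : E3 → ℝ) :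
    smear ψ f = convolution ψ f (ContinuousLinearMap.lsmul ℝ ℝ) volume := by
  funext x
  rw [convolution_lsmul_swap]; rfl

theorem smear_eq_integral_sub (ψ f : E3 → ℝ) (x : E3) : smear ψ f x = ∫ t, ψ t * f (x - t) := by
  rw [smear_eq_convolution, convolution_lsmul]; rfl

theorem contDiff_smear {ψ f : E3 → ℝ} (hψ : ContDiff ℝ ∞ ψ) (hc : HasCompactSupport ψ)
    (hf : LocallyIntegrable f) : ContDiff ℝ ∞ (smear ψ f) := by
  rw [smear_eq_convolution]
  exact hc.contDiff_convolution_left _ hψ hf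

theorem pderiv_smear {ψ f : E3 → ℝ} (hψ : ContDiff ℝ ∞ ψ) (hc : HasCompactSupport ψ)
    (hf : LocallyIntegrable f) (i : Fin 3) : pderiv i (smear ψ f) = smear (pderiv i ψ) f := by
  funext x
  have h := hc.hasFDerivAt_convolution_left (ContinuousLinearMap.lsmul ℝ ℝ) (μ := volume)
    (hψ.of_le (by norm_cast)) hf x
  rw [pderiv, smear_eq_convolution, h.fderiv, smear_eq_convolution]
  have hi := (hc.fderiv (𝕜 := ℝ)).convolutionExists_left
    ((ContinuousLinearMap.lsmul ℝ ℝ).precompL E3) (μ := volume) (hψ.continuous_fderiv (by simp)) hf x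
  unfold convolution
  rw [ContinuousLinearMap.integral_apply hi]
  rfl

theorem pderivs_smear {ψ f : E3 → ℝ} (hψ : ContDiff ℝ ∞ ψ) (hc : HasCompactSupport ψ)
    (hf : LocallyIntegrable f) (l : List (Fin 3)) : pderivs l (smear ψ f) = smear (pderivs l ψ) f := by
  induction l with
  | nil => rfl
  | cons i l ih =>
    rw [pderivs, ih, pderiv_smear (contDiff_pderivs hψ l) (hasCompactSupport_pderivs hc l) hf]; rfl

theorem pderiv_comp_sub_left (i : Fin 3) {ψ : E3 → ℝ} (hψ : ContDiff ℝ ∞ ψ) (x : E3) :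
    pderiv i (fun t => ψ (x - t)) = fun t => -pderiv i ψ (x - t) := by
  funext t
  have h1 : HasFDerivAt (fun t : E3 => x - t) (-ContinuousLinearMap.id ℝ E3) t := (hasFDerivAt_id t).const_sub x
  have h2 := (hψ.differentiable (by simp) (x - t)).hasFDerivAt.comp t h1
  rw [pderiv, show (fun t => ψ (x - t)) = ψ ∘ fun t => x - t from rfl, h2.fderiv]
  simp [pderiv]

theorem pderivs_comp_sub_left {ψ : E3 → ℝ} (hψ : ContDiff ℝ ∞ ψ) (l : List (Fin 3)) (x : E3) :
    pderivs l (fun t => ψ (x - t)) = fun t => (-1) ^ l.length * pderivs l ψ (x - t) := by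
  induction l with
  | nil => simp [pderivs]
  | cons i l ih =>
    have h := pderiv_comp_sub_left i (contDiff_pderivs hψ l) x
    have hs : ContDiff ℝ ∞ fun t => pderivs l ψ (x - t) := (contDiff_pderivs hψ l).comp (by fun_prop)
    rw [pderivs, ih]
    funext t
    rw [pderiv, fderiv_const_mul (hs.differentiable (by simp) t)]
    have := congrFun h t
    rw [pderiv] at this
    simp only [_root_.smul_apply, smul_eq_mul, this, pderivs, List.length_cons]
    ring

/-- The derivatives of order `m` of `ψ * u` are the convolutions of `ψ` with the weak derivatives. -/
theorem IsWeakGradient.pderivs_smear {m : ℕ} {u : E3 → ℝ} {G : E3 → GradTensor m} (h : IsWeakGradient m u G)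
    {ψ : E3 → ℝ} (hψ : ContDiff ℝ ∞ ψ) (hc : HasCompactSupport ψ) (I : Fin m → Fin 3) :
    pderivs (List.ofFn I) (smear ψ u) = smear ψ fun x => G x I := by
  rw [_root_.pderivs_smear hψ hc h.1]
  funext x
  have hs : ContDiff ℝ ∞ fun t => ψ (x - t) := hψ.comp (by fun_prop)
  have hcs : HasCompactSupport fun t => ψ (x - t) := hc.comp_homeomorph (Homeomorph.subLeft x)
  have h1 := h.2.2 _ hs hcs I
  simp only [iteratedFDeriv_eq_pderivs hs, pderivs_comp_sub_left hψ, List.length_ofFn] at h1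
  have h2 : ∀ t, u t * ((-1) ^ m * pderivs (List.ofFn I) ψ (x - t)) =
      (-1) ^ m * (pderivs (List.ofFn I) ψ (x - t) * u t) := fun t => by ring
  simp_rw [h2, integral_const_mul] at h1
  have h3 := mul_left_cancel₀ (pow_ne_zero _ (by norm_num)) h1
  rw [smear, h3, smear]
  simp_rw [mul_comm]

theorem IsTransPeriodic.smear {Λ : ℝ} {f : E3 → ℝ} (hf : IsTransPeriodic Λ f) (ψ : E3 → ℝ) :
    IsTransPeriodic Λ (smear ψ f) := fun x => by
  simp only [smear_eq_integral_sub, add_sub_right_comm, (hf _).1, (hf _).2, and_self]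

theorem smear_congr_ae {ψ f g : E3 → ℝ} (h : f =ᵐ[volume] g) : smear ψ f = smear ψ g := by
  funext x
  exact integral_congr_ae (h.mono fun t ht => by simp [ht])

theorem smear_sub {ψ f g : E3 → ℝ} (hψ : Continuous ψ) (hc : HasCompactSupport ψ) (hf : LocallyIntegrable f)
    (hg : LocallyIntegrable g) (x : E3) : smear ψ (fun t => f t - g t) x = smear ψ f x - smear ψ g x := by
  have h (u : E3 → ℝ) (hu : LocallyIntegrable u) : Integrable fun t => ψ (x - t) * u t := by
    exact hu.integrable_smul_left_of_hasCompactSupport (hψ.comp (continuous_const.sub continuous_id))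
      (hc.comp_homeomorph (Homeomorph.subLeft x))
  simp only [smear, mul_sub]
  exact integral_sub (h f hf) (h g hg)

theorem enorm_smear_le {ψ : E3 → ℝ} (h0 : ∀ x, 0 ≤ ψ x) (hψ : Continuous ψ) {f : E3 → ℝ} (x : E3) :
    ‖smear ψ f x‖ₑ ≤ ∫⁻ s, ‖f (x + -s)‖ₑ ∂(volume.withDensity fun s => ENNReal.ofReal (ψ s)) := by
  rw [smear_eq_integral_sub, lintegral_withDensity_eq_lintegral_mul_non_measurable _
    hψ.measurable.ennreal_ofReal (Filter.Eventually.of_forall fun _ => ENNReal.ofReal_lt_top)]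
  refine (enorm_integral_le_lintegral_enorm _).trans (lintegral_mono fun s => ?_)
  simp [enorm_mul, Real.enorm_of_nonneg (h0 s), sub_eq_add_neg]

/-! ### Mollification of periodic functions -/

/-- Bump functions that shrink to the origin, with support of radius at most `Λ / 2`. -/
noncomputable def shrinkingBump {Λ : ℝ} (hΛ : 0 < Λ) (n : ℕ) : ContDiffBump (0 : E3) where
  rIn := Λ / (4 * (n + 1))
  rOut := Λ / (2 * (n + 1))
  rIn_pos := by positivity
  rIn_lt_rOut := by
    refine div_lt_div_of_pos_left hΛ (by positivity) ?_
    have : (0 : ℝ) ≤ n := n.cast_nonneg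
    linarith

/-- The mollifiers. -/
noncomputable def mollifier {Λ : ℝ} (hΛ : 0 < Λ) (n : ℕ) : E3 → ℝ := (shrinkingBump hΛ n).normed volume

section Mollifier

variable {Λ : ℝ} (hΛ : 0 < Λ)

theorem tendsto_shrinkingBump_rOut :
    Filter.Tendsto (fun n => (shrinkingBump hΛ n).rOut) Filter.atTop (nhds 0) := by
  have h := (tendsto_one_div_add_atTop_nhds_zero_nat (𝕜 := ℝ)).const_mul (Λ / 2)
  rw [mul_zero] at h
  refine h.congr fun n => ?_
  simp only [shrinkingBump]
  field_simp

theorem shrinkingBump_rOut_le (n : ℕ) : (shrinkingBump hΛ n).rOut ≤ Λ / 2 := by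
  simp only [shrinkingBump]
  refine div_le_div_of_nonneg_left hΛ.le two_pos ?_
  have : (0 : ℝ) ≤ n := n.cast_nonneg
  linarith

theorem contDiff_mollifier (n : ℕ) : ContDiff ℝ ∞ (mollifier hΛ n) := ContDiffBump.contDiff_normed _

theorem continuous_mollifier (n : ℕ) : Continuous (mollifier hΛ n) := (contDiff_mollifier hΛ n).continuous

theorem hasCompactSupport_mollifier (n : ℕ) : HasCompactSupport (mollifier hΛ n) :=
  ContDiffBump.hasCompactSupport_normed _

theorem tsupport_mollifier_subset (n : ℕ) :
    tsupport (mollifier hΛ n) ⊆ Metric.closedBall 0 (Λ / 2) := by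
  rw [mollifier, ContDiffBump.tsupport_normed_eq]
  exact Metric.closedBall_subset_closedBall (shrinkingBump_rOut_le hΛ n)

theorem mollifier_nonneg (n : ℕ) (x : E3) : 0 ≤ mollifier hΛ n x := ContDiffBump.nonneg_normed _ _

/-- The probability measure with density `mollifier hΛ n`. -/
noncomputable def mollifierMeasure (n : ℕ) : Measure E3 :=
  volume.withDensity fun s => ENNReal.ofReal (mollifier hΛ n s)

instance (n : ℕ) : IsProbabilityMeasure (mollifierMeasure hΛ n) := ⟨by
  rw [mollifierMeasure, withDensity_apply _ MeasurableSet.univ, Measure.restrict_univ,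
    ← ofReal_integral_eq_lintegral_ofReal ((continuous_mollifier hΛ n).integrable_of_hasCompactSupport
      (hasCompactSupport_mollifier hΛ n)) (Filter.Eventually.of_forall (mollifier_nonneg hΛ n))]
  rw [mollifier, ContDiffBump.integral_normed, ENNReal.ofReal_one]⟩

theorem enorm_smear_mollifier_le (n : ℕ) (f : E3 → ℝ) (x : E3) :
    ‖smear (mollifier hΛ n) f x‖ₑ ≤ ∫⁻ s, ‖f (x + -s)‖ₑ ∂(mollifierMeasure hΛ n) :=
  enorm_smear_le (mollifier_nonneg hΛ n) (continuous_mollifier hΛ n) x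

theorem ae_norm_le_mollifierMeasure (n : ℕ) : ∀ᵐ s ∂(mollifierMeasure hΛ n), ‖-s‖ ≤ Λ := by
  rw [mollifierMeasure, ae_withDensity_iff (continuous_mollifier hΛ n).measurable.ennreal_ofReal]
  refine Filter.Eventually.of_forall fun s hs => ?_
  have : mollifier hΛ n s ≠ 0 := fun h => hs (by simp [h])
  have := mem_closedBall_zero_iff.1 (tsupport_mollifier_subset hΛ n (subset_tsupport _ this))
  rw [norm_neg]; linarith

/-- A locally integrable function with periodic mollifications coincides almost everywhere with an
everywhere periodic one: the limit of the mollifications is taken to be `limUnder`, so that it is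
periodic at the points of divergence, too. -/
theorem exists_periodic_ae_eq {f : E3 → ℝ} (hf : LocallyIntegrable f)
    (h : ∀ n, IsTransPeriodic Λ (smear (mollifier hΛ n) f)) :
    ∃ g : E3 → ℝ, StronglyMeasurable g ∧ IsTransPeriodic Λ g ∧ f =ᵐ[volume] g := by
  refine ⟨fun x => Filter.limUnder Filter.atTop fun n => smear (mollifier hΛ n) f x, ?_, fun x => ?_, ?_⟩
  · exact StronglyMeasurable.limUnder fun n => (contDiff_smear (contDiff_mollifier hΛ n)
      (hasCompactSupport_mollifier hΛ n) hf).continuous.stronglyMeasurable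
  · simp only [(h _ x).1, (h _ x).2, and_self]
  · have := ContDiffBump.ae_convolution_tendsto_right_of_locallyIntegrable (K := 2)
      (tendsto_shrinkingBump_rOut hΛ) (Filter.Eventually.of_forall fun n => ?_) hf
    · filter_upwards [this] with x hx
      simp_rw [smear_eq_convolution]
      exact hx.limUnder_eq.symm
    · simp only [shrinkingBump]
      refine le_of_eq ?_
      field_simp
      norm_num

/-- Mollification does not increase norms over the cell. Only the mollifications are assumed to be periodic:
a weak derivative of a periodic function need be periodic only almost everywhere. -/
theorem eLpNorm_smear_mollifier_le {f : E3 → ℝ} (hf : LocallyIntegrable f)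
    (h : ∀ n, IsTransPeriodic Λ (smear (mollifier hΛ n) f)) {p : ℝ≥0∞} (hp : 1 ≤ p) (n : ℕ) :
    eLpNorm (smear (mollifier hΛ n) f) p (cellMeasure Λ) ≤ eLpNorm f p (cellMeasure Λ) := by
  obtain ⟨g, hg, hgp, hfg⟩ := exists_periodic_ae_eq hΛ hf h
  rw [smear_congr_ae hfg, eLpNorm_congr_ae (μ := cellMeasure Λ) (ae_restrict_of_ae hfg)]
  exact eLpNorm_cell_le_of_le_average hΛ hp hgp hg (mollifierMeasure hΛ n) measurable_neg
    (enorm_smear_mollifier_le hΛ n g)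

theorem ballNorm_smear_mollifier_le {f : E3 → ℝ} (hf : AEStronglyMeasurable f) (n : ℕ) (R : ℝ) :
    ballNorm R (smear (mollifier hΛ n) f) ≤ ballNorm (R + Λ) f := by
  rw [smear_congr_ae hf.ae_eq_mk]
  calc _ ≤ ballNorm (R + Λ) (hf.mk f) :=
        (lintegral_mono fun x => enorm_smear_mollifier_le hΛ n (hf.mk f) x).trans
          (setLIntegral_ball_average_le (F := fun x => ‖hf.mk f x‖ₑ) hf.stronglyMeasurable_mk.enorm
            (mollifierMeasure hΛ n) measurable_neg (ae_norm_le_mollifierMeasure hΛ n) R)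
    _ = _ := lintegral_congr_ae (ae_restrict_of_ae (hf.ae_eq_mk.symm.mono fun x hx => by simp only [hx]))

theorem locTendsto_smear_mollifier_of_continuous {g : E3 → ℝ} (hg : Continuous g) (hc : HasCompactSupport g) :
    LocTendsto (fun n => smear (mollifier hΛ n) g) g := by
  intro R
  rw [ENNReal.tendsto_atTop_zero]
  intro ε hε
  set V := volume (Metric.closedBall (0 : E3) R) with hV
  have hVt : V ≠ ⊤ := measure_closedBall_lt_top.ne
  obtain ⟨δ, hδ, hδε⟩ : ∃ δ : ℝ, 0 < δ ∧ ENNReal.ofReal δ * V ≤ ε := by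
    obtain ⟨δ, hδ, h⟩ := ENNReal.exists_nnreal_pos_mul_lt hVt hε.ne'
    exact ⟨δ, hδ, by simpa using h.le⟩
  obtain ⟨η, hη, hu⟩ := Metric.uniformContinuous_iff.1 (hc.uniformContinuous_of_continuous hg) δ hδ
  obtain ⟨N, hN⟩ := Filter.eventually_atTop.1 ((tendsto_shrinkingBump_rOut hΛ).eventually_lt_const hη)
  refine ⟨N, fun n hn => ?_⟩
  refine le_trans ?_ hδε
  rw [ballNorm, hV, ← setLIntegral_const]
  refine lintegral_mono fun x => ?_
  rw [← edist_eq_enorm_sub, edist_dist]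
  refine ENNReal.ofReal_le_ofReal ?_
  simp only [smear_eq_convolution]
  exact ContDiffBump.dist_normed_convolution_le hg.aestronglyMeasurable fun y hy =>
    (hu ((Metric.mem_ball.1 hy).trans (hN n hn))).le

/-- Mollifications converge locally in `L¹`. -/
theorem locTendsto_smear_mollifier {f : E3 → ℝ} (hf : LocallyIntegrable f) :
    LocTendsto (fun n => smear (mollifier hΛ n) f) f := by
  intro R
  rw [ENNReal.tendsto_atTop_zero]
  intro ε hε
  set B := Metric.closedBall (0 : E3) (R + Λ) with hB
  have hfB : Integrable (B.indicator f) :=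
    (integrable_indicator_iff measurableSet_closedBall).2 (hf.integrableOn_isCompact (isCompact_closedBall _ _))
  have hε3 : ε / 3 ≠ 0 := (ENNReal.div_pos hε.ne' (by simp)).ne'
  obtain ⟨g, hgc, hfg, hg, -⟩ := hfB.exists_hasCompactSupport_lintegral_sub_le hε3
  have hgl : LocallyIntegrable g := hg.locallyIntegrable
  have h1 : ballNorm (R + Λ) (fun x => f x - g x) ≤ ε / 3 := by
    refine le_trans (le_of_eq ?_) ((setLIntegral_le_lintegral B _).trans hfg)
    refine setLIntegral_congr_fun measurableSet_closedBall fun x hx => ?_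
    have hx' : x ∈ B := hx
    simp only [Set.indicator_of_mem hx']
  obtain ⟨N, hN⟩ := (ENNReal.tendsto_atTop_zero.1 (locTendsto_smear_mollifier_of_continuous hΛ hg hgc R))
    (ε / 3) (pos_iff_ne_zero.2 hε3)
  refine ⟨N, fun n hn => ?_⟩
  have hc (u : E3 → ℝ) (hu : LocallyIntegrable u) : AEStronglyMeasurable (smear (mollifier hΛ n) u) :=
    (contDiff_smear (contDiff_mollifier hΛ n) (hasCompactSupport_mollifier hΛ n) hu).continuous.aestronglyMeasurable
  have h2 : ballNorm R (fun x => smear (mollifier hΛ n) f x - smear (mollifier hΛ n) g x) ≤ ε / 3 := by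
    simp_rw [← smear_sub (continuous_mollifier hΛ n) (hasCompactSupport_mollifier hΛ n) hf hgl]
    exact (ballNorm_smear_mollifier_le hΛ (hf.sub hgl).aestronglyMeasurable n R).trans h1
  calc _ ≤ ballNorm R (fun x => smear (mollifier hΛ n) f x - g x) + ballNorm R (fun x => f x - g x) :=
        ballNorm_sub_le (hc f hf) hgl.aestronglyMeasurable R
    _ ≤ (ballNorm R (fun x => smear (mollifier hΛ n) f x - smear (mollifier hΛ n) g x) +
        ballNorm R (fun x => smear (mollifier hΛ n) g x - g x)) + ballNorm R (fun x => f x - g x) := by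
        gcongr
        rw [ballNorm_sub_comm (smear (mollifier hΛ n) g)]
        exact ballNorm_sub_le (hc f hf) (hc g hgl) R
    _ ≤ (ε / 3 + ε / 3) + ε / 3 := by
        gcongr
        · exact hN n hn
        · exact (ballNorm_mono (by linarith) _).trans h1
    _ = ε := by rw [ENNReal.add_thirds]

/-- The mollifications of a function in `L^q(Ω_Λ)` have bounded derivatives of all orders. -/
theorem isNice_smear_mollifier {u : E3 → ℝ} (hu : LocallyIntegrable u) (hp : IsTransPeriodic Λ u) {q : ℝ≥0∞}
    (hq : 1 ≤ q) (hB : eLpNorm u q (cellMeasure Λ) ≠ ⊤) (n : ℕ) : IsNice Λ (smear (mollifier hΛ n) u) where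
  smooth := contDiff_smear (contDiff_mollifier hΛ n) (hasCompactSupport_mollifier hΛ n) hu
  periodic := hp.smear _
  bounded l := by
    obtain ⟨g, hg, hgp, hug⟩ := exists_periodic_ae_eq hΛ hu fun n => hp.smear _
    rw [pderivs_smear (contDiff_mollifier hΛ n) (hasCompactSupport_mollifier hΛ n) hu]
    rw [smear_congr_ae hug]
    rw [eLpNorm_congr_ae (μ := cellMeasure Λ) (ae_restrict_of_ae hug)] at hB
    set ψ := pderivs l (mollifier hΛ n) with hψ
    have hψs : tsupport ψ ⊆ Metric.closedBall 0 (Λ / 2) := by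
      have (l : List (Fin 3)) : tsupport (pderivs l (mollifier hΛ n)) ⊆ tsupport (mollifier hΛ n) := by
        induction l with
        | nil => exact subset_rfl
        | cons i l ih =>
          exact (tsupport_fderiv_apply_subset ℝ (f := pderivs l (mollifier hΛ n)) (stdBasis3 i)).trans ih
      exact (this l).trans (tsupport_mollifier_subset hΛ n)
    obtain ⟨M, hM⟩ := (hasCompactSupport_pderivs (hasCompactSupport_mollifier hΛ n) l).exists_bound_of_continuous
      (contDiff_pderivs (contDiff_mollifier hΛ n) l).continuous
    have hM0 : 0 ≤ M := (norm_nonneg _).trans (hM 0)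
    -- the support of the kernel, shifted by `c`, fits into the box `[0, Λ]³`
    set c : E3 := (Λ / 2) • (stdBasis3 0 + stdBasis3 1 + stdBasis3 2) with hc
    have hci (i : Fin 3) : c i = Λ / 2 := by
      fin_cases i <;> simp [hc, stdBasis3]
    set K := ENNReal.ofReal M * (ENNReal.ofReal (Λ * Λ * Λ) ^ (1 - recip q) * eLpNorm g q (cellMeasure Λ)) with hK
    have hKt : K ≠ ⊤ := ENNReal.mul_ne_top ENNReal.ofReal_ne_top (ENNReal.mul_ne_top
      (ENNReal.rpow_ne_top_of_nonneg (by linarith [recip_le_one hq]) ENNReal.ofReal_ne_top) hB)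
    refine ⟨K.toReal, fun x => ?_⟩
    rw [← Real.norm_eq_abs, ← toReal_enorm]
    refine ENNReal.toReal_mono hKt ?_
    calc ‖smear ψ g x‖ₑ ≤ ∫⁻ t, ‖ψ (x - t) * g t‖ₑ := enorm_integral_le_lintegral_enorm _
      _ = ∫⁻ y, ‖ψ (c - y) * g ((x - c) + y)‖ₑ := by
          rw [← lintegral_add_left_eq_self (fun t => ‖ψ (x - t) * g t‖ₑ) (x - c)]
          refine lintegral_congr fun y => ?_
          congr 3
          abel_nf
      _ ≤ ∫⁻ y in coordBox Λ Λ Λ, ENNReal.ofReal M * ‖g ((x - c) + y)‖ₑ := by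
          rw [← lintegral_indicator (measurableSet_coordBox _ _ _)]
          refine lintegral_mono fun y => ?_
          by_cases hy : y ∈ coordBox Λ Λ Λ
          · rw [Set.indicator_of_mem hy, enorm_mul]
            gcongr
            rw [← ofReal_norm]
            exact ENNReal.ofReal_le_ofReal (hM _)
          · rw [Set.indicator_of_notMem hy, image_eq_zero_of_notMem_tsupport (f := ψ), zero_mul, enorm_zero]
            intro h
            have h1 := mem_closedBall_zero_iff.1 (hψs h)
            have h2 (i : Fin 3) : y i ∈ Set.Icc 0 Λ := by
              have := (PiLp.norm_apply_le (c - y) i).trans h1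
              rw [Real.norm_eq_abs, PiLp.sub_apply, hci, abs_le] at this
              constructor <;> linarith
            exact hy ⟨h2 0, h2 1, h2 2⟩
      _ ≤ K := by
          rw [lintegral_const_mul' _ _ ENNReal.ofReal_ne_top, hK]
          gcongr
          exact setLIntegral_coordBox_le hΛ hq hgp hg hΛ.le hΛ.le le_rfl le_rfl _

end Mollifier

/-! ### The decomposition -/

theorem locallyIntegrable_component {j : ℕ} {G : E3 → GradTensor j} (hG : LocallyIntegrable G)
    (I : Fin j → Fin 3) : LocallyIntegrable fun x => G x I :=
  hG.mono ((by fun_prop : Continuous fun y : GradTensor j => y I).comp_aestronglyMeasurable hG.aestronglyMeasurable)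
    (Filter.Eventually.of_forall fun _ => PiLp.norm_apply_le _ _)

theorem IsWeakGradient.add {j : ℕ} {u v : E3 → ℝ} {G H : E3 → GradTensor j} (hu : IsWeakGradient j u G)
    (hv : IsWeakGradient j v H) : IsWeakGradient j (fun x => u x + v x) (fun x => G x + H x) := by
  refine ⟨hu.1.add hv.1, hu.2.1.add hv.2.1, fun φ hφ hc I => ?_⟩
  have hi (f ψ : E3 → ℝ) (hf : LocallyIntegrable f) (hψ : Continuous ψ) (hcψ : HasCompactSupport ψ) :
      Integrable fun x => f x * ψ x :=
    hf.integrable_smul_right_of_hasCompactSupport hψ hcψ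
  have hd := (contDiff_pderivs hφ (List.ofFn I)).continuous
  have hcd := hasCompactSupport_pderivs hc (List.ofFn I)
  have h1 := hu.2.2 φ hφ hc I
  have h2 := hv.2.2 φ hφ hc I
  simp only [iteratedFDeriv_eq_pderivs hφ] at h1 h2 ⊢
  simp only [PiLp.add_apply, add_mul]
  rw [integral_add (hi _ _ hu.1 hd hcd) (hi _ _ hv.1 hd hcd),
    integral_add (hi _ _ (locallyIntegrable_component hu.2.1 I) hφ.continuous hc) (hi _ _ (locallyIntegrable_component hv.2.1 I) hφ.continuous hc),
    h1, h2, mul_add]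

theorem isWeakGradient_zero (j : ℕ) : IsWeakGradient j (fun _ => 0) fun _ => 0 :=
  ⟨locallyIntegrable_zero, locallyIntegrable_zero, fun _ _ _ _ => by simp⟩

theorem isWeakGradient_tensorOf_self {u : E3 → ℝ} (hu : LocallyIntegrable u) :
    IsWeakGradient 0 u (tensorOf fun _ => u) :=
  ⟨hu, locallyIntegrable_tensorOf fun _ => hu, fun φ _ _ I => by simp [tensorOf]⟩

/-- The transverse mean is continuous with respect to local convergence in `L¹`. -/
theorem LocCauchy.transMean {Λ : ℝ} (hΛ : 0 < Λ) {f : ℕ → E3 → ℝ} (hf : ∀ n, IsNice Λ (f n))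
    (h : LocCauchy f) : LocCauchy fun n => transMean Λ (f n) := by
  intro R
  refine tendsto_of_tendsto_of_tendsto_of_le_of_le tendsto_const_nhds (h (R + 2 * Λ)) (fun _ => zero_le)
    fun p => ?_
  have e : (fun x => _root_.transMean Λ (f p.1) x - _root_.transMean Λ (f p.2) x) =
      _root_.transMean Λ fun x => f p.1 x - f p.2 x := by
    funext x
    exact (integral_sub ((hf _).integrable_shift hΛ x) ((hf _).integrable_shift hΛ x)).symm
  simp only [e]
  exact ballNorm_transMean_le hΛ ((hf _).sub (hf _)).stronglyMeasurable.measurable R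

theorem LocCauchy.sub {f g : ℕ → E3 → ℝ} (hf : ∀ n, AEStronglyMeasurable (f n))
    (hfc : LocCauchy f) (hgc : LocCauchy g) :
    LocCauchy fun n x => f n x - g n x := by
  intro R
  have h := (hfc R).add (hgc R)
  rw [add_zero] at h
  refine tendsto_of_tendsto_of_tendsto_of_le_of_le tendsto_const_nhds h (fun _ => zero_le) fun p => ?_
  have e : (fun x => f p.1 x - g p.1 x - (f p.2 x - g p.2 x)) =
      fun x => (f p.1 x - f p.2 x) - (g p.1 x - g p.2 x) := by funext x; ring
  simp only [e]
  refine (ballNorm_sub_le (g := fun _ => 0) ((hf _).sub (hf _)) aestronglyMeasurable_const R).trans (le_of_eq ?_)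
  simp

theorem LocTendsto.sub {f g : ℕ → E3 → ℝ} {u v : E3 → ℝ} (hf : ∀ n, AEStronglyMeasurable (f n))
    (hu : AEStronglyMeasurable u) (hfu : LocTendsto f u) (hgv : LocTendsto g v) :
    LocTendsto (fun n x => f n x - g n x) fun x => u x - v x := by
  intro R
  have h := (hfu R).add (hgv R)
  rw [add_zero] at h
  refine tendsto_of_tendsto_of_tendsto_of_le_of_le tendsto_const_nhds h (fun _ => zero_le) fun n => ?_
  have e : (fun x => f n x - g n x - (u x - v x)) = fun x => (f n x - u x) + -(g n x - v x) := by
    funext x; ring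
  simp only [e]
  refine (ballNorm_add_le ((hf n).sub hu) R).trans (le_of_eq ?_)
  simp only [ballNorm, enorm_neg, Pi.sub_apply]

/-- The function `v` has weak derivatives of all orders `j < m` which satisfy every Gagliardo-Nirenberg
inequality that holds in the class `𝒦`, with `A` and `B` in place of `‖∇^m v‖_r` and `‖v‖_q`. -/
def InheritsGNBounds (𝒦 : ℝ → (E3 → ℝ) → Prop) (Λ : ℝ) (m : ℕ) (q r A B : ℝ≥0∞) (v : E3 → ℝ) : Prop :=
  ∀ j < m, ∃ H : E3 → GradTensor j, IsWeakGradient j v H ∧ ∀ (κ : ℝ) (p : ℝ≥0∞) (θ : ℝ), 1 ≤ p → 0 ≤ θ → θ ≤ 1 →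
    ∀ h : GNBound 𝒦 κ m j q r p θ, eLpNorm H p (cellMeasure Λ) ≤
      ENNReal.ofReal (2 * 3 ^ j * h.choose * Λ ^ (-(3 * κ - 1) * (m * θ - j))) * A ^ θ * B ^ (1 - θ)

/-- The decomposition into the transverse mean and a remainder. The transverse mean is obtained as the
limit of the transverse means of mollifications. -/
theorem exists_decomposition {Λ : ℝ} (hΛ : 0 < Λ) {m : ℕ} {q r : ℝ≥0∞} (hq : 1 ≤ q) (hr : 1 ≤ r) {u : E3 → ℝ}
    {G : E3 → GradTensor m} (hp : IsTransPeriodic Λ u) (huq : MemLp u q (cellMeasure Λ))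
    (hG : IsWeakGradient m u G) (hGr : MemLp G r (cellMeasure Λ)) :
    ∃ v : E3 → ℝ, IsTransPeriodic Λ v ∧
      InheritsGNBounds LongitudinalClass Λ m q r (eLpNorm G r (cellMeasure Λ)) (eLpNorm u q (cellMeasure Λ)) v ∧
      InheritsGNBounds MeanZeroClass Λ m q r (eLpNorm G r (cellMeasure Λ)) (eLpNorm u q (cellMeasure Λ))
        fun x => u x - v x := by
  set A := eLpNorm G r (cellMeasure Λ) with hA
  set B := eLpNorm u q (cellMeasure Λ) with hB
  have hAt : A ≠ ⊤ := hGr.2.ne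
  have hBt : B ≠ ⊤ := huq.2.ne
  set f : ℕ → E3 → ℝ := fun n => smear (mollifier hΛ n) u with hf
  have hn (n : ℕ) : IsNice Λ (f n) := isNice_smear_mollifier hΛ hG.1 hp hq hBt n
  have hsm (n : ℕ) (l : List (Fin 3)) : AEStronglyMeasurable (pderivs l (f n)) :=
    ((hn n).pderivs l).stronglyMeasurable.aestronglyMeasurable
  have hfu : LocTendsto f u := locTendsto_smear_mollifier hΛ hG.1
  have hder (n : ℕ) (I : Fin m → Fin 3) : pderivs (List.ofFn I) (f n) = smear (mollifier hΛ n) fun x => G x I :=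
    hG.pderivs_smear (contDiff_mollifier hΛ n) (hasCompactSupport_mollifier hΛ n) I
  have hfm (I : Fin m → Fin 3) : LocCauchy fun n => pderivs (List.ofFn I) (f n) := by
    refine LocTendsto.locCauchy (fun n => hsm n _) (locallyIntegrable_component hG.2.1 I).aestronglyMeasurable ?_
    simp only [hder]
    exact locTendsto_smear_mollifier hΛ (locallyIntegrable_component hG.2.1 I)
  have hf0 : LocCauchy f := hfu.locCauchy (fun n => hsm n []) hG.1.aestronglyMeasurable
  have hfA (n : ℕ) (l : List (Fin 3)) (hl : l.length = m) : eLpNorm (pderivs l (f n)) r (cellMeasure Λ) ≤ A := by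
    subst hl
    have hd := fun n => hder n l.get
    simp only [List.ofFn_get] at hd
    rw [hd]
    refine (eLpNorm_smear_mollifier_le hΛ (locallyIntegrable_component hG.2.1 l.get) (fun n => ?_) hr n).trans
      (eLpNorm_mono fun x => PiLp.norm_apply_le _ _)
    rw [← hd]
    exact ((hn n).pderivs l).periodic
  have hfB (n : ℕ) : eLpNorm (f n) q (cellMeasure Λ) ≤ B :=
    eLpNorm_smear_mollifier_le hΛ hG.1 (fun n => hp.smear _) hq n
  have htwo {X : ℝ} {a : ℝ≥0∞} (h : a ≤ ENNReal.ofReal X) : a ≤ ENNReal.ofReal (2 * X) := by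
    rw [ENNReal.ofReal_mul zero_le_two, ENNReal.ofReal_ofNat]
    exact h.trans (le_mul_of_one_le_left zero_le one_le_two)
  set g : ℕ → E3 → ℝ := fun n => transMean Λ (f n) with hg
  have hgn (n : ℕ) : IsNice Λ (g n) := (hn n).transMean hΛ
  have hgsm (n : ℕ) (l : List (Fin 3)) : AEStronglyMeasurable (pderivs l (g n)) :=
    ((hgn n).pderivs l).stronglyMeasurable.aestronglyMeasurable
  have hg0 : LocCauchy g := hf0.transMean hΛ hn
  have hgd (n : ℕ) (l : List (Fin 3)) : pderivs l (g n) = transMean Λ (pderivs l (f n)) :=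
    (hn n).pderivs_transMean hΛ l
  have hgm (I : Fin m → Fin 3) : LocCauchy fun n => pderivs (List.ofFn I) (g n) := by
    simp only [hgd]
    exact (hfm I).transMean hΛ fun n => (hn n).pderivs _
  obtain ⟨V, hV, hgV⟩ := hg0.exists_locTendsto fun n => (hgn n).smooth.continuous.locallyIntegrable
  obtain ⟨φ, -, hφ⟩ := hgV.exists_subseq (fun n => hgsm n []) hV.aestronglyMeasurable
  -- `limUnder` depends on the values of the sequence at `x` alone; therefore `v` is periodic everywhere, also
  -- where the sequence diverges
  set v : E3 → ℝ := fun x => Filter.limUnder Filter.atTop fun k => g (φ k) x with hv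
  have hvV : V =ᵐ[volume] v := hφ.mono fun x hx => hx.limUnder_eq.symm
  have hvl : LocallyIntegrable v := locallyIntegrable_iff.2 fun K hK =>
    (hV.integrableOn_isCompact hK).congr (ae_restrict_of_ae hvV)
  have hgv : LocTendsto g v := fun R => (hgV R).congr fun n =>
    lintegral_congr_ae (ae_restrict_of_ae (hvV.mono fun x hx => by simp only [hx]))
  refine ⟨v, fun x => ?_, fun j hj => ?_, fun j hj => ?_⟩
  · simp only [hv, ((hgn _).periodic x).1, ((hgn _).periodic x).2, and_self]
  · refine exists_isWeakGradient_of_locTendsto (fun _ _ h => h.1) hj hΛ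
      (fun n => (hn n).longitudinalClass_transMean hΛ) hvl hgv hgm hAt hBt (fun X hX n l hl => htwo ?_)
      fun Y hY n => htwo ?_
    · rw [(hn n).pderivs_transMean hΛ]
      exact (eLpNorm_transMean_le hΛ ((hn n).pderivs l) hr).trans ((hfA n l hl).trans hX)
    · exact (eLpNorm_transMean_le hΛ (hn n) hq).trans ((hfB n).trans hY)
  · have hd (n : ℕ) (l : List (Fin 3)) : pderivs l (fun x => f n x - transMean Λ (f n) x) =
        fun x => pderivs l (f n) x - transMean Λ (pderivs l (f n)) x := by
      rw [pderivs_sub (hn n).smooth (hgn n).smooth, ← hgd]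
    refine exists_isWeakGradient_of_locTendsto (fun _ _ h => h.1) hj hΛ
      (fun n => (hn n).meanZeroClass_sub_transMean hΛ) (hG.1.sub hvl)
      (LocTendsto.sub (fun n => hsm n []) hG.1.aestronglyMeasurable hfu hgv) (fun I => ?_) hAt hBt
      (fun X hX n l hl => ?_) fun Y hY n => ?_
    · simp only [hd, ← hgd]
      exact LocCauchy.sub (fun n => hsm n _) (hfm I) (hgm I)
    · rw [hd]
      exact eLpNorm_sub_transMean_le hΛ ((hn n).pderivs l) hr ((hfA n l hl).trans hX)
    · exact eLpNorm_sub_transMean_le hΛ (hn n) hq ((hfB n).trans hY)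

/-! ### The Gagliardo-Nirenberg inequality -/

open Classical in
/-- The constant in the inequality for limits of functions in the class `𝒦`; its value is `1` if there is
no such inequality. -/
noncomputable def limitConst (𝒦 : ℝ → (E3 → ℝ) → Prop) (κ : ℝ) (m : ℕ) (q r : ℝ≥0∞) (j : ℕ) (p : ℝ≥0∞)
    (θ : ℝ) : ℝ := if h : GNBound 𝒦 κ m j q r p θ then 2 * 3 ^ j * h.choose else 1

theorem limitConst_pos (𝒦 : ℝ → (E3 → ℝ) → Prop) (κ : ℝ) (m : ℕ) (q r : ℝ≥0∞) (j : ℕ) (p : ℝ≥0∞) (θ : ℝ) :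
    0 < limitConst 𝒦 κ m q r j p θ := by
  unfold limitConst
  split_ifs with h
  · have := h.choose_spec.1
    positivity
  · exact one_pos

/-- For `j = 0` and `θ = 0` the right-hand side is `‖u‖_q`. -/
theorem eLpNorm_le_of_theta_eq_zero {Λ : ℝ} {q : ℝ≥0∞} (hq : 1 ≤ q) {u : E3 → ℝ}
    (hu : LocallyIntegrable u) (A : ℝ≥0∞) (k m : ℕ) :
    eLpNorm (tensorOf fun _ : Fin 0 → Fin 3 => u) q (cellMeasure Λ) ≤
      ENNReal.ofReal (periodFactor Λ k m 0 0) * A ^ (0 : ℝ) * eLpNorm u q (cellMeasure Λ) ^ (1 - 0 : ℝ) := by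
  have h := eLpNorm_tensorOf_le (j := 0) (H := fun _ => u) (μ := cellMeasure Λ)
    (fun _ => hu.aestronglyMeasurable.restrict) hq fun _ => le_rfl
  simpa [periodFactor] using h

/-- In a degenerate case, the inequality for the other of the dimensions `1` and `3` is the trivial one. -/
theorem theta_eq_zero_of_degenerate {m j : ℕ} {q r p : ℝ≥0∞} {θ : ℕ → ℝ} (hm : 1 ≤ m) (hp : 1 ≤ p)
    (h1 : GNRelation 1 m j q r p (θ 1)) (h3 : GNRelation 3 m j q r p (θ 3))
    (h : GNDegenerate 1 m j q r (θ 1) ∨ GNDegenerate 3 m j q r (θ 3)) :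
    j = 0 ∧ q = ⊤ ∧ p = ⊤ ∧ (θ 1 = 0 ∨ θ 3 = 0) := by
  obtain ⟨e1, -⟩ := h1
  obtain ⟨e3, -⟩ := h3
  rcases h with ⟨rfl, rfl, -, ⟨-, rfl, rfl⟩ | ⟨h, -⟩⟩ | ⟨rfl, rfl, -, ⟨h, -⟩ | ⟨-, -, hr⟩⟩
  · have h1 : recip 1 = 1 := by simp [recip]
    simp only [recip_top, h1] at e1 e3
    have hp0 : recip p = 0 := by rw [e1]; simp
    refine ⟨rfl, rfl, (recip_eq_zero_iff hp).1 hp0, Or.inr ?_⟩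
    rw [hp0] at e3
    push_cast at e3
    linarith
  · omega
  · omega
  · simp only [recip_top] at e1 e3
    have hp0 : recip p = 0 := by
      rw [e3, hr]; push_cast; ring
    refine ⟨rfl, rfl, (recip_eq_zero_iff hp).1 hp0, Or.inl ?_⟩
    rw [hp0] at e1
    have hm' : (1 : ℝ) ≤ m := by exact_mod_cast hm
    have e : (recip r - m) * θ 1 = 0 := by
      push_cast at e1; linarith
    rcases mul_eq_zero.1 e with h | h
    · linarith
    · exact h

theorem lemma2p5 (m : ℕ) (hm : 1 ≤ m) (q r : ℝ≥0∞) (hq : 1 ≤ q) (hr : 1 ≤ r) :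
    (∃ C : ℕ → ℕ → ℝ≥0∞ → ℝ → ℝ, (∀ k j p θ, 0 < C k j p θ) ∧
      ∀ Λ : ℝ, 0 < Λ → ∀ (u : E3 → ℝ) (G : E3 → GradTensor m),
        TransversallyPeriodic Λ u → MemLp u q (cellMeasure Λ) →
        IsWeakGradient m u G → MemLp G r (cellMeasure Λ) →
        ∃ v : ℕ → E3 → ℝ, (∀ x, u x = ∑ k ∈ Finset.Icc 1 3, v k x) ∧
          ∀ k ∈ Finset.Icc 1 3, TransversallyPeriodic Λ (v k) ∧
            ∀ j < m, ∃ H : E3 → GradTensor j, IsWeakGradient j (v k) H ∧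
              ∀ (p : ℝ≥0∞) (θ : ℝ), 1 ≤ p → GNRelation k m j q r p θ →
                ¬ (k = 3 ∧ GNCritical m j r θ) → ¬ GNDegenerate k m j q r θ →
                eLpNorm H p (cellMeasure Λ) ≤
                  ENNReal.ofReal (C k j p θ * periodFactor Λ k m j θ) *
                    eLpNorm G r (cellMeasure Λ) ^ θ *
                    eLpNorm u q (cellMeasure Λ) ^ (1 - θ)) ∧
    (∀ j < m, ∀ (p : ℝ≥0∞) (θ : ℕ → ℝ), 1 ≤ p →
      (∀ k ∈ Finset.Icc 1 3, GNRelation k m j q r p (θ k)) →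
      ¬ GNCritical m j r (θ 3) →
      ∃ C : ℝ, 0 < C ∧
        ∀ Λ : ℝ, 0 < Λ → ∀ (u : E3 → ℝ) (G : E3 → GradTensor m),
          TransversallyPeriodic Λ u → MemLp u q (cellMeasure Λ) →
          IsWeakGradient m u G → MemLp G r (cellMeasure Λ) →
          ∃ H : E3 → GradTensor j, IsWeakGradient j u H ∧
            eLpNorm H p (cellMeasure Λ) ≤
              ENNReal.ofReal C * ∑ k ∈ Finset.Icc 1 3,
                ENNReal.ofReal (periodFactor Λ k m j (θ k)) *
                  eLpNorm G r (cellMeasure Λ) ^ (θ k) *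
                  eLpNorm u q (cellMeasure Λ) ^ (1 - θ k)) := by
  have hIcc : Finset.Icc 1 3 = ({1, 2, 3} : Finset ℕ) := rfl
  set C1 := limitConst LongitudinalClass 1 m q r with hC1
  set C3 := limitConst MeanZeroClass (1 / 3) m q r with hC3
  have hC1p : ∀ j p θ, 0 < C1 j p θ := limitConst_pos _ _ _ _ _
  have hC3p : ∀ j p θ, 0 < C3 j p θ := limitConst_pos _ _ _ _ _
  have hθ {k j : ℕ} {p : ℝ≥0∞} {θ : ℝ} (h : GNRelation k m j q r p θ) : 0 ≤ θ ∧ θ ≤ 1 :=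
    ⟨le_trans (by positivity) h.2.1, h.2.2⟩
  have pf1 (Λ : ℝ) (j : ℕ) (θ : ℝ) : Λ ^ (-(3 * 1 - 1 : ℝ) * (m * θ - j)) = periodFactor Λ 1 m j θ := by
    rw [periodFactor]; norm_num
  have pf3 (Λ : ℝ) (j : ℕ) (θ : ℝ) : Λ ^ (-(3 * (1 / 3) - 1 : ℝ) * (m * θ - j)) = periodFactor Λ 3 m j θ := by
    rw [periodFactor]; norm_num
  have main (Λ : ℝ) (hΛ : 0 < Λ) (u : E3 → ℝ) (G : E3 → GradTensor m) (hp : TransversallyPeriodic Λ u)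
      (huq : MemLp u q (cellMeasure Λ)) (hG : IsWeakGradient m u G) (hGr : MemLp G r (cellMeasure Λ)) :
      ∃ v : E3 → ℝ, TransversallyPeriodic Λ v ∧
        (∀ j < m, ∃ H : E3 → GradTensor j, IsWeakGradient j v H ∧ ∀ (p : ℝ≥0∞) (θ : ℝ), 1 ≤ p →
          GNRelation 1 m j q r p θ → ¬ GNDegenerate 1 m j q r θ → eLpNorm H p (cellMeasure Λ) ≤
            ENNReal.ofReal (C1 j p θ * periodFactor Λ 1 m j θ) * eLpNorm G r (cellMeasure Λ) ^ θ *
              eLpNorm u q (cellMeasure Λ) ^ (1 - θ)) ∧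
        (∀ j < m, ∃ H : E3 → GradTensor j, IsWeakGradient j (fun x => u x - v x) H ∧ ∀ (p : ℝ≥0∞) (θ : ℝ), 1 ≤ p →
          GNRelation 3 m j q r p θ → ¬ GNCritical m j r θ → ¬ GNDegenerate 3 m j q r θ →
            eLpNorm H p (cellMeasure Λ) ≤
            ENNReal.ofReal (C3 j p θ * periodFactor Λ 3 m j θ) * eLpNorm G r (cellMeasure Λ) ^ θ *
              eLpNorm u q (cellMeasure Λ) ^ (1 - θ)) := by
    obtain ⟨v, hv, h1, h3⟩ := exists_decomposition hΛ hq hr hp huq hG hGr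
    refine ⟨v, hv, fun j hj => ?_, fun j hj => ?_⟩
    · obtain ⟨H, hH, hb⟩ := h1 j hj
      refine ⟨H, hH, fun p θ hp hR hd => ?_⟩
      have h := gnBound_of_isLongitudinal hj hq hr hp hR hd
      have := hb 1 p θ hp (hθ hR).1 (hθ hR).2 h
      rwa [pf1, show 2 * 3 ^ j * h.choose = C1 j p θ by rw [hC1, limitConst, dif_pos h]] at this
    · obtain ⟨H, hH, hb⟩ := h3 j hj
      refine ⟨H, hH, fun p θ hp hR hc hd => ?_⟩
      have h := gnBound_of_isMeanZero hj hq hr hp hR hc hd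
      have := hb (1 / 3) p θ hp (hθ hR).1 (hθ hR).2 h
      rwa [pf3, show 2 * 3 ^ j * h.choose = C3 j p θ by rw [hC3, limitConst, dif_pos h]] at this
  constructor
  · refine ⟨fun k => if k = 1 then C1 else C3, fun k j p θ => ?_, fun Λ hΛ u G hp huq hG hGr => ?_⟩
    · dsimp only
      split_ifs
      exacts [hC1p j p θ, hC3p j p θ]
    obtain ⟨v, hv, h1, h3⟩ := main Λ hΛ u G hp huq hG hGr
    refine ⟨fun k => if k = 1 then v else if k = 3 then fun x => u x - v x else fun _ => 0, fun x => ?_, ?_⟩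
    · simp [hIcc]
    simp only [hIcc, Finset.mem_insert, Finset.mem_singleton, forall_eq_or_imp, forall_eq]
    refine ⟨⟨hv, fun j hj => ?_⟩, ⟨fun x => by simp, fun j hj => ?_⟩, ⟨fun x => ?_, fun j hj => ?_⟩⟩
    · obtain ⟨H, hH, hb⟩ := h1 j hj
      exact ⟨H, hH, fun p θ hp hR _ hd => hb p θ hp hR hd⟩
    · exact ⟨fun _ => 0, isWeakGradient_zero j, fun p θ _ _ _ _ => by simp⟩
    · simp [(hp x).1, (hp x).2, (hv x).1, (hv x).2]
    · obtain ⟨H, hH, hb⟩ := h3 j hj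
      exact ⟨H, hH, fun p θ hp hR hc hd => hb p θ hp hR (fun h => hc ⟨trivial, h⟩) hd⟩
  · intro j hj p θ hp hR hc
    have hR1 := hR 1 (by simp)
    have hR3 := hR 3 (by simp)
    simp only [hIcc]
    -- in the degenerate cases, one summand of the right-hand side is `‖u‖_∞`, which is the left-hand side
    by_cases hd : GNDegenerate 1 m j q r (θ 1) ∨ GNDegenerate 3 m j q r (θ 3)
    · obtain ⟨rfl, rfl, rfl, h0⟩ := theta_eq_zero_of_degenerate hm hp hR1 hR3 hd
      obtain ⟨k, hk, hk0⟩ : ∃ k ∈ ({1, 2, 3} : Finset ℕ), θ k = 0 :=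
        h0.elim (fun h => ⟨1, by simp, h⟩) fun h => ⟨3, by simp, h⟩
      refine ⟨1, one_pos, fun Λ hΛ u G _ _ hG _ => ⟨_, isWeakGradient_tensorOf_self hG.1, ?_⟩⟩
      rw [ENNReal.ofReal_one, one_mul]
      refine le_trans ?_ (Finset.single_le_sum (fun _ _ => zero_le) hk)
      rw [hk0]
      exact eLpNorm_le_of_theta_eq_zero le_top hG.1 _ k m
    · push Not at hd
      refine ⟨C1 j p (θ 1) + C3 j p (θ 3), add_pos (hC1p _ _ _) (hC3p _ _ _), fun Λ hΛ u G hper huq hG hGr => ?_⟩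
      obtain ⟨v, -, h1, h3⟩ := main Λ hΛ u G hper huq hG hGr
      obtain ⟨H1, hH1, hb1⟩ := h1 j hj
      obtain ⟨H3, hH3, hb3⟩ := h3 j hj
      have hadd := hH1.add hH3
      simp only [add_sub_cancel] at hadd
      refine ⟨fun x => H1 x + H3 x, hadd, ?_⟩
      refine (eLpNorm_add_le hH1.2.1.aestronglyMeasurable.restrict hH3.2.1.aestronglyMeasurable.restrict hp).trans ?_
      refine (add_le_add (hb1 p (θ 1) hp hR1 hd.1) (hb3 p (θ 3) hp hR3 hc hd.2)).trans ?_
      rw [ENNReal.ofReal_mul (hC1p _ _ _).le, ENNReal.ofReal_mul (hC3p _ _ _).le,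
        ENNReal.ofReal_add (hC1p _ _ _).le (hC3p _ _ _).le, add_mul, mul_assoc (ENNReal.ofReal (C1 _ _ _)),
        mul_assoc (ENNReal.ofReal (C1 _ _ _)), mul_assoc (ENNReal.ofReal (C3 _ _ _)),
        mul_assoc (ENNReal.ofReal (C3 _ _ _))]
      refine add_le_add (mul_le_mul_right ?_ _) (mul_le_mul_right ?_ _)
      · exact Finset.single_le_sum (f := fun k => ENNReal.ofReal (periodFactor Λ k m j (θ k)) *
          eLpNorm G r (cellMeasure Λ) ^ (θ k) * eLpNorm u q (cellMeasure Λ) ^ (1 - θ k))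
          (fun _ _ => zero_le) (by simp : 1 ∈ ({1, 2, 3} : Finset ℕ))
      · exact Finset.single_le_sum (f := fun k => ENNReal.ofReal (periodFactor Λ k m j (θ k)) *
          eLpNorm G r (cellMeasure Λ) ^ (θ k) * eLpNorm u q (cellMeasure Λ) ^ (1 - θ k))
          (fun _ _ => zero_le) (by simp : 3 ∈ ({1, 2, 3} : Finset ℕ))
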